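/- Let $k$ be a field of characteristic $0$ and let $A$ be a Poisson algebra over $k$: a commutative (unital, associative) $k$-algebra with product $\mu$ and with a $k$-bilinear skew-symmetric bracket $\mu_p=\{\cdot,\cdot\}$ that is a derivation in each argument and satisfies the Jacobi identity. *The dgla.* For $n\ge 1$ let $C^n(A)$ be the space of $k$-multilinear maps $A^n\to A$. For $f\in C^m(A)$, $g\in C^n(A)$ let $[f,g]=f\circ g-(-1)^{(m+1)(n+1)}g\circ f\in C^{m+n-1}(A)$ be the Gerstenhaber bracket, where $$(f\circ g)(a_1,\dots,a_{m+n-1})=\sum_{i=1}^m(-1)^{(i-1)(n+1)}f(a_1,\dots,a_{i-1},g(a_i,\dots,a_{i+n-1}),a_{i+n},\dots,a_{m+n-1}).$$ Let $s_n=\sum_{i=1}^{n-1}\sum_\pi \operatorname{sgn}(\pi)\,\pi$, the inner sum running over the $\pi\in S_n$ with $\pi(1)<\dots<\pi(i)$ and $\pi(i+1)<\dots<\pi(n)$, where $\pi$ acts on $A^{\otimes n}$ by moving the $a$-th factor to position $\pi(a)$. Let $C^n_{(i)}(A)=\{f\in C^n(A)\mid f\circ s_n=(2^i-2)f\}$ be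 the Hodge pieces, so that $C^n(A)=\bigoplus_{i=1}^n C^n_{(i)}(A)$, and let $e_n(i)=\prod_{1\le j\le n,\,j\ne i}\frac{s_n-(2^j-2)}{2^i-2^j}$ be the projector onto $C^n_{(i)}(A)$. For $f\in C^m(A)$, $g\in C^n(A)$ with Hodge components $f_i$, $g_j$ put $$[f,g]_p=\sum_{i=1}^m\sum_{j=1}^n e_{m+n-1}(i+j-1)\,[f_i,g_j]\in C^{m+n-1}(A).$$ Let $\mathfrak g=C^{\bullet}_p(A)[1]$ be the graded vector space with $\mathfrak g^{n}=C^{n+1}(A)=\bigoplus_{i=1}^{n+1}C^{n+1}_{(i)}(A)$ for $n\ge 0$ and $\mathfrak g^n=0$ for $n<0$, with the bracket $[\cdot,\cdot]_p$ and the differential $\tilde d=[\mu+\mu_p,\cdot]_p$. *The functors.* Let $\mathcal A$ be the category of local Artinian $k$-algebras $B$ with residue field $k$ (and maximal ideal $m_B$), with local homomorphisms of $k$-algebras as morphisms. Let $\operatorname{MC}_{\mathfrak g}(B)=\{x\in\mathfrak g^1\otimes m_B\mid \tilde d x+\frac12[x,x]_p=0\}$, and let $\operatorname{Def}_{\mathfrak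 g}(B)$ be its quotient by the gauge action of $\exp(\mathfrak g^0\otimes m_B)$, $$e^b*x=x+\sum_{n\ge 0}\frac{[b,\cdot]_p^n}{(n+1)!}\big([b,x]_p-\tilde d b\big).$$ Let $\operatorname{PDef}_A(B)$ be the set of equivalence classes of Poisson deformations of $A$ over $B$: pairs $(A',\pi)$ of a flat Poisson $B$-algebra $A'$ and an isomorphism $\pi:A'\otimes_Bk\to A$ of Poisson $k$-algebras, where $(A',\pi_1)$ and $(A'',\pi_2)$ are equivalent if there is an isomorphism $\phi:A'\to A''$ of Poisson $B$-algebras with $\pi_1=\pi_2\circ(\phi\otimes_Bk)$. Both are functors of $B\in\mathcal A$, the second by base change. **Proposition.** $\mathfrak g=C_p^\bullet(A)[1]$ is a dgla and it controls $\operatorname{PDef}_A$, that is, the functors $\operatorname{Def}_{\mathfrak g}$ and $\operatorname{PDef}_A$ on $\mathcal A$ are isomorphic. More precisely, for every $B\in\mathcal A$: 1. Sending $x\in \operatorname{MC}_{\mathfrak g}(B)$, with Hodge components $(\gamma,\gamma_p)\in (C^2_{(1)}(A)\oplus C^2_{(2)}(A))\otimes m_B$, to the pair of $B$-bilinear maps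 $(\mu+\gamma,\ \mu_p+\gamma_p)$ on $A\otimes_k B$ is a bijection from $\operatorname{MC}_{\mathfrak g}(B)$ onto the set of $B$-bilinear Poisson products on $A\otimes_kB$ that induce the given Poisson product on $A\cong (A\otimes_k B)/(A\otimes_k m_B)$. 2. Two Maurer–Cartan elements are gauge equivalent if and only if the corresponding Poisson products are isomorphic via a $B$-linear automorphism of $A\otimes_kB$ that is the identity modulo $m_B$. 3. The isomorphism $\operatorname{Def}_{\mathfrak g}\cong\operatorname{PDef}_A$ can be chosen such that it sends the class of $x$ to the class of $A\otimes_kB$ with the Poisson product $(\mu+\gamma,\mu_p+\gamma_p)$ and the canonical identification $(A\otimes_kB)\otimes_Bk\cong A$. -/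

import Mathlib

open CategoryTheory TensorProduct

universe u

noncomputable section

namespace PoissonDef

/-! ### Local Artinian `k`-algebras with residue field `k` -/

/-- A local Artinian `k`-algebra with residue field `k`. -/
structure ArtAlg (k : Type u) [Field k] where
  carrier : Type u
  [commRing : CommRing carrier]
  [algebra : Algebra k carrier]
  [isLocalRing : IsLocalRing carrier]
  [isArtinianRing : IsArtinianRing carrier]
  residue_bijective : Function.Bijective (algebraMap k (IsLocalRing.ResidueField carrier))

namespace ArtAlg

variable {k : Type u} [Field k]

instance : CoeSort (ArtAlg k) (Type u) := ⟨carrier⟩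

attribute [instance] commRing algebra isLocalRing isArtinianRing

/-- Morphisms are the local homomorphisms of `k`-algebras. -/
@[ext]
structure Hom (B B' : ArtAlg k) where
  toAlgHom : B →ₐ[k] B'
  isLocalHom : IsLocalHom toAlgHom.toRingHom

instance : Category (ArtAlg k) where
  Hom := Hom
  id B := ⟨AlgHom.id k B, ⟨fun _ h => h⟩⟩
  comp f g := ⟨g.toAlgHom.comp f.toAlgHom,
    ⟨fun a h => f.isLocalHom.map_nonunit a (g.isLocalHom.map_nonunit _ h)⟩⟩

@[simp] lemma id_toAlgHom (B : ArtAlg k) : Hom.toAlgHom (𝟙 B) = AlgHom.id k B := rfl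

@[simp] lemma comp_toAlgHom {B B' B'' : ArtAlg k} (f : B ⟶ B') (g : B' ⟶ B'') :
    Hom.toAlgHom (f ≫ g) = (Hom.toAlgHom g).comp (Hom.toAlgHom f) := rfl

/-- The maximal ideal `m_B` as a `k`-subspace of `B`. -/
def maxIdeal (B : ArtAlg k) : Submodule k B :=
  (IsLocalRing.maximalIdeal (B : Type u)).restrictScalars k

lemma map_mem_maxIdeal {B B' : ArtAlg k} (f : B ⟶ B') {b : B} (hb : b ∈ B.maxIdeal) :
    Hom.toAlgHom f b ∈ B'.maxIdeal := by
  have h : b ∈ IsLocalRing.maximalIdeal (B : Type u) := hb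
  change Hom.toAlgHom f b ∈ IsLocalRing.maximalIdeal (B' : Type u)
  rw [IsLocalRing.mem_maximalIdeal, mem_nonunits_iff] at h ⊢
  exact fun hu => h (f.isLocalHom.map_nonunit b hu)

end ArtAlg

/-! ### Differential graded Lie algebras and their deformation functors -/

/-- The data underlying a differential graded Lie algebra: a vector space with a family of
homogeneous subspaces, a differential and a bracket. The axioms are in `DGLAData.IsDGLA`. -/
structure DGLAData (k : Type u) [Field k] where
  carrier : Type u
  [addCommGroup : AddCommGroup carrier]
  [module : Module k carrier]
  /-- the homogeneous elements of a given degree -/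
  gr : ℤ → Submodule k carrier
  d : carrier →ₗ[k] carrier
  bracket : carrier →ₗ[k] carrier →ₗ[k] carrier

namespace DGLAData

variable {k : Type u} [Field k]

instance : CoeSort (DGLAData k) (Type u) := ⟨carrier⟩

attribute [instance] addCommGroup module

/-- The axioms of a differential graded Lie algebra (in characteristic zero). -/
structure IsDGLA (L : DGLAData k) : Prop where
  isInternal : DirectSum.IsInternal L.gr
  d_mem : ∀ i, ∀ x ∈ L.gr i, L.d x ∈ L.gr (i + 1)
  bracket_mem : ∀ i j, ∀ x ∈ L.gr i, ∀ y ∈ L.gr j, L.bracket x y ∈ L.gr (i + j)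
  d_d : ∀ x, L.d (L.d x) = 0
  antisymm : ∀ i j, ∀ x ∈ L.gr i, ∀ y ∈ L.gr j,
    L.bracket x y = -(((i * j).negOnePow : ℤ) • L.bracket y x)
  jacobi : ∀ i j, ∀ x ∈ L.gr i, ∀ y ∈ L.gr j, ∀ z,
    L.bracket x (L.bracket y z) =
      L.bracket (L.bracket x y) z + ((i * j).negOnePow : ℤ) • L.bracket y (L.bracket x z)
  leibniz : ∀ i, ∀ x ∈ L.gr i, ∀ y,
    L.d (L.bracket x y) = L.bracket (L.d x) y + (i.negOnePow : ℤ) • L.bracket x (L.d y)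

variable (L : DGLAData k) (B : ArtAlg k)

/-- The subspace `m_B ⊗ 𝔤ⁱ` of `B ⊗ 𝔤`. -/
def grMax (i : ℤ) : Submodule k (B ⊗[k] L) :=
  LinearMap.range (TensorProduct.map B.maxIdeal.subtype (L.gr i).subtype)

/-- The `B`-linear extension of the differential to `B ⊗ 𝔤`. -/
def dExt : B ⊗[k] L →ₗ[B] B ⊗[k] L := L.d.baseChange B

/-- The `B`-bilinear extension of the bracket to `B ⊗ 𝔤`. -/
def bracketExt : B ⊗[k] L →ₗ[B] B ⊗[k] L →ₗ[B] B ⊗[k] L :=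
  LinearMap.BilinMap.baseChange B L.bracket

/-- The Maurer–Cartan elements: `x ∈ 𝔤¹ ⊗ m_B` with `d x + ½ [x, x] = 0`. -/
def MC : Type u :=
  { x : B ⊗[k] L // x ∈ L.grMax B 1 ∧ L.dExt B x + (2⁻¹ : k) • L.bracketExt B x x = 0 }

/-- `y` is obtained from `x` by the gauge action of some `e^b`, `b ∈ 𝔤⁰ ⊗ m_B`:
`y = x + ∑_{n ≥ 0} [b, ·]ⁿ / (n + 1)! ([b, x] - d b)`. The sum is finite because `m_B` is nilpotent:
it is cut off at an index `N` for which `[b, ·]ᴺ ([b, x] - d b)` vanishes. -/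
def GaugeRel (x y : L.MC B) : Prop :=
  ∃ b ∈ L.grMax B 0, ∃ N : ℕ,
    (L.bracketExt B b ^ N) (L.bracketExt B b x.1 - L.dExt B b) = 0 ∧
    y.1 = x.1 + ∑ n ∈ Finset.range N, (((n + 1).factorial : k)⁻¹) •
      (L.bracketExt B b ^ n) (L.bracketExt B b x.1 - L.dExt B b)

variable {B} {B' B'' : ArtAlg k}

/-- The map `B ⊗ 𝔤 → B' ⊗ 𝔤` induced by a morphism `B ⟶ B'`. -/
def extMap (f : B ⟶ B') : B ⊗[k] L →ₗ[k] B' ⊗[k] L :=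
  TensorProduct.map f.toAlgHom.toLinearMap LinearMap.id

@[simp] lemma extMap_tmul (f : B ⟶ B') (b : B) (x : L) :
    L.extMap f (b ⊗ₜ x) = f.toAlgHom b ⊗ₜ x := rfl

lemma extMap_id (x : B ⊗[k] L) : L.extMap (𝟙 B) x = x := by
  induction x with
  | zero => simp
  | tmul b x => simp
  | add x y hx hy => rw [map_add, hx, hy]

lemma extMap_comp (f : B ⟶ B') (g : B' ⟶ B'') (x : B ⊗[k] L) :
    L.extMap (f ≫ g) x = L.extMap g (L.extMap f x) := by
  induction x with
  | zero => simp
  | tmul b x => simp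
  | add x y hx hy => rw [map_add, hx, hy, map_add, map_add]

lemma extMap_mem (f : B ⟶ B') (i : ℤ) {x : B ⊗[k] L} (hx : x ∈ L.grMax B i) :
    L.extMap f x ∈ L.grMax B' i := by
  obtain ⟨t, rfl⟩ := hx
  induction t with
  | zero => simp
  | tmul b x =>
    exact ⟨(⟨f.toAlgHom b, ArtAlg.map_mem_maxIdeal f b.2⟩ : B'.maxIdeal) ⊗ₜ x, rfl⟩
  | add s t hs ht => rw [map_add, map_add]; exact add_mem hs ht

lemma extMap_d (f : B ⟶ B') (x : B ⊗[k] L) :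
    L.extMap f (L.dExt B x) = L.dExt B' (L.extMap f x) := by
  induction x with
  | zero => simp
  | tmul b x => simp [dExt]
  | add x y hx hy => simp only [map_add, hx, hy]

lemma extMap_bracket (f : B ⟶ B') (x y : B ⊗[k] L) :
    L.extMap f (L.bracketExt B x y) = L.bracketExt B' (L.extMap f x) (L.extMap f y) := by
  induction x with
  | zero => simp
  | add x x' hx hx' => simp only [map_add, LinearMap.add_apply, hx, hx']
  | tmul b x =>
    induction y with
    | zero => simp
    | add y y' hy hy' => simp only [map_add, hy, hy']
    | tmul c y => simp [bracketExt]

lemma extMap_bracket_pow (f : B ⟶ B') (b : B ⊗[k] L) (n : ℕ) (x : B ⊗[k] L) :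
    L.extMap f ((L.bracketExt B b ^ n) x) = (L.bracketExt B' (L.extMap f b) ^ n) (L.extMap f x) := by
  induction n with
  | zero => simp
  | succ n ih => rw [pow_succ', pow_succ', Module.End.mul_apply, Module.End.mul_apply,
      extMap_bracket, ih]

/-- Functoriality of the Maurer–Cartan elements. -/
def MC.map (f : B ⟶ B') (x : L.MC B) : L.MC B' :=
  ⟨L.extMap f x.1, L.extMap_mem f 1 x.2.1, by
    rw [← extMap_d, ← extMap_bracket, ← map_smul, ← map_add, x.2.2, map_zero]⟩

lemma GaugeRel.map (f : B ⟶ B') {x y : L.MC B} (h : L.GaugeRel B x y) :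
    L.GaugeRel B' (MC.map L f x) (MC.map L f y) := by
  obtain ⟨b, hb, N, h0, h1⟩ := h
  refine ⟨L.extMap f b, L.extMap_mem f 0 hb, N, ?_, ?_⟩
  · simp only [MC.map]
    rw [← extMap_d, ← extMap_bracket, ← map_sub, ← extMap_bracket_pow, h0, map_zero]
  · simp only [MC.map]
    rw [h1, map_add, map_sum]
    simp only [map_smul, extMap_bracket_pow, map_sub, extMap_bracket, extMap_d]

/-- The deformation functor `B ↦ MC(B) / gauge`. -/
def Def : ArtAlg k ⥤ Type u where
  obj B := Quot (L.GaugeRel B)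
  map f := TypeCat.ofHom (Quot.map (MC.map L f) fun _ _ h => GaugeRel.map L f h)
  map_id B := by
    ext x
    obtain ⟨x, rfl⟩ := Quot.exists_rep x
    exact congrArg (Quot.mk _) (Subtype.ext (L.extMap_id x.1))
  map_comp f g := by
    ext x
    obtain ⟨x, rfl⟩ := Quot.exists_rep x
    exact congrArg (Quot.mk _) (Subtype.ext (L.extMap_comp f g x.1))

end DGLAData

/-! ### Poisson products -/

/-- `mul` is a commutative, associative, unital product on the `R`-module `V`. -/
structure IsCommProduct {R V : Type*} [CommRing R] [AddCommGroup V] [Module R V]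
    (mul : V →ₗ[R] V →ₗ[R] V) : Prop where
  comm : ∀ a b, mul a b = mul b a
  assoc : ∀ a b c, mul (mul a b) c = mul a (mul b c)
  unit : ∃ e, ∀ a, mul e a = a

/-- `br` is a Poisson bracket for the product `mul` on the `R`-module `V`. -/
structure IsPoissonBracket {R V : Type*} [CommRing R] [AddCommGroup V] [Module R V]
    (mul br : V →ₗ[R] V →ₗ[R] V) : Prop where
  skew : ∀ a b, br a b = -br b a
  leibniz : ∀ a b c, br a (mul b c) = mul (br a b) c + mul (br a c) b
  jacobi : ∀ a b c, br a (br b c) + br b (br c a) + br c (br a b) = 0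

/-! ### Poisson deformations -/

section Deformations

variable {k : Type u} [Field k] {A : Type u} [CommRing A] [Algebra k A]

/-- A Poisson deformation over `B` of the Poisson algebra `A` with bracket `p`: a flat Poisson
`B`-algebra together with an isomorphism of Poisson `k`-algebras of its fibre with `A`. -/
structure PoissonDeformation (p : A →ₗ[k] A →ₗ[k] A) (B : ArtAlg k) where
  carrier : Type u
  [commRing : CommRing carrier]
  [algebra : Algebra B carrier]
  [flat : Module.Flat B carrier]
  bracket : carrier →ₗ[B] carrier →ₗ[B] carrier
  isPoisson : IsPoissonBracket (LinearMap.mul B carrier) bracket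
  π : IsLocalRing.ResidueField B ⊗[B] carrier ≃ₐ[k] A
  π_bracket : ∀ x y, π (LinearMap.BilinMap.baseChange (IsLocalRing.ResidueField B) bracket x y) =
    p (π x) (π y)

namespace PoissonDeformation

attribute [instance] commRing algebra flat

variable {p : A →ₗ[k] A →ₗ[k] A} {B B' B'' : ArtAlg k}

instance : CoeSort (PoissonDeformation p B) (Type u) := ⟨carrier⟩

/-- Two deformations are equivalent if there is an isomorphism of Poisson `B`-algebras between
them that is compatible with the identifications of the fibres with `A`. -/
def Equivalent (E F : PoissonDeformation p B) : Prop :=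
  ∃ φ : E ≃ₐ[B] F, (∀ x y, φ (E.bracket x y) = F.bracket (φ x) (φ y)) ∧
    ∀ z, F.π (Algebra.TensorProduct.map
      (AlgHom.id B (IsLocalRing.ResidueField B)) (φ : E →ₐ[B] F) z) = E.π z

lemma _root_.PoissonDef.IsPoissonBracket.baseChange {R S M : Type*} [CommRing R] [CommRing S] [Algebra R S]
    [CommRing M] [Algebra R M] {br : M →ₗ[R] M →ₗ[R] M}
    (h : IsPoissonBracket (LinearMap.mul R M) br) :
    IsPoissonBracket (LinearMap.mul S (S ⊗[R] M)) (LinearMap.BilinMap.baseChange S br) where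
  skew a b := by
    induction a with
    | zero => simp
    | add a a' ha ha' => simp only [map_add, LinearMap.add_apply, ha, ha', neg_add]
    | tmul s a =>
      induction b with
      | zero => simp
      | add b b' hb hb' => simp only [map_add, LinearMap.add_apply, hb, hb', neg_add]
      | tmul t b =>
        rw [LinearMap.BilinMap.baseChange_tmul, LinearMap.BilinMap.baseChange_tmul, h.skew a b,
          TensorProduct.tmul_neg, mul_comm]
  leibniz a b c := by
    induction a with
    | zero => simp
    | add a a' ha ha' =>
      simp only [map_add, LinearMap.add_apply, ha, ha']; abel
    | tmul s a =>
      induction b with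
      | zero => simp
      | add b b' hb hb' =>
        simp only [map_add, LinearMap.add_apply, hb, hb']; abel
      | tmul t b =>
        induction c with
        | zero => simp
        | add c c' hc hc' =>
          simp only [map_add, LinearMap.add_apply, hc, hc']; abel
        | tmul r c =>
          have := h.leibniz a b c
          simp only [LinearMap.mul_apply'] at this
          simp only [LinearMap.mul_apply', LinearMap.BilinMap.baseChange_tmul,
            Algebra.TensorProduct.tmul_mul_tmul, this, TensorProduct.tmul_add]
          congr 2 <;> ring
  jacobi a b c := by
    induction a with
    | zero => simp
    | add a a' ha ha' =>
      simp only [map_add, LinearMap.add_apply]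
      linear_combination (exp := 1) ha + ha'
    | tmul s a =>
      induction b with
      | zero => simp
      | add b b' hb hb' =>
        simp only [map_add, LinearMap.add_apply]
        linear_combination (exp := 1) hb + hb'
      | tmul t b =>
        induction c with
        | zero => simp
        | add c c' hc hc' =>
          simp only [map_add, LinearMap.add_apply]
          linear_combination (exp := 1) hc + hc'
        | tmul r c =>
          simp only [LinearMap.BilinMap.baseChange_tmul]
          rw [show t * (r * s) = s * (t * r) by ring, show r * (s * t) = s * (t * r) by ring,
            ← TensorProduct.tmul_add, ← TensorProduct.tmul_add, h.jacobi, TensorProduct.tmul_zero]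

lemma residue_bijective' [Algebra B B'] [IsScalarTower k B B']
    [IsLocalHom (algebraMap B B')] :
    Function.Bijective (IsScalarTower.toAlgHom B (IsLocalRing.ResidueField B)
      (IsLocalRing.ResidueField B')) := by
  refine ⟨RingHom.injective _, fun y => ?_⟩
  obtain ⟨c, rfl⟩ := B'.residue_bijective.2 y
  exact ⟨algebraMap k _ c, (IsScalarTower.algebraMap_apply k (IsLocalRing.ResidueField B)
    (IsLocalRing.ResidueField B') c).symm⟩

variable (B') in
/-- The identification of the fibre of `B' ⊗_B E` with the fibre of `E`. -/
def fibreEquiv [Algebra B B'] [IsScalarTower k B B'] [IsLocalHom (algebraMap B B')]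
    (M : Type u) [CommRing M] [Algebra B M] :
    IsLocalRing.ResidueField B' ⊗[B'] (B' ⊗[B] M) ≃ₐ[B] IsLocalRing.ResidueField B ⊗[B] M :=
  ((Algebra.TensorProduct.cancelBaseChange B B' B' (IsLocalRing.ResidueField B')
    M).restrictScalars B).trans
  (Algebra.TensorProduct.congr (AlgEquiv.ofBijective _ residue_bijective').symm AlgEquiv.refl)

lemma fibreEquiv_tmul [Algebra B B'] [IsScalarTower k B B'] [IsLocalHom (algebraMap B B')]
    (M : Type u) [CommRing M] [Algebra B M] (c : IsLocalRing.ResidueField B') (b : B') (m : M) :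
    fibreEquiv B' M (c ⊗ₜ (b ⊗ₜ m)) =
      (AlgEquiv.ofBijective _ (residue_bijective' (B := B) (B' := B'))).symm (b • c) ⊗ₜ m := rfl

lemma fibreEquiv_bracket [Algebra B B'] [IsScalarTower k B B'] [IsLocalHom (algebraMap B B')]
    (M : Type u) [CommRing M] [Algebra B M] (br : M →ₗ[B] M →ₗ[B] M)
    (x y : IsLocalRing.ResidueField B' ⊗[B'] (B' ⊗[B] M)) :
    fibreEquiv B' M (LinearMap.BilinMap.baseChange _ (LinearMap.BilinMap.baseChange B' br) x y) =
      LinearMap.BilinMap.baseChange _ br (fibreEquiv B' M x) (fibreEquiv B' M y) := by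
  induction x with
  | zero => simp
  | add x x' hx hx' => simp only [map_add, LinearMap.add_apply, hx, hx']
  | tmul c x =>
  induction x with
  | zero => simp
  | add x x' hx hx' => simp only [map_add, tmul_add, LinearMap.add_apply, hx, hx']
  | tmul b m =>
  induction y with
  | zero => simp
  | add x x' hx hx' => simp only [map_add, hx, hx']
  | tmul c' y =>
  induction y with
  | zero => simp
  | add x x' hx hx' => simp only [map_add, tmul_add, hx, hx']
  | tmul b' m' =>
    simp only [LinearMap.BilinMap.baseChange_tmul, fibreEquiv_tmul, ← map_mul, smul_mul_smul_comm]

lemma fibreEquiv_map [Algebra B B'] [IsScalarTower k B B'] [IsLocalHom (algebraMap B B')]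
    {M N : Type u} [CommRing M] [Algebra B M] [CommRing N] [Algebra B N] (φ : M ≃ₐ[B] N)
    (z : IsLocalRing.ResidueField B' ⊗[B'] (B' ⊗[B] M)) :
    fibreEquiv B' N (Algebra.TensorProduct.map (AlgHom.id B' (IsLocalRing.ResidueField B'))
      ((Algebra.TensorProduct.congr AlgEquiv.refl φ : B' ⊗[B] M ≃ₐ[B'] B' ⊗[B] N) :
        B' ⊗[B] M →ₐ[B'] B' ⊗[B] N) z) =
    Algebra.TensorProduct.map (AlgHom.id B (IsLocalRing.ResidueField B)) (φ : M →ₐ[B] N)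
      (fibreEquiv B' M z) := by
  induction z with
  | zero => simp
  | add x x' hx hx' => simp only [map_add, hx, hx']
  | tmul c x =>
  induction x with
  | zero => simp
  | add x x' hx hx' => simp only [map_add, tmul_add, hx, hx']
  | tmul b m =>
    rw [fibreEquiv_tmul]
    rfl

lemma fibreEquiv_self [IsLocalHom (algebraMap B B)] (M : Type u) [CommRing M] [Algebra B M]
    (z : IsLocalRing.ResidueField B ⊗[B] (B ⊗[B] M)) :
    Algebra.TensorProduct.map (AlgHom.id B (IsLocalRing.ResidueField B))
      (Algebra.TensorProduct.lid B M : B ⊗[B] M →ₐ[B] M) z = fibreEquiv B M z := by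
  induction z with
  | zero => simp
  | add x x' hx hx' => simp only [map_add, hx, hx']
  | tmul c x =>
  induction x with
  | zero => simp
  | add x x' hx hx' => simp only [map_add, tmul_add, hx, hx']
  | tmul b m =>
    rw [fibreEquiv_tmul]
    change c ⊗ₜ[B] (b • m) = _
    rw [← TensorProduct.smul_tmul]
    congr 1
    rw [AlgEquiv.eq_symm_apply]
    obtain ⟨c, rfl⟩ := IsLocalRing.residue_surjective c
    rfl

lemma fibreEquiv_fibreEquiv
    [Algebra B B'] [IsScalarTower k B B'] [IsLocalHom (algebraMap B B')]
    [Algebra B' B''] [IsScalarTower k B' B''] [IsLocalHom (algebraMap B' B'')]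
    [Algebra B B''] [IsScalarTower k B B''] [IsLocalHom (algebraMap B B'')]
    [IsScalarTower B B' B''] (M : Type u) [CommRing M] [Algebra B M]
    (z : IsLocalRing.ResidueField B'' ⊗[B''] (B'' ⊗[B'] (B' ⊗[B] M))) :
    fibreEquiv B'' M (Algebra.TensorProduct.map (AlgHom.id B'' (IsLocalRing.ResidueField B''))
      (Algebra.TensorProduct.cancelBaseChange B B' B'' B'' M :
        B'' ⊗[B'] (B' ⊗[B] M) →ₐ[B''] B'' ⊗[B] M) z) =
    fibreEquiv B' M (fibreEquiv B'' (B' ⊗[B] M) z) := by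
  induction z with
  | zero => simp
  | add x x' hx hx' => simp only [map_add, hx, hx']
  | tmul c x =>
  induction x with
  | zero => simp
  | add x x' hx hx' => simp only [map_add, tmul_add, hx, hx']
  | tmul b x =>
  induction x with
  | zero => simp
  | add x x' hx hx' => simp only [map_add, tmul_add, hx, hx']
  | tmul b' m =>
    rw [fibreEquiv_tmul, fibreEquiv_tmul]
    change fibreEquiv B'' M (c ⊗ₜ[B''] ((b' • b) ⊗ₜ[B] m)) = _
    rw [fibreEquiv_tmul]
    congr 1
    rw [AlgEquiv.symm_apply_eq]
    obtain ⟨c', hc'⟩ := (AlgEquiv.ofBijective _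
      (residue_bijective' (B := B') (B' := B''))).surjective (b • c)
    obtain ⟨c'', hc''⟩ := (AlgEquiv.ofBijective _
      (residue_bijective' (B := B) (B' := B'))).surjective (b' • c')
    rw [← hc', AlgEquiv.symm_apply_apply, ← hc'', AlgEquiv.symm_apply_apply, smul_assoc, ← hc']
    change b' • algebraMap (IsLocalRing.ResidueField B') (IsLocalRing.ResidueField B'') c' =
      algebraMap (IsLocalRing.ResidueField B) (IsLocalRing.ResidueField B'') c''
    change algebraMap (IsLocalRing.ResidueField B) (IsLocalRing.ResidueField B') c'' = _ at hc''
    rw [IsScalarTower.algebraMap_apply (IsLocalRing.ResidueField B)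
      (IsLocalRing.ResidueField B') (IsLocalRing.ResidueField B''), hc'',
      ← IsScalarTower.coe_toAlgHom' B', map_smul]

variable (B') in
/-- The base change `B' ⊗_B E` of a Poisson deformation. -/
def baseChange [Algebra B B'] [IsScalarTower k B B'] [IsLocalHom (algebraMap B B')]
    (E : PoissonDeformation p B) : PoissonDeformation p B' where
  carrier := B' ⊗[B] E.carrier
  bracket := LinearMap.BilinMap.baseChange B' E.bracket
  isPoisson := E.isPoisson.baseChange
  π := ((fibreEquiv (B := B) B' E.carrier).restrictScalars k).trans E.π
  π_bracket x y := by
    simp only [AlgEquiv.trans_apply, AlgEquiv.restrictScalars_apply]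
    rw [fibreEquiv_bracket, E.π_bracket]

lemma Equivalent.refl (E : PoissonDeformation p B) : Equivalent E E :=
  ⟨AlgEquiv.refl, fun _ _ => rfl, fun z => by
    induction z with
    | zero => simp
    | add x y hx hy => simp only [map_add, hx, hy]
    | tmul c m => simp⟩

lemma Equivalent.symm {E F : PoissonDeformation p B} (h : Equivalent E F) : Equivalent F E := by
  obtain ⟨φ, h1, h2⟩ := h
  refine ⟨φ.symm, fun x y => ?_, fun z => ?_⟩
  · rw [AlgEquiv.symm_apply_eq, h1, AlgEquiv.apply_symm_apply, AlgEquiv.apply_symm_apply]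
  · rw [← h2]
    congr 1
    induction z with
    | zero => simp
    | add x y hx hy => simp only [map_add, hx, hy]
    | tmul c m => simp

lemma Equivalent.trans {E F G : PoissonDeformation p B} (h : Equivalent E F)
    (h' : Equivalent F G) : Equivalent E G := by
  obtain ⟨φ, h1, h2⟩ := h
  obtain ⟨ψ, h3, h4⟩ := h'
  refine ⟨φ.trans ψ, fun x y => ?_, fun z => ?_⟩
  · simp only [AlgEquiv.trans_apply, h1, h3]
  · rw [← h2, ← h4]
    congr 1
    induction z with
    | zero => simp
    | add x y hx hy => simp only [map_add, hx, hy]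
    | tmul c m => simp

variable (p B) in
/-- The setoid of equivalence of Poisson deformations. -/
def setoid : Setoid (PoissonDeformation p B) :=
  ⟨Equivalent, Equivalent.refl, Equivalent.symm, Equivalent.trans⟩

lemma Equivalent.baseChange [Algebra B B'] [IsScalarTower k B B'] [IsLocalHom (algebraMap B B')]
    {E F : PoissonDeformation p B} (h : Equivalent E F) :
    Equivalent (E.baseChange B') (F.baseChange B') := by
  obtain ⟨φ, h1, h2⟩ := h
  refine ⟨(Algebra.TensorProduct.congr AlgEquiv.refl φ :
    B' ⊗[B] E.carrier ≃ₐ[B'] B' ⊗[B] F.carrier), fun x y => ?_, fun z => ?_⟩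
  · change B' ⊗[B] E.carrier at x y
    change (Algebra.TensorProduct.congr AlgEquiv.refl φ : B' ⊗[B] E.carrier ≃ₐ[B'] B' ⊗[B] F.carrier)
      (LinearMap.BilinMap.baseChange B' E.bracket x y) =
      LinearMap.BilinMap.baseChange B' F.bracket
      ((Algebra.TensorProduct.congr AlgEquiv.refl φ : _ ≃ₐ[B'] B' ⊗[B] F.carrier) x)
      ((Algebra.TensorProduct.congr AlgEquiv.refl φ : _ ≃ₐ[B'] B' ⊗[B] F.carrier) y)
    induction x with
    | zero => simp
    | add x x' hx hx' => simp only [map_add, LinearMap.add_apply, hx, hx']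
    | tmul b m =>
    induction y with
    | zero => simp
    | add x x' hx hx' => simp only [map_add, hx, hx']
    | tmul b' m' => simp [h1]
  · exact (congrArg F.π (fibreEquiv_map φ z)).trans (h2 _)

lemma baseChange_self [IsLocalHom (algebraMap B B)]
    (E : PoissonDeformation p B) : Equivalent (E.baseChange B) E := by
  refine ⟨(Algebra.TensorProduct.lid B E.carrier : B ⊗[B] E.carrier ≃ₐ[B] E.carrier),
    fun x y => ?_, fun z => ?_⟩
  · change B ⊗[B] E.carrier at x y
    change Algebra.TensorProduct.lid B E.carrier (LinearMap.BilinMap.baseChange B E.bracket x y) =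
      E.bracket (Algebra.TensorProduct.lid B E.carrier x) (Algebra.TensorProduct.lid B E.carrier y)
    induction x with
    | zero => simp
    | add x x' hx hx' => simp only [map_add, LinearMap.add_apply, hx, hx']
    | tmul b m =>
    induction y with
    | zero => simp
    | add x x' hx hx' => simp only [map_add, hx, hx']
    | tmul b' m' => simp [mul_smul, smul_comm b b']
  · exact congrArg E.π (fibreEquiv_self E.carrier z)

lemma baseChange_baseChange [Algebra B B'] [IsScalarTower k B B'] [IsLocalHom (algebraMap B B')]
    [Algebra B' B''] [IsScalarTower k B' B''] [IsLocalHom (algebraMap B' B'')]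
    [Algebra B B''] [IsScalarTower k B B''] [IsLocalHom (algebraMap B B'')]
    [IsScalarTower B B' B''] (E : PoissonDeformation p B) :
    Equivalent ((E.baseChange B').baseChange B'') (E.baseChange B'') := by
  refine ⟨(Algebra.TensorProduct.cancelBaseChange B B' B'' B'' E.carrier :
    B'' ⊗[B'] (B' ⊗[B] E.carrier) ≃ₐ[B''] B'' ⊗[B] E.carrier), fun x y => ?_, fun z => ?_⟩
  · change B'' ⊗[B'] (B' ⊗[B] E.carrier) at x y
    change Algebra.TensorProduct.cancelBaseChange B B' B'' B'' E.carrier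
      (LinearMap.BilinMap.baseChange B'' (LinearMap.BilinMap.baseChange B' E.bracket) x y) =
      LinearMap.BilinMap.baseChange B'' E.bracket
        (Algebra.TensorProduct.cancelBaseChange B B' B'' B'' E.carrier x)
        (Algebra.TensorProduct.cancelBaseChange B B' B'' B'' E.carrier y)
    induction x with
    | zero => simp
    | add x x' hx hx' => simp only [map_add, LinearMap.add_apply, hx, hx']
    | tmul c x =>
    induction x with
    | zero => simp
    | add x x' hx hx' => simp only [map_add, tmul_add, LinearMap.add_apply, hx, hx']
    | tmul b m =>
    induction y with
    | zero => simp
    | add x x' hx hx' => simp only [map_add, hx, hx']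
    | tmul c' y =>
    induction y with
    | zero => simp
    | add x x' hx hx' => simp only [map_add, tmul_add, hx, hx']
    | tmul b' m' =>
      simp only [LinearMap.BilinMap.baseChange_tmul,
        Algebra.TensorProduct.cancelBaseChange_tmul, smul_mul_smul_comm]
  · exact congrArg E.π (fibreEquiv_fibreEquiv E.carrier z)

/-- The base change of a Poisson deformation along a morphism `B ⟶ B'`. -/
def pushforward (f : B ⟶ B') (E : PoissonDeformation p B) : PoissonDeformation p B' :=
  letI : Algebra B B' := f.toAlgHom.toRingHom.toAlgebra
  haveI : IsScalarTower k B B' := .of_algebraMap_eq fun c => (f.toAlgHom.commutes c).symm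
  haveI : IsLocalHom (algebraMap B B') := f.isLocalHom
  E.baseChange B'

lemma Equivalent.pushforward (f : B ⟶ B') {E F : PoissonDeformation p B} (h : Equivalent E F) :
    Equivalent (E.pushforward f) (F.pushforward f) :=
  let : Algebra B B' := f.toAlgHom.toRingHom.toAlgebra
  have : IsScalarTower k B B' := .of_algebraMap_eq fun c => (f.toAlgHom.commutes c).symm
  have : IsLocalHom (algebraMap B B') := f.isLocalHom
  h.baseChange

lemma pushforward_id (E : PoissonDeformation p B) : Equivalent (E.pushforward (𝟙 B)) E :=
  have : IsLocalHom (algebraMap B B) := (𝟙 B : B ⟶ B).isLocalHom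
  baseChange_self E

lemma pushforward_comp (f : B ⟶ B') (g : B' ⟶ B'') (E : PoissonDeformation p B) :
    Equivalent ((E.pushforward f).pushforward g) (E.pushforward (f ≫ g)) := by
  let : Algebra B B' := f.toAlgHom.toRingHom.toAlgebra
  have : IsScalarTower k B B' := .of_algebraMap_eq fun c => (f.toAlgHom.commutes c).symm
  have : IsLocalHom (algebraMap B B') := f.isLocalHom
  let : Algebra B' B'' := g.toAlgHom.toRingHom.toAlgebra
  have : IsScalarTower k B' B'' := .of_algebraMap_eq fun c => (g.toAlgHom.commutes c).symm
  have : IsLocalHom (algebraMap B' B'') := g.isLocalHom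
  let : Algebra B B'' := (f ≫ g).toAlgHom.toRingHom.toAlgebra
  have : IsScalarTower k B B'' := .of_algebraMap_eq fun c => ((f ≫ g).toAlgHom.commutes c).symm
  have : IsLocalHom (algebraMap B B'') := (f ≫ g).isLocalHom
  have : IsScalarTower B B' B'' := .of_algebraMap_eq fun _ => rfl
  exact baseChange_baseChange E

end PoissonDeformation

/-- The functor of Poisson deformations of the Poisson algebra `A` with bracket `p`, up to
equivalence. -/
def PDef (p : A →ₗ[k] A →ₗ[k] A) : ArtAlg k ⥤ Type (u + 1) where
  obj B := Quotient (PoissonDeformation.setoid p B)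
  map f := TypeCat.ofHom (Quotient.map (PoissonDeformation.pushforward f)
    fun _ _ h => PoissonDeformation.Equivalent.pushforward f h)
  map_id B := by
    ext x
    obtain ⟨E, rfl⟩ := Quotient.exists_rep x
    exact Quotient.sound E.pushforward_id
  map_comp f g := by
    ext x
    obtain ⟨E, rfl⟩ := Quotient.exists_rep x
    exact Quotient.sound (PoissonDeformation.Equivalent.symm (E.pushforward_comp f g))

end Deformations

/-! ### Hochschild cochains and the Gerstenhaber bracket -/

section Hochschild

variable (k : Type u) [Field k] (A : Type u) [CommRing A] [Algebra k A]

/-- The space `Cⁿ(A)` of Hochschild cochains: `k`-multilinear maps `Aⁿ → A`. -/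
abbrev Cochain (n : ℕ) : Type u := MultilinearMap k (fun _ : Fin n => A) A

variable {k A}

/-- The arguments `(a₁, …, aᵢ₋₁, g(aᵢ, …, aᵢ₊ₙ), aᵢ₊ₙ₊₁, …)`. -/
def insertArg {m n : ℕ} (g : Cochain k A (n + 1)) (i : Fin (m + 1)) (a : Fin (m + n + 1) → A) :
    Fin (m + 1) → A := fun j =>
  if j < i then a ⟨j, by omega⟩
  else if j = i then g fun l : Fin (n + 1) => a ⟨i + l, by omega⟩
  else a ⟨j + n, by omega⟩

lemma insertArg_update_lt {m n : ℕ} (g : Cochain k A (n + 1)) (i : Fin (m + 1))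
    (a : Fin (m + n + 1) → A) (q : Fin (m + n + 1)) (hq : (q : ℕ) < i) (x : A) :
    insertArg g i (Function.update a q x) =
      Function.update (insertArg g i a) ⟨q, by omega⟩ x := by
  funext j
  have hg : (fun l : Fin (n + 1) => Function.update a q x ⟨i + l, by omega⟩) =
      fun l : Fin (n + 1) => a ⟨i + l, by omega⟩ := by
    funext l
    rw [Function.update_of_ne]
    simp only [ne_eq, Fin.ext_iff]; omega
  simp only [insertArg, hg]
  simp only [insertArg, Function.update_apply, Fin.ext_iff, Fin.lt_def]
  split_ifs <;> first | rfl | omega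

lemma insertArg_update_mid {m n : ℕ} (g : Cochain k A (n + 1)) (i : Fin (m + 1))
    (a : Fin (m + n + 1) → A) (q : Fin (m + n + 1)) (hq : (i : ℕ) ≤ q) (hq' : (q : ℕ) ≤ i + n)
    (x : A) :
    insertArg g i (Function.update a q x) =
      Function.update (insertArg g i a) i
        (g (Function.update (fun l : Fin (n + 1) => a ⟨i + l, by omega⟩) ⟨q - i, by omega⟩ x)) := by
  funext j
  have hg : (fun l : Fin (n + 1) => Function.update a q x ⟨i + l, by omega⟩) =
      Function.update (fun l : Fin (n + 1) => a ⟨i + l, by omega⟩) ⟨q - i, by omega⟩ x := by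
    funext l
    simp only [Function.update_apply, Fin.ext_iff]
    split_ifs <;> first | rfl | omega
  simp only [insertArg, hg]
  rw [Function.update_apply (insertArg g i a)]
  simp only [insertArg, Fin.lt_def, Fin.ext_iff]
  split_ifs with h1 h2 h2
  · omega
  · rw [Function.update_of_ne]
    simp only [ne_eq, Fin.ext_iff]; omega
  · rfl
  · rw [Function.update_of_ne]
    simp only [ne_eq, Fin.ext_iff]; omega

lemma insertArg_update_gt {m n : ℕ} (g : Cochain k A (n + 1)) (i : Fin (m + 1))
    (a : Fin (m + n + 1) → A) (q : Fin (m + n + 1)) (hq : (i : ℕ) + n < q) (x : A) :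
    insertArg g i (Function.update a q x) =
      Function.update (insertArg g i a) ⟨q - n, by omega⟩ x := by
  funext j
  have hg : (fun l : Fin (n + 1) => Function.update a q x ⟨i + l, by omega⟩) =
      fun l : Fin (n + 1) => a ⟨i + l, by omega⟩ := by
    funext l
    rw [Function.update_of_ne]
    simp only [ne_eq, Fin.ext_iff]; omega
  simp only [insertArg, hg]
  simp only [insertArg, Function.update_apply, Fin.ext_iff, Fin.lt_def]
  split_ifs <;> first | rfl | omega

/-- The insertion of `g` into the `i`-th argument of `f`:
`f(a₁, …, aᵢ₋₁, g(aᵢ, …, aᵢ₊ₙ), aᵢ₊ₙ₊₁, …)`. -/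
def insertAt {m n : ℕ} (f : Cochain k A (m + 1)) (g : Cochain k A (n + 1)) (i : Fin (m + 1)) :
    Cochain k A (m + n + 1) :=
  MultilinearMap.mk' (fun a => f (insertArg g i a))
    (fun a q x y => by
      rcases lt_or_ge (q : ℕ) i with h | h
      · simp only [insertArg_update_lt g i a q h, f.map_update_add]
      · rcases le_or_gt (q : ℕ) (i + n) with h' | h'
        · simp only [insertArg_update_mid g i a q h h', g.map_update_add, f.map_update_add]
        · simp only [insertArg_update_gt g i a q h', f.map_update_add])
    (fun a q c x => by
      rcases lt_or_ge (q : ℕ) i with h | h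
      · simp only [insertArg_update_lt g i a q h, f.map_update_smul]
      · rcases le_or_gt (q : ℕ) (i + n) with h' | h'
        · simp only [insertArg_update_mid g i a q h h', g.map_update_smul, f.map_update_smul]
        · simp only [insertArg_update_gt g i a q h', f.map_update_smul])

@[simp] lemma insertAt_apply {m n : ℕ} (f : Cochain k A (m + 1)) (g : Cochain k A (n + 1))
    (i : Fin (m + 1)) (a : Fin (m + n + 1) → A) : insertAt f g i a = f (insertArg g i a) := rfl

lemma insertArg_eq_update {m n : ℕ} (g h : Cochain k A (n + 1)) (i : Fin (m + 1))
    (a : Fin (m + n + 1) → A) :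
    insertArg g i a =
      Function.update (insertArg h i a) i (g fun l : Fin (n + 1) => a ⟨i + l, by omega⟩) := by
  funext j
  rw [Function.update_apply]
  simp only [insertArg, Fin.lt_def, Fin.ext_iff]
  split_ifs <;> first | rfl | omega

/-- The composition `f ∘ g = ∑ᵢ (-1)^((i - 1)(n + 1)) f ∘ᵢ g` for `g ∈ Cⁿ(A)`. (With `g` of arity
`n + 1` and positions counted from `0` the sign is `(-1)^(i n)`.) -/
def circ {m n : ℕ} : Cochain k A (m + 1) →ₗ[k] Cochain k A (n + 1) →ₗ[k]
    Cochain k A (m + n + 1) :=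
  LinearMap.mk₂ k (fun f g => ∑ i : Fin (m + 1), (-1 : k) ^ ((i : ℕ) * n) • insertAt f g i)
    (fun f f' g => by
      rw [← Finset.sum_add_distrib]
      refine Finset.sum_congr rfl fun i _ => ?_
      rw [← smul_add]; rfl)
    (fun c f g => by
      rw [Finset.smul_sum]
      refine Finset.sum_congr rfl fun i _ => ?_
      rw [smul_comm]; rfl)
    (fun f g g' => by
      rw [← Finset.sum_add_distrib]
      refine Finset.sum_congr rfl fun i _ => ?_
      rw [← smul_add]
      congr 1
      ext a
      rw [add_apply, insertAt_apply, insertAt_apply, insertAt_apply,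
        insertArg_eq_update (g + g') 0, insertArg_eq_update g 0, insertArg_eq_update g' 0,
        add_apply, f.map_update_add])
    (fun c f g => by
      rw [Finset.smul_sum]
      refine Finset.sum_congr rfl fun i _ => ?_
      rw [smul_comm]
      congr 1
      ext a
      rw [smul_apply, insertAt_apply, insertAt_apply,
        insertArg_eq_update (c • g) 0, insertArg_eq_update g 0,
        smul_apply, f.map_update_smul])

/-- Reindexing of cochains along an equality of arities. -/
def castArity {m n : ℕ} (h : m = n) : Cochain k A m →ₗ[k] Cochain k A n :=
  (MultilinearMap.domDomCongrLinearEquiv k k A A (finCongr h)).toLinearMap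

/-- The Gerstenhaber bracket `[f, g] = f ∘ g - (-1)^((m + 1)(n + 1)) g ∘ f` for `f ∈ Cᵐ(A)`,
`g ∈ Cⁿ(A)`. -/
def gerstenhaber {m n : ℕ} : Cochain k A (m + 1) →ₗ[k] Cochain k A (n + 1) →ₗ[k]
    Cochain k A (m + n + 1) :=
  LinearMap.mk₂ k
    (fun f g => circ f g -
      (-1 : k) ^ (m * n) • castArity (show n + m + 1 = m + n + 1 by omega) (circ g f))
    (fun f f' g => by
      rw [map_add, map_add, LinearMap.add_apply, map_add, smul_add, add_sub_add_comm])
    (fun c f g => by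
      rw [map_smul, map_smul, LinearMap.smul_apply, map_smul, smul_sub, smul_comm c])
    (fun f g g' => by
      rw [map_add, map_add, LinearMap.add_apply, map_add, smul_add, add_sub_add_comm])
    (fun c f g => by
      rw [map_smul, map_smul, LinearMap.smul_apply, map_smul, smul_sub, smul_comm c])

/-! ### The Hodge decomposition -/

/-- The permutations `π` of `{1, …, n}` with `π(1) < ⋯ < π(i)` and `π(i + 1) < ⋯ < π(n)`. -/
def shuffles (n i : ℕ) : Finset (Equiv.Perm (Fin n)) :=
  open Classical in
  Finset.univ.filter fun π =>
    ∀ a b : Fin n, a < b → ((b : ℕ) < i ∨ i ≤ (a : ℕ)) → π a < π b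

variable (k A) in
/-- The operator `f ↦ f ∘ sₙ` on `Cⁿ(A)`, where `sₙ = ∑_{0 < i < n} s_{i, n - i}` is the signed sum
of all shuffles and a permutation acts on `A^{⊗ n}` by moving the `a`-th tensor factor to the
position `π(a)`. -/
def shuffleOp (n : ℕ) : Cochain k A n →ₗ[k] Cochain k A n :=
  ∑ i ∈ Finset.Ico 1 n, ∑ π ∈ shuffles n i, ((Equiv.Perm.sign π : ℤ) : k) •
    (MultilinearMap.domDomCongrLinearEquiv k k A A π⁻¹).toLinearMap

variable (k A) in
/-- The Hodge piece `Cⁿ_(i)(A) = {f | f ∘ sₙ = (2ⁱ - 2) f}`. -/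
def hodgePiece (n i : ℕ) : Submodule k (Cochain k A n) :=
  Module.End.eigenspace (shuffleOp k A n) ((2 : k) ^ i - 2)

variable (k A) in
/-- The projector `eₙ(i) = ∏_{j ≠ i} (sₙ - (2ʲ - 2)) / (2ⁱ - 2ʲ)`, `1 ≤ j ≤ n`, onto the Hodge piece
`Cⁿ_(i)(A)` along the other Hodge pieces, for `1 ≤ i ≤ n`. -/
def hodgeProj (n i : ℕ) : Cochain k A n →ₗ[k] Cochain k A n :=
  Polynomial.aeval (R := k) (A := Module.End k (Cochain k A n)) (shuffleOp k A n)
    (Lagrange.basis (Finset.Icc 1 n) (fun j : ℕ => (2 : k) ^ j - 2) i)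

/-- The bracket `[f, g]_p = ∑_{i, j} e(i + j - 1) [fᵢ, gⱼ]`, where `fᵢ` and `gⱼ` are the Hodge
components of `f` and `g`. -/
def hodgeBracket {m n : ℕ} : Cochain k A (m + 1) →ₗ[k] Cochain k A (n + 1) →ₗ[k]
    Cochain k A (m + n + 1) :=
  ∑ i ∈ Finset.Icc 1 (m + 1), ∑ j ∈ Finset.Icc 1 (n + 1),
    (gerstenhaber.compl₁₂ (hodgeProj k A (m + 1) i) (hodgeProj k A (n + 1) j)).compr₂
      (hodgeProj k A (m + n + 1) (i + j - 1))

/-! ### The dgla of a Poisson algebra -/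

variable (k A) in
/-- The space `⨁_{n ≥ 1} Cⁿ(A) = ⨁_{n ≥ 1} ⨁_{1 ≤ i ≤ n} Cⁿ_(i)(A)` of total cochains; the summand
with index `n` is `Cⁿ⁺¹(A)`. -/
abbrev TotalCochain : Type u := DirectSum ℕ fun n => Cochain k A (n + 1)

/-- The subspace of elements of degree `i` of the shifted complex: it is `Cⁱ⁺¹(A)` for `i ≥ 0` and
zero for `i < 0`. -/
def totalGr : ℤ → Submodule k (TotalCochain k A)
  | Int.ofNat n => LinearMap.range (DirectSum.lof k ℕ (fun n => Cochain k A (n + 1)) n)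
  | Int.negSucc _ => ⊥

/-- The bracket `[ , ]_p` on total cochains. -/
def totalBracket : TotalCochain k A →ₗ[k] TotalCochain k A →ₗ[k] TotalCochain k A :=
  DirectSum.toModule k ℕ _ fun m => LinearMap.flip <| DirectSum.toModule k ℕ _ fun n =>
    (hodgeBracket.compr₂ (DirectSum.lof k ℕ (fun n => Cochain k A (n + 1)) (m + n))).flip

/-- A bilinear map as a Hochschild `2`-cochain. -/
def ofBilin (f : A →ₗ[k] A →ₗ[k] A) : Cochain k A 2 :=
  MultilinearMap.mk' (fun a => f (a 0) (a 1))
    (fun a i x y => by fin_cases i <;> simp)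
    (fun a i c x => by fin_cases i <;> simp)

/-- A Hochschild `2`-cochain as a bilinear map. -/
def toBilin : Cochain k A 2 →ₗ[k] (A →ₗ[k] A →ₗ[k] A) where
  toFun f := LinearMap.mk₂ k (fun a b => f ![a, b])
    (fun a a' b => f.cons_add ![b] a a')
    (fun c a b => f.cons_smul ![b] c a)
    (fun a b b' => by
      have h (x : A) : ![a, x] = Function.update ![a, b] 1 x := by
        funext i; fin_cases i <;> simp
      rw [h (b + b'), f.map_update_add, ← h b, ← h b'])
    (fun c a b => by
      have h (x : A) : ![a, x] = Function.update ![a, b] 1 x := by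
        funext i; fin_cases i <;> simp
      rw [h (c • b), f.map_update_smul, ← h b])
  map_add' f g := rfl
  map_smul' c f := rfl

/-- The degree one element `μ + μ_p` given by the product of `A` and the Poisson bracket `p`. -/
def structureElement (p : A →ₗ[k] A →ₗ[k] A) : TotalCochain k A :=
  DirectSum.lof k ℕ (fun n => Cochain k A (n + 1)) 1 (ofBilin (LinearMap.mul k A) + ofBilin p)

/-- The dgla `C_p^•(A)[1]` of the Poisson algebra `A` with bracket `p`: the shifted total complex of
the Hodge pieces with bracket `[ , ]_p` and differential `[μ + μ_p, ·]_p`. -/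
def poissonDGLA (p : A →ₗ[k] A →ₗ[k] A) : DGLAData k where
  carrier := TotalCochain k A
  gr := totalGr
  d := totalBracket (structureElement p)
  bracket := totalBracket

end Hochschild

/-! ### From Maurer–Cartan elements to Poisson products -/

section Comparison

variable {k : Type u} [Field k] {A : Type u} [CommRing A] [Algebra k A]

/-- The `B`-bilinear extension to `B ⊗ A` of `k`-bilinear maps on `A`. -/
def bilinExt (B : ArtAlg k) :
    (A →ₗ[k] A →ₗ[k] A) →ₗ[k] (B ⊗[k] A →ₗ[B] B ⊗[k] A →ₗ[B] B ⊗[k] A) where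
  toFun f := LinearMap.BilinMap.baseChange B f
  map_add' f g := by
    ext a b
    exact TensorProduct.tmul_add _ _ _
  map_smul' c f := by
    ext a b
    exact TensorProduct.tmul_smul _ _ _

/-- The `B`-bilinear map on `B ⊗ A` given by the component of weight `i` of the part in
`B ⊗ C²(A)` of an element of `B ⊗ ⨁ₙ Cⁿ(A)`. -/
def weightBilin (B : ArtAlg k) (i : ℕ) :
    B ⊗[k] TotalCochain k A →ₗ[B] (B ⊗[k] A →ₗ[B] B ⊗[k] A →ₗ[B] B ⊗[k] A) :=
  LinearMap.liftBaseChange B (bilinExt B ∘ₗ toBilin ∘ₗ hodgeProj k A 2 i ∘ₗ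
    DirectSum.component k ℕ (fun n => Cochain k A (n + 1)) 1)

/-- The product `μ + γ` on `B ⊗ A`, where `γ` is the component of weight one of `x`. -/
def deformedMul (B : ArtAlg k) (x : B ⊗[k] TotalCochain k A) :
    B ⊗[k] A →ₗ[B] B ⊗[k] A →ₗ[B] B ⊗[k] A :=
  bilinExt B (LinearMap.mul k A) + weightBilin B 1 x

/-- The bracket `μ_p + γ_p` on `B ⊗ A`, where `γ_p` is the component of weight two of `x`. -/
def deformedBracket (p : A →ₗ[k] A →ₗ[k] A) (B : ArtAlg k) (x : B ⊗[k] TotalCochain k A) :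
    B ⊗[k] A →ₗ[B] B ⊗[k] A →ₗ[B] B ⊗[k] A :=
  bilinExt B p + weightBilin B 2 x

variable (A) in
/-- The submodule `m_B ⊗ A` of `B ⊗ A`. -/
def maxTensor (B : ArtAlg k) : Submodule B (B ⊗[k] A) :=
  IsLocalRing.maximalIdeal (B : Type u) • ⊤

/-- A Poisson product on the `B`-module `B ⊗ A` that induces the given Poisson product on
`A ≅ (B ⊗ A) / (m_B ⊗ A)`. -/
structure IsPoissonLift (p : A →ₗ[k] A →ₗ[k] A) (B : ArtAlg k)
    (mul br : B ⊗[k] A →ₗ[B] B ⊗[k] A →ₗ[B] B ⊗[k] A) : Prop where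
  isCommProduct : IsCommProduct mul
  isPoissonBracket : IsPoissonBracket mul br
  mul_sub_mem : ∀ v w, mul v w - bilinExt B (LinearMap.mul k A) v w ∈ maxTensor A B
  bracket_sub_mem : ∀ v w, br v w - bilinExt B p v w ∈ maxTensor A B

/-- Two Poisson products on `B ⊗ A` are isomorphic via a `B`-linear automorphism of `B ⊗ A` that is
the identity modulo `m_B`. -/
def ProductsEquivalent (B : ArtAlg k)
    (mul br mul' br' : B ⊗[k] A →ₗ[B] B ⊗[k] A →ₗ[B] B ⊗[k] A) : Prop :=
  ∃ φ : B ⊗[k] A ≃ₗ[B] B ⊗[k] A, (∀ v, φ v - v ∈ maxTensor A B) ∧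
    (∀ v w, φ (mul v w) = mul' (φ v) (φ w)) ∧ (∀ v w, φ (br v w) = br' (φ v) (φ w))

/-- The Poisson deformation `E` is isomorphic to `B ⊗ A` with the product `mul`, the bracket `br` and
the canonical identification of the fibre with `A`. -/
def PoissonDeformation.IsRealizedBy {p : A →ₗ[k] A →ₗ[k] A} {B : ArtAlg k}
    (E : PoissonDeformation p B) (mul br : B ⊗[k] A →ₗ[B] B ⊗[k] A →ₗ[B] B ⊗[k] A) : Prop :=
  ∃ θ : B ⊗[k] A ≃ₗ[B] E, (∀ v w, θ (mul v w) = θ v * θ w) ∧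
    (∀ v w, θ (br v w) = E.bracket (θ v) (θ w)) ∧
    ∀ a : A, E.π (1 ⊗ₜ[B] θ (1 ⊗ₜ[k] a)) = a

end Comparison

end PoissonDef

end

/-!
The bracket `[ , ]_p` is the bracket induced by the Gerstenhaber bracket on the associated graded of a
filtration, so that its graded Jacobi identity follows from that of the Gerstenhaber bracket
(`evalSeq_gerstenhaber_jacobi`) as soon as the Gerstenhaber bracket respects the filtration. The
filtration is `hodgeFil`: evaluate a cochain `f ∈ Cⁿ(A)` at `n` copies of a generic element
`∑ aₛ ⊗ xₛ` with odd noncommuting variables `xₛ`. The value lies in `A ⊗ U`, where `U` is the free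
superalgebra, i.e. the enveloping algebra of a free Lie superalgebra, with its
Poincaré–Birkhoff–Witt filtration `pbw`; `f` is in step `q` if all these values are in `A ⊗ U_q`.

* The operator `f ↦ f ∘ (sₙ + 2)` becomes the Adams operation `μ ∘ Δ` of the Hopf superalgebra `U`
  (`generic_shuffleOp`), which acts on `U_q / U_{q-1}` by `2^q` (`adams_sub_mem`). Hence step `q` of
  the filtration is the sum of the Hodge pieces of weight at most `q`.
* The composition `f ∘ g` becomes the substitution of the generic value of `g` for one variable in
  that of `f`, which is a superderivation. A superderivation with values in `U_j` on the variables
  maps `U_i` to `U_{i+j-1}` (`superDer_mem_pbw`), so `f ∘ g` has filtration degree `i + j - 1`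
  (`circ_mem_hodgeFil`).

In arity two the Hodge pieces are the symmetric and the skew-symmetric bilinear maps. The three weight
components of `[Y, Y]_p` for `Y ∈ C²(A)` express associativity of the symmetric part, the Leibniz
rule, and the Jacobi identity of the skew-symmetric part (`hodgeProj_hodgeBracket_two`,
`trilin_self_eq_zero_iff`, `trilin_eq_zero_iff_leibniz`, `trilin_cyclic_eq_zero_iff_jacobi`). For
`Y = μ + μ_p` this gives `[Y, Y]_p = 0`, hence the dgla. For `Y = μ + μ_p + x` over `B` it says that
`x` is a Maurer–Cartan element if and only if the products `(μ + γ, μ_p + γ_p)` are Poisson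
(`range_deformed`); such a product automatically has a unit, as multiplication by `1 ⊗ 1` is
invertible modulo the nilpotent ideal `m_B` (`exists_unit_of_lift`).

The gauge action of `b` is `μ + μ_p + x ↦ e^{[b, ·]} (μ + μ_p + x)`, the transport of the products
along the automorphism `e^b` of `B ⊗ A`. An automorphism that is the identity modulo `m_B` is
unipotent, hence of the form `e^b` (`gaugeRel_iff_productsEquivalent`).

Finally a flat deformation is isomorphic to `B ⊗ A` as a `B`-module compatibly with the
identification of the fibre with `A` (`PoissonDeformation.exists_linearEquiv`), so deformations up to
equivalence are the Poisson products on `B ⊗ A` up to automorphisms that are the identity modulo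
`m_B` (`PoissonDeformation.exists_isRealizedBy`,
`PoissonDeformation.equivalent_iff_productsEquivalent`).
-/

noncomputable section

namespace PoissonDef

/-! ### The composition product is graded pre-Lie -/

section PreLie

variable {k : Type u} [Field k] {A : Type u} [CommRing A] [Algebra k A]

/-- The value of a cochain on the first arguments of an infinite sequence. Regarding cochains as
functions of sequences makes the reindexings `castArity` invisible. -/
def evalSeq {n : ℕ} (f : Cochain k A n) (a : ℕ → A) : A := f fun j => a j

lemma evalSeq_injective {n : ℕ} {f g : Cochain k A n} (h : evalSeq f = evalSeq g) : f = g := by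
  ext a
  have := congrFun h fun j => if hj : j < n then a ⟨j, hj⟩ else 0
  simpa [evalSeq] using this

lemma evalSeq_congr {n : ℕ} (f : Cochain k A n) {a b : ℕ → A} (h : ∀ j < n, a j = b j) :
    evalSeq f a = evalSeq f b :=
  congrArg f (funext fun j => h j j.2)

@[simp] lemma evalSeq_add {n : ℕ} (f g : Cochain k A n) :
    evalSeq (f + g) = evalSeq f + evalSeq g := rfl

@[simp] lemma evalSeq_sub {n : ℕ} (f g : Cochain k A n) :
    evalSeq (f - g) = evalSeq f - evalSeq g := rfl

@[simp] lemma evalSeq_neg {n : ℕ} (f : Cochain k A n) :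
    evalSeq (-f) = -evalSeq f := rfl

@[simp] lemma evalSeq_smul {n : ℕ} (c : k) (f : Cochain k A n) :
    evalSeq (c • f) = c • evalSeq f := rfl

@[simp] lemma evalSeq_castArity {m n : ℕ} (h : m = n) (f : Cochain k A m) :
    evalSeq (castArity h f) = evalSeq f := by
  subst h; rfl

/-- The sequence `(a₀, …, aᵢ₋₁, g(aᵢ, aᵢ₊₁, …), aᵢ₊ₙ₊₁, …)`. -/
def insertSeq {A : Type*} (g : (ℕ → A) → A) (n i : ℕ) (a : ℕ → A) : ℕ → A := fun j =>
  if j < i then a j else if j = i then g fun l => a (i + l) else a (j + n)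

lemma evalSeq_insertAt {m n : ℕ} (f : Cochain k A (m + 1)) (g : Cochain k A (n + 1))
    (i : Fin (m + 1)) (a : ℕ → A) :
    evalSeq (insertAt f g i) a = evalSeq f (insertSeq (evalSeq g) n i a) := by
  simp only [evalSeq, insertAt_apply]
  congr 1
  funext j
  simp only [insertArg, insertSeq, Fin.lt_def, Fin.ext_iff]
  rfl

lemma evalSeq_circ {m n : ℕ} (f : Cochain k A (m + 1)) (g : Cochain k A (n + 1)) (a : ℕ → A) :
    evalSeq (circ f g) a =
      ∑ i ∈ Finset.range (m + 1), (-1 : k) ^ (i * n) • evalSeq f (insertSeq (evalSeq g) n i a) := by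
  rw [Finset.sum_range fun i => (-1 : k) ^ (i * n) • evalSeq f (insertSeq (evalSeq g) n i a)]
  change (circ f g) _ = _
  simp only [circ, LinearMap.mk₂_apply, sum_apply, smul_apply]
  exact Finset.sum_congr rfl fun i _ => congrArg _ (evalSeq_insertAt f g i a)

lemma evalSeq_circ_cast {m n q : ℕ} (h : q + 1 = m + 1) (f : Cochain k A (q + 1))
    (g : Cochain k A (n + 1)) :
    evalSeq (circ (castArity h f) g) = evalSeq (circ f g) := by
  obtain rfl : q = m := by omega
  rfl

lemma evalSeq_circ_cast' {m n q : ℕ} (h : q + 1 = n + 1) (f : Cochain k A (m + 1))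
    (g : Cochain k A (q + 1)) :
    evalSeq (circ f (castArity h g)) = evalSeq (circ f g) := by
  obtain rfl : q = n := by omega
  rfl

/-- Inserting `h` into one of the places that `g` takes up is the same as inserting `g` with `h`
inserted. -/
lemma insertSeq_nested {A : Type*} (g h : (ℕ → A) → A) (n p i r : ℕ) (hr : r ≤ n) (a : ℕ → A) :
    insertSeq g n i (insertSeq h p (i + r) a) =
      insertSeq (fun b => g (insertSeq h p r b)) (n + p) i a := by
  funext j
  simp only [insertSeq]
  split_ifs with h1 h2 h3 h4 h5
  · rfl
  · omega
  · omega
  · congr 1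
    funext l
    simp only [Nat.add_lt_add_iff_left, Nat.add_left_cancel_iff, add_assoc, insertSeq]
  · omega
  · omega
  · rw [add_assoc]

/-- Insertions of `h` at `j` and of `g` further to the right commute, up to the shift of the place of
`g`. The functions depend on finitely many arguments only. -/
lemma insertSeq_comm {A : Type*} (g h : (ℕ → A) → A) (n p i j : ℕ) (hij : j < i)
    (hh : ∀ a b : ℕ → A, (∀ l ≤ p, a l = b l) → h a = h b) (a : ℕ → A) :
    insertSeq g n i (insertSeq h p j a) = insertSeq h p j (insertSeq g n (i + p) a) := by
  funext q
  simp only [insertSeq]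
  split_ifs <;> first | rfl | omega | skip
  · refine hh _ _ fun l hl => ?_
    rw [if_pos (by omega)]
  · congr 1
    funext l
    rw [if_neg (by omega), if_neg (by omega)]
    congr 1
    omega
  · congr 1
    omega

lemma evalSeq_insertSeq_sum {m n : ℕ} (f : Cochain k A (m + 1)) {ι : Type*} (s : Finset ι)
    (c : ι → k) (g : ι → (ℕ → A) → A) (i : ℕ) (hi : i ≤ m) (a : ℕ → A) :
    evalSeq f (insertSeq (fun b => ∑ x ∈ s, c x • g x b) n i a) =
      ∑ x ∈ s, c x • evalSeq f (insertSeq (g x) n i a) := by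
  have key (v : A) (h : (ℕ → A) → A) (hv : h (fun l => a (i + l)) = v) :
      evalSeq f (insertSeq h n i a) =
        f.toLinearMap (fun j => insertSeq (0 : (ℕ → A) → A) n i a j) ⟨i, by omega⟩ v := by
    subst hv
    simp only [evalSeq, MultilinearMap.toLinearMap_apply]
    congr 1
    funext j
    rw [Function.update_apply]
    simp only [insertSeq, Fin.ext_iff]
    split_ifs <;> first | rfl | omega
  rw [key _ _ rfl, map_sum]
  exact Finset.sum_congr rfl fun x _ => by rw [map_smul, ← key _ _ rfl]

/-- The part of `(f ∘ g) ∘ h` in which `h` is inserted to the left of `g`. -/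
def disjointInsertions {m n p : ℕ} (f : Cochain k A (m + 1)) (g : Cochain k A (n + 1))
    (h : Cochain k A (p + 1)) (a : ℕ → A) : A :=
  ∑ i ∈ Finset.range (m + 1), ∑ j ∈ Finset.range i, (-1 : k) ^ (j * p + i * n) •
    evalSeq f (insertSeq (evalSeq g) n i (insertSeq (evalSeq h) p j a))

lemma sum_range_split {M : Type*} [AddCommMonoid M] (F : ℕ → M) (m n i : ℕ) (hi : i ≤ m) :
    ∑ j ∈ Finset.range (m + n + 1), F j = ∑ j ∈ Finset.range i, F j +
      ∑ r ∈ Finset.range (n + 1), F (i + r) +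
      ∑ j ∈ Finset.Ico (i + 1) (m + 1), F (j + n) := by
  have e1 : m + n + 1 = i + ((n + 1) + (m - i)) := by omega
  rw [e1, Finset.sum_range_add, Finset.sum_range_add, ← add_assoc]
  congr 1
  rw [Finset.sum_Ico_eq_sum_range, show m + 1 - (i + 1) = m - i by omega]
  exact Finset.sum_congr rfl fun j _ => congrArg F (by omega)

/-- The associator of the composition product is the sum of the disjoint insertions; those with
`h` to the right of `g` are matched with the ones in which the roles are exchanged. -/
lemma evalSeq_associator {m n p : ℕ} (f : Cochain k A (m + 1)) (g : Cochain k A (n + 1))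
    (h : Cochain k A (p + 1)) (a : ℕ → A) :
    evalSeq (circ (circ f g) h) a = evalSeq (circ f (circ g h)) a +
      (disjointInsertions f g h a + (-1 : k) ^ (n * p) • disjointInsertions f h g a) := by
  have hloc {q : ℕ} (x : Cochain k A (q + 1)) :
      ∀ a b : ℕ → A, (∀ l ≤ q, a l = b l) → evalSeq x a = evalSeq x b :=
    fun a b hab => evalSeq_congr x fun j hj => hab j (by omega)
  have h1 : evalSeq (circ (circ f g) h) a =
      ∑ i ∈ Finset.range (m + 1), ∑ j ∈ Finset.range (m + n + 1), (-1 : k) ^ (j * p + i * n) •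
        evalSeq f (insertSeq (evalSeq g) n i (insertSeq (evalSeq h) p j a)) := by
    rw [evalSeq_circ, Finset.sum_comm]
    refine Finset.sum_congr rfl fun j _ => ?_
    rw [evalSeq_circ, Finset.smul_sum]
    exact Finset.sum_congr rfl fun i _ => by rw [smul_smul, pow_add]
  have h2 : evalSeq (circ f (circ g h)) a =
      ∑ i ∈ Finset.range (m + 1), ∑ r ∈ Finset.range (n + 1), (-1 : k) ^ ((i + r) * p + i * n) •
        evalSeq f (insertSeq (evalSeq g) n i (insertSeq (evalSeq h) p (i + r) a)) := by
    rw [evalSeq_circ]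
    refine Finset.sum_congr rfl fun i hi => ?_
    rw [show evalSeq (circ g h) = fun b => ∑ r ∈ Finset.range (n + 1), (-1 : k) ^ (r * p) •
      evalSeq g (insertSeq (evalSeq h) p r b) from funext fun b => evalSeq_circ g h b,
      evalSeq_insertSeq_sum _ _ _ _ _ (by simp at hi; omega), Finset.smul_sum]
    refine Finset.sum_congr rfl fun r hr => ?_
    rw [smul_smul, ← pow_add, insertSeq_nested _ _ _ _ _ _ (by simp at hr; omega)]
    congr 2
    ring
  have h3 : (-1 : k) ^ (n * p) • disjointInsertions f h g a =
      ∑ i ∈ Finset.range (m + 1), ∑ j ∈ Finset.Ico (i + 1) (m + 1),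
        (-1 : k) ^ ((j + n) * p + i * n) •
        evalSeq f (insertSeq (evalSeq g) n i (insertSeq (evalSeq h) p (j + n) a)) := by
    rw [disjointInsertions, Finset.smul_sum]
    simp only [Finset.smul_sum]
    rw [Finset.sum_sigma', Finset.sum_sigma']
    refine Finset.sum_bij' (fun x _ => ⟨x.2, x.1⟩) (fun x _ => ⟨x.2, x.1⟩) ?_ ?_ ?_ ?_ ?_
    · rintro ⟨x, y⟩ hx; simp at hx ⊢; omega
    · rintro ⟨x, y⟩ hx; simp at hx ⊢; omega
    · rintro ⟨x, y⟩ _; rfl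
    · rintro ⟨x, y⟩ _; rfl
    · rintro ⟨x, y⟩ hx
      simp at hx
      simp only
      rw [insertSeq_comm _ _ _ _ _ _ hx.2 (hloc g), smul_smul, ← pow_add]
      congr 2
      ring
  -- for a fixed place `i` of `g`, the place of `h` is left of `g`, inside of `g` or right of `g`
  rw [h1, h2, h3, disjointInsertions]
  simp only [← Finset.sum_add_distrib]
  refine Finset.sum_congr rfl fun i hi => ?_
  rw [sum_range_split _ m n i (by simp at hi; omega)]
  abel

/-- The composition product is a graded right pre-Lie product. -/
lemma evalSeq_preLie {m n p : ℕ} (f : Cochain k A (m + 1)) (g : Cochain k A (n + 1))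
    (h : Cochain k A (p + 1)) :
    evalSeq (circ (circ f g) h) - evalSeq (circ f (circ g h)) =
      (-1 : k) ^ (n * p) • (evalSeq (circ (circ f h) g) - evalSeq (circ f (circ h g))) := by
  funext a
  simp only [Pi.sub_apply, Pi.smul_apply]
  rw [evalSeq_associator f g h, evalSeq_associator f h g, add_sub_cancel_left,
    add_sub_cancel_left, smul_add, smul_smul, mul_comm p n, ← pow_add, Even.neg_one_pow ⟨_, rfl⟩,
    one_smul, add_comm]

lemma evalSeq_gerstenhaber {m n : ℕ} (f : Cochain k A (m + 1)) (g : Cochain k A (n + 1)) :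
    evalSeq (gerstenhaber f g) =
      evalSeq (circ f g) - (-1 : k) ^ (m * n) • evalSeq (circ g f) := by
  simp [gerstenhaber]

lemma evalSeq_circ_gerstenhaber {m n p : ℕ} (f : Cochain k A (m + 1)) (g : Cochain k A (n + 1))
    (h : Cochain k A (p + 1)) :
    evalSeq (circ f (gerstenhaber g h)) =
      evalSeq (circ f (circ g h)) - (-1 : k) ^ (n * p) • evalSeq (circ f (circ h g)) := by
  simp only [gerstenhaber, LinearMap.mk₂_apply, map_sub, map_smul, evalSeq_sub, evalSeq_smul,
    evalSeq_circ_cast']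

lemma evalSeq_gerstenhaber_circ {m n p : ℕ} (f : Cochain k A (m + 1)) (g : Cochain k A (n + 1))
    (h : Cochain k A (p + 1)) :
    evalSeq (circ (gerstenhaber f g) h) =
      evalSeq (circ (circ f g) h) - (-1 : k) ^ (m * n) • evalSeq (circ (circ g f) h) := by
  simp only [gerstenhaber, LinearMap.mk₂_apply, map_sub, map_smul, LinearMap.sub_apply,
    LinearMap.smul_apply, evalSeq_sub, evalSeq_smul, evalSeq_circ_cast]

lemma evalSeq_gerstenhaber_symm {m n : ℕ} (f : Cochain k A (m + 1)) (g : Cochain k A (n + 1)) :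
    evalSeq (gerstenhaber f g) = -((-1 : k) ^ (m * n) • evalSeq (gerstenhaber g f)) := by
  rw [evalSeq_gerstenhaber, evalSeq_gerstenhaber, smul_sub, smul_smul, mul_comm n m, ← pow_add,
    Even.neg_one_pow ⟨_, rfl⟩, one_smul]
  abel

/-- The graded Jacobi identity of the Gerstenhaber bracket. -/
lemma evalSeq_gerstenhaber_jacobi {m n p : ℕ} (f : Cochain k A (m + 1))
    (g : Cochain k A (n + 1)) (h : Cochain k A (p + 1)) :
    evalSeq (gerstenhaber f (gerstenhaber g h)) =
      evalSeq (gerstenhaber (gerstenhaber f g) h) +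
      (-1 : k) ^ (m * n) • evalSeq (gerstenhaber g (gerstenhaber f h)) := by
  simp only [evalSeq_gerstenhaber, evalSeq_circ_gerstenhaber, evalSeq_gerstenhaber_circ]
  have e1 := sub_eq_iff_eq_add.1 (evalSeq_preLie f g h)
  have e2 := sub_eq_iff_eq_add.1 (evalSeq_preLie g f h)
  have e3 := sub_eq_iff_eq_add.1 (evalSeq_preLie h f g)
  rw [e1, e2, e3]
  -- the signs depend on the parities of the degrees only
  rcases neg_one_pow_eq_or k m with hm | hm <;> rcases neg_one_pow_eq_or k n with hn | hn <;>
    rcases neg_one_pow_eq_or k p with hp | hp <;>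
    simp only [mul_add, add_mul, pow_add, pow_mul, hm, hn, hp, one_pow, mul_one,
      neg_smul, one_smul, mul_neg, neg_neg] <;> abel

end PreLie

/-! ### The Poincaré–Birkhoff–Witt filtration of the free superalgebra -/

section SuperFiltration

variable {k : Type u} [Field k] {κ κ' : Type*}

variable (k κ) in
/-- The parity automorphism of the free algebra, all generators being odd. -/
def parity : FreeAlgebra k κ →ₐ[k] FreeAlgebra k κ := FreeAlgebra.lift k fun s => -FreeAlgebra.ι k s

/-- `SuperLie p u`: `u` is an iterated supercommutator, of degree `p`, of the generators of the free
superalgebra on odd generators (or `u = 0`). -/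
inductive SuperLie : ℕ → FreeAlgebra k κ → Prop
  | gen (s : κ) : SuperLie 1 (FreeAlgebra.ι k s)
  | zero (p : ℕ) : SuperLie p 0
  | bracket {p q : ℕ} {a b : FreeAlgebra k κ} (ha : SuperLie p a) (hb : SuperLie q b) :
      SuperLie (p + q) (a * b - (-1 : k) ^ (p * q) • (b * a))

variable (k κ) in
/-- The free Lie superalgebra inside the free superalgebra. -/
def superLieSpan : Submodule k (FreeAlgebra k κ) := Submodule.span k {u | ∃ p, SuperLie p u}

variable (k κ) in
/-- The Poincaré–Birkhoff–Witt filtration of the free superalgebra, as the enveloping algebra of the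
free Lie superalgebra. -/
def pbw (q : ℕ) : Submodule k (FreeAlgebra k κ) := (1 ⊔ superLieSpan k κ) ^ q

lemma SuperLie.mem {p : ℕ} {u : FreeAlgebra k κ} (h : SuperLie p u) : u ∈ superLieSpan k κ :=
  Submodule.subset_span ⟨p, h⟩

lemma one_le_sup : (1 : Submodule k (FreeAlgebra k κ)) ≤ 1 ⊔ superLieSpan k κ := le_sup_left

lemma SuperLie.mem_pbw_one {p : ℕ} {u : FreeAlgebra k κ} (h : SuperLie p u) : u ∈ pbw k κ 1 := by
  rw [pbw, pow_one]
  exact Submodule.mem_sup_right h.mem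

lemma pbw_mono {q r : ℕ} (h : q ≤ r) : pbw k κ q ≤ pbw k κ r :=
  pow_le_pow_right₀ one_le_sup h

lemma one_mem_pbw (q : ℕ) : (1 : FreeAlgebra k κ) ∈ pbw k κ q :=
  pbw_mono (Nat.zero_le q) (by rw [pbw, pow_zero]; exact Submodule.one_le.1 le_rfl)

lemma mul_mem_pbw {q r : ℕ} {u v : FreeAlgebra k κ} (hu : u ∈ pbw k κ q) (hv : v ∈ pbw k κ r) :
    u * v ∈ pbw k κ (q + r) := by
  rw [pbw, pow_add]
  exact Submodule.mul_mem_mul hu hv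

/-- Induction along `U_{q+1} = (1 + L) U_q`. -/
lemma pbw_succ_le {q : ℕ} {N : Submodule k (FreeAlgebra k κ)} (h1 : pbw k κ q ≤ N)
    (h2 : ∀ p l, SuperLie p l → ∀ u ∈ pbw k κ q, l * u ∈ N) : pbw k κ (q + 1) ≤ N := by
  rw [pbw, pow_succ', Submodule.mul_le]
  intro m hm u hu
  obtain ⟨c, hc, l, hl, rfl⟩ := Submodule.mem_sup.1 hm
  rw [add_mul]
  refine add_mem ?_ ?_
  · obtain ⟨c, rfl⟩ := Submodule.mem_one.1 hc
    rw [← Algebra.smul_def]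
    exact N.smul_mem c (h1 hu)
  · induction hl using Submodule.span_induction with
    | mem l hl => obtain ⟨p, hl⟩ := hl; exact h2 p l hl u hu
    | zero => simp
    | add x y _ _ hx hy =>
      rw [add_mul]
      exact add_mem (hx (Submodule.add_mem_sup hc (by assumption)))
        (hy (Submodule.add_mem_sup hc (by assumption)))
    | smul c' x _ hx =>
      rw [smul_mul_assoc]
      exact N.smul_mem _ (hx (Submodule.add_mem_sup hc (by assumption)))

@[simp] lemma parity_ι (s : κ) : parity k κ (FreeAlgebra.ι k s) = -FreeAlgebra.ι k s := by
  simp [parity]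

lemma parity_parity (u : FreeAlgebra k κ) : parity k κ (parity k κ u) = u := by
  have : (parity k κ).comp (parity k κ) = AlgHom.id k _ := by
    ext s; simp
  exact DFunLike.congr_fun this u

lemma SuperLie.parity {p : ℕ} {u : FreeAlgebra k κ} (h : SuperLie p u) :
    parity k κ u = (-1 : k) ^ p • u := by
  induction h with
  | gen s => simp
  | zero p => simp
  | @bracket p q a b _ _ ha hb =>
    rw [map_sub, map_smul, map_mul, map_mul, ha, hb, smul_mul_smul_comm, smul_mul_smul_comm,
      smul_sub, ← pow_add, ← pow_add, add_comm q p, smul_comm]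

lemma parity_mem_pbw {q : ℕ} {u : FreeAlgebra k κ} (h : u ∈ pbw k κ q) :
    parity k κ u ∈ pbw k κ q := by
  suffices pbw k κ q ≤ (pbw k κ q).comap (parity k κ).toLinearMap from this h
  clear h u
  induction q with
  | zero =>
    intro u hu
    rw [pbw, pow_zero] at hu
    obtain ⟨c, rfl⟩ := Submodule.mem_one.1 hu
    simp only [Submodule.mem_comap, AlgHom.toLinearMap_apply, AlgHom.commutes]
    rw [Algebra.algebraMap_eq_smul_one]
    exact Submodule.smul_mem _ _ (one_mem_pbw 0)
  | succ q ih =>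
    refine pbw_succ_le (fun u hu => pbw_mono (Nat.le_succ q) (ih hu)) fun p l hl u hu => ?_
    simp only [Submodule.mem_comap, AlgHom.toLinearMap_apply, map_mul]
    rw [hl.parity, add_comm]
    exact mul_mem_pbw (Submodule.smul_mem _ _ hl.mem_pbw_one) (ih hu)

lemma parity_pow_mem_pbw {q : ℕ} (p : ℕ) {u : FreeAlgebra k κ} (h : u ∈ pbw k κ q) :
    (parity k κ ^ p) u ∈ pbw k κ q := by
  induction p with
  | zero => simpa using h
  | succ p ih => rw [pow_succ', AlgHom.mul_apply]; exact parity_mem_pbw ih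

lemma SuperLie.parity_pow {p : ℕ} {u : FreeAlgebra k κ} (h : SuperLie p u) (r : ℕ) :
    (PoissonDef.parity k κ ^ r) u = (-1 : k) ^ (r * p) • u := by
  induction r with
  | zero => simp
  | succ r ih =>
    rw [pow_succ', AlgHom.mul_apply, ih, map_smul, h.parity, smul_smul, ← pow_add, add_mul, one_mul]

/-- Supercommutators with elements of the Lie superalgebra do not raise the filtration. (The parity
automorphism produces the sign `(-1)^(p d)` on the part of degree `d` of `u`.) -/
lemma superComm_mem_pbw {p q : ℕ} {l u : FreeAlgebra k κ} (hl : SuperLie p l)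
    (hu : u ∈ pbw k κ q) : u * l - l * (parity k κ ^ p) u ∈ pbw k κ q := by
  let T : FreeAlgebra k κ →ₗ[k] FreeAlgebra k κ :=
    LinearMap.mulRight k l - LinearMap.mulLeft k l ∘ₗ (parity k κ ^ p).toLinearMap
  suffices pbw k κ q ≤ (pbw k κ q).comap T from this hu
  clear hu u
  induction q with
  | zero =>
    intro u hu
    rw [pbw, pow_zero] at hu
    obtain ⟨c, rfl⟩ := Submodule.mem_one.1 hu
    simp only [T, Submodule.mem_comap, LinearMap.sub_apply, LinearMap.mulRight_apply,
      LinearMap.comp_apply, AlgHom.toLinearMap_apply, LinearMap.mulLeft_apply, AlgHom.commutes]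
    rw [← Algebra.commutes, sub_self]
    exact zero_mem _
  | succ q ih =>
    refine pbw_succ_le (fun u hu => pbw_mono (Nat.le_succ q) (ih hu)) fun p' l' hl' u hu => ?_
    have h1 : u * l - l * (parity k κ ^ p) u ∈ pbw k κ q := ih hu
    -- this is the bracket of `l'` and `l`, an element of the Lie superalgebra
    have h2 : l' * l - l * (parity k κ ^ p) l' ∈ pbw k κ 1 := by
      have := (hl'.bracket hl).mem_pbw_one
      rwa [hl'.parity_pow, mul_smul_comm, mul_comm p p']
    simp only [T, Submodule.mem_comap, LinearMap.sub_apply, LinearMap.mulRight_apply,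
      LinearMap.comp_apply, AlgHom.toLinearMap_apply, LinearMap.mulLeft_apply, map_mul]
    have h3 : l' * u * l - l * ((parity k κ ^ p) l' * (parity k κ ^ p) u) =
        l' * (u * l - l * (parity k κ ^ p) u) +
        (l' * l - l * (parity k κ ^ p) l') * (parity k κ ^ p) u := by noncomm_ring
    rw [h3, add_comm q 1]
    exact add_mem (mul_mem_pbw hl'.mem_pbw_one h1)
      (mul_mem_pbw h2 (parity_pow_mem_pbw p hu))

/-! ### Superderivations -/

section Derivation

variable (ρ : FreeAlgebra k κ →ₐ[k] FreeAlgebra k κ') (r : ℕ) (Q : κ → FreeAlgebra k κ')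

/-- The homomorphism to upper triangular matrices that encodes a superderivation: its upper right
entry satisfies the Leibniz rule because of the rule for matrix products. -/
def triangularHom : FreeAlgebra k κ →ₐ[k] Matrix (Fin 2) (Fin 2) (FreeAlgebra k κ') :=
  FreeAlgebra.lift k fun s => !![(parity k κ' ^ r) (ρ (FreeAlgebra.ι k s)), Q s;
    0, ρ (FreeAlgebra.ι k s)]

lemma triangularHom_apply (u : FreeAlgebra k κ) :
    triangularHom ρ r Q u 0 0 = (parity k κ' ^ r) (ρ u) ∧
      triangularHom ρ r Q u 1 0 = 0 ∧ triangularHom ρ r Q u 1 1 = ρ u := by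
  induction u using FreeAlgebra.induction with
  | grade0 c => simp [AlgHom.commutes, Matrix.algebraMap_matrix_apply]
  | grade1 s => simp [triangularHom]
  | mul a b ha hb =>
    simp [map_mul, Matrix.mul_apply, Fin.sum_univ_two, ha, hb]
  | add a b ha hb => simp [map_add, Matrix.add_apply, ha, hb]

/-- The superderivation `D` along `ρ` of parity `r` with `D s = Q s` on generators. -/
def superDer : FreeAlgebra k κ →ₗ[k] FreeAlgebra k κ' where
  toFun u := triangularHom ρ r Q u 0 1
  map_add' u v := by simp [map_add]
  map_smul' c u := by simp [map_smul]

lemma superDer_ι (s : κ) : superDer ρ r Q (FreeAlgebra.ι k s) = Q s := by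
  simp [superDer, triangularHom]

lemma superDer_one : superDer ρ r Q 1 = 0 := by
  simp [superDer]

lemma superDer_mul (u v : FreeAlgebra k κ) :
    superDer ρ r Q (u * v) =
      superDer ρ r Q u * ρ v + (parity k κ' ^ r) (ρ u) * superDer ρ r Q v := by
  change triangularHom ρ r Q (u * v) 0 1 = _
  rw [map_mul, Matrix.mul_apply, Fin.sum_univ_two, (triangularHom_apply ρ r Q u).1,
    (triangularHom_apply ρ r Q v).2.2, add_comm]
  rfl

lemma SuperLie.map (hρ : ∀ s, SuperLie 1 (ρ (FreeAlgebra.ι k s))) {p : ℕ} {u : FreeAlgebra k κ}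
    (h : SuperLie p u) : SuperLie p (ρ u) := by
  induction h with
  | gen s => exact hρ s
  | zero p => rw [map_zero]; exact .zero p
  | bracket _ _ ha hb => rw [map_sub, map_smul, map_mul, map_mul]; exact ha.bracket hb

lemma map_mem_pbw (hρ : ∀ s, SuperLie 1 (ρ (FreeAlgebra.ι k s))) {q : ℕ} {u : FreeAlgebra k κ}
    (h : u ∈ pbw k κ q) : ρ u ∈ pbw k κ' q := by
  suffices pbw k κ q ≤ (pbw k κ' q).comap ρ.toLinearMap from this h
  clear h u
  induction q with
  | zero =>
    intro u hu
    rw [pbw, pow_zero] at hu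
    obtain ⟨c, rfl⟩ := Submodule.mem_one.1 hu
    simp only [Submodule.mem_comap, AlgHom.toLinearMap_apply, AlgHom.commutes]
    rw [Algebra.algebraMap_eq_smul_one]
    exact Submodule.smul_mem _ _ (one_mem_pbw 0)
  | succ q ih =>
    refine pbw_succ_le (fun u hu => pbw_mono (Nat.le_succ q) (ih hu)) fun p l hl u hu => ?_
    simp only [Submodule.mem_comap, AlgHom.toLinearMap_apply, map_mul]
    rw [add_comm]
    exact mul_mem_pbw (hl.map ρ hρ).mem_pbw_one (ih hu)

variable {j : ℕ} (hρ : ∀ s, SuperLie 1 (ρ (FreeAlgebra.ι k s))) (hQ : ∀ s, Q s ∈ pbw k κ' j)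
  (hQ' : ∀ s, parity k κ' (Q s) = (-1 : k) ^ (r + 1) • Q s)

include hρ hQ hQ' in
/-- A superderivation with values in `U_j` on generators maps the whole Lie superalgebra to `U_j`: its
value on a bracket is a combination of supercommutators with elements of the Lie superalgebra. -/
lemma superDer_superLie {p : ℕ} {l : FreeAlgebra k κ} (hl : SuperLie p l) :
    superDer ρ r Q l ∈ pbw k κ' j ∧
      parity k κ' (superDer ρ r Q l) = (-1 : k) ^ (r + p) • superDer ρ r Q l := by
  have par {v : FreeAlgebra k κ'} {d : ℕ} (hv : parity k κ' v = (-1 : k) ^ d • v) (q : ℕ) :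
      (parity k κ' ^ q) v = (-1 : k) ^ (q * d) • v := by
    induction q with
    | zero => simp
    | succ q ih =>
      rw [pow_succ', AlgHom.mul_apply, ih, map_smul, hv, smul_smul, ← pow_add, add_mul, one_mul]
  induction hl with
  | gen s => rw [superDer_ι]; exact ⟨hQ s, hQ' s⟩
  | zero p => rw [map_zero]; exact ⟨zero_mem _, by simp⟩
  | @bracket p q a b ha hb iha ihb =>
    have ha' := ha.map ρ hρ
    have hb' := hb.map ρ hρ
    obtain ⟨ha1, ha2⟩ := iha
    obtain ⟨hb1, hb2⟩ := ihb
    have e : superDer ρ r Q (a * b - (-1 : k) ^ (p * q) • (b * a)) =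
        (superDer ρ r Q a * ρ b - ρ b * (parity k κ' ^ q) (superDer ρ r Q a)) -
        (-1 : k) ^ (p * q) • (superDer ρ r Q b * ρ a -
          ρ a * (parity k κ' ^ p) (superDer ρ r Q b)) := by
      rw [map_sub, map_smul, superDer_mul, superDer_mul, par ha2, par hb2, ha'.parity_pow,
        hb'.parity_pow]
      simp only [smul_mul_assoc, mul_smul_comm, smul_add, smul_sub, smul_smul, ← pow_add]
      rw [show p * q + p * (r + q) = (p * q) + (p * q) + r * p by ring,
        show p * q + r * q = q * (r + p) by ring, pow_add _ (p * q + p * q),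
        Even.neg_one_pow ⟨_, rfl⟩, one_mul]
      abel
    constructor
    · rw [e]
      exact sub_mem (superComm_mem_pbw hb' ha1)
        (Submodule.smul_mem _ _ (superComm_mem_pbw ha' hb1))
    · rw [e, par ha2, par hb2]
      simp only [map_sub, map_smul, map_mul, ha2, hb2, ha'.parity, hb'.parity, smul_sub,
        smul_mul_assoc, mul_smul_comm, smul_smul, ← pow_add]
      congr 3 <;> congr 1 <;> ring_nf

include hρ hQ hQ' in
/-- A superderivation with values in `U_j` on generators maps `U_i` to `U_{i+j-1}`. -/
lemma superDer_mem_pbw (i : ℕ) {u : FreeAlgebra k κ} (hu : u ∈ pbw k κ i) :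
    superDer ρ r Q u ∈ pbw k κ' (i + j - 1) := by
  suffices pbw k κ i ≤ (pbw k κ' (i + j - 1)).comap (superDer ρ r Q) from this hu
  clear hu u
  induction i with
  | zero =>
    intro u hu
    rw [pbw, pow_zero] at hu
    obtain ⟨c, rfl⟩ := Submodule.mem_one.1 hu
    rw [Submodule.mem_comap, Algebra.algebraMap_eq_smul_one, map_smul, superDer_one, smul_zero]
    exact zero_mem _
  | succ i ih =>
    refine pbw_succ_le (fun u hu => pbw_mono (by omega) (ih hu)) fun p l hl u hu => ?_
    rw [Submodule.mem_comap, superDer_mul]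
    refine add_mem ?_ ?_
    · rw [show i + 1 + j - 1 = j + i by omega]
      exact mul_mem_pbw (superDer_superLie ρ r Q hρ hQ hQ' hl).1 (map_mem_pbw ρ hρ hu)
    -- for `i = 0` the subtraction in `i + j - 1` may truncate, but `D` vanishes on constants
    · rcases Nat.eq_zero_or_pos i with rfl | hi
      · rw [pbw, pow_zero] at hu
        obtain ⟨c, rfl⟩ := Submodule.mem_one.1 hu
        rw [Algebra.algebraMap_eq_smul_one, map_smul, superDer_one, smul_zero, mul_zero]
        exact zero_mem _
      · rw [show i + 1 + j - 1 = 1 + (i + j - 1) by omega]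
        exact mul_mem_pbw (parity_pow_mem_pbw r (hl.map ρ hρ).mem_pbw_one) (ih hu)

end Derivation

end SuperFiltration

/-! ### The Adams operation -/

section Adams

variable {k : Type u} [Field k] {κ : Type*}

variable (k κ) in
/-- The (super)coproduct of the free superalgebra, for which the generators are primitive; it takes
values in the algebra of operators of `U ⊗ U`, in which `a ⊗ b` of the graded tensor product is
represented by a product of left multiplications and parity automorphisms. -/
def coprodOp : FreeAlgebra k κ →ₐ[k] Module.End k (FreeAlgebra k κ ⊗[k] FreeAlgebra k κ) :=
  FreeAlgebra.lift k fun s =>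
    TensorProduct.map (LinearMap.mulLeft k (FreeAlgebra.ι k s)) LinearMap.id +
      TensorProduct.map (parity k κ).toLinearMap (LinearMap.mulLeft k (FreeAlgebra.ι k s))

/-- All elements of the Lie superalgebra are primitive. -/
lemma coprodOp_superLie {p : ℕ} {l : FreeAlgebra k κ} (hl : SuperLie p l) :
    coprodOp k κ l = TensorProduct.map (LinearMap.mulLeft k l) LinearMap.id +
      TensorProduct.map (parity k κ ^ p).toLinearMap (LinearMap.mulLeft k l) := by
  induction hl with
  | gen s => simp [coprodOp]
  | zero p => ext; simp
  | @bracket p q a b ha hb iha ihb =>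
    rw [map_sub, map_smul, map_mul, map_mul, iha, ihb]
    refine TensorProduct.ext' fun u v => ?_
    have h1 (w : FreeAlgebra k κ) : (parity k κ ^ q) ((parity k κ ^ p) w) =
        (parity k κ ^ (p + q)) w := by
      rw [← AlgHom.mul_apply, ← pow_add, add_comm]
    have h2 (w : FreeAlgebra k κ) : (parity k κ ^ p) ((parity k κ ^ q) w) =
        (parity k κ ^ (p + q)) w := by
      rw [← AlgHom.mul_apply, ← pow_add]
    simp only [LinearMap.sub_apply, LinearMap.smul_apply, Module.End.mul_apply,
      LinearMap.add_apply, TensorProduct.map_tmul, LinearMap.mulLeft_apply, LinearMap.id_apply,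
      AlgHom.toLinearMap_apply, map_add, map_mul, ha.parity_pow, hb.parity_pow, h1, h2, smul_add,
      smul_mul_assoc, TensorProduct.smul_tmul', sub_mul, TensorProduct.sub_tmul,
      TensorProduct.tmul_sub, TensorProduct.tmul_smul, mul_assoc, smul_smul, ← pow_add]
    rw [mul_comm q p, Even.neg_one_pow (n := p * q + p * q) ⟨_, rfl⟩, one_smul]
    abel

variable (k κ) in
/-- The Adams operator `ψ² = μ ∘ Δ` of the free superalgebra. -/
def adams : FreeAlgebra k κ →ₗ[k] FreeAlgebra k κ :=
  LinearMap.mul' k _ ∘ₗ (LinearMap.applyₗ (1 ⊗ₜ 1)) ∘ₗ (coprodOp k κ).toLinearMap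

lemma adams_apply (u : FreeAlgebra k κ) :
    adams k κ u = LinearMap.mul' k _ (coprodOp k κ u (1 ⊗ₜ 1)) := rfl

variable (k κ) in
/-- The total filtration of `U ⊗ U`. -/
def pbwTensor (q : ℕ) : Submodule k (FreeAlgebra k κ ⊗[k] FreeAlgebra k κ) :=
  Submodule.span k {t | ∃ a b u v, a + b = q ∧ u ∈ pbw k κ a ∧ v ∈ pbw k κ b ∧ t = u ⊗ₜ v}

lemma tmul_mem_pbwTensor {a b q : ℕ} (h : a + b = q) {u v : FreeAlgebra k κ} (hu : u ∈ pbw k κ a)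
    (hv : v ∈ pbw k κ b) : u ⊗ₜ v ∈ pbwTensor k κ q :=
  Submodule.subset_span ⟨a, b, u, v, h, hu, hv, rfl⟩

lemma pbwTensor_mono (q : ℕ) : pbwTensor k κ q ≤ pbwTensor k κ (q + 1) := by
  refine Submodule.span_le.2 ?_
  rintro _ ⟨a, b, u, v, rfl, hu, hv, rfl⟩
  exact tmul_mem_pbwTensor (show a + 1 + b = _ by omega) (pbw_mono (Nat.le_succ a) hu) hv

lemma coprodOp_mem_pbwTensor {q : ℕ} {u : FreeAlgebra k κ} (hu : u ∈ pbw k κ q) :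
    coprodOp k κ u (1 ⊗ₜ 1) ∈ pbwTensor k κ q := by
  suffices pbw k κ q ≤ (pbwTensor k κ q).comap
    ((LinearMap.applyₗ (1 ⊗ₜ 1)) ∘ₗ (coprodOp k κ).toLinearMap) from this hu
  clear hu u
  induction q with
  | zero =>
    intro u hu
    rw [pbw, pow_zero] at hu
    obtain ⟨c, rfl⟩ := Submodule.mem_one.1 hu
    simp only [Submodule.mem_comap, LinearMap.comp_apply, AlgHom.toLinearMap_apply, AlgHom.commutes,
      LinearMap.applyₗ_apply_apply, Module.algebraMap_end_apply]
    exact Submodule.smul_mem _ _ (tmul_mem_pbwTensor (add_zero 0) (one_mem_pbw 0) (one_mem_pbw 0))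
  | succ q ih =>
    refine pbw_succ_le (fun u hu => pbwTensor_mono q (ih hu)) fun p l hl u hu => ?_
    have h := ih hu
    simp only [Submodule.mem_comap, LinearMap.comp_apply, AlgHom.toLinearMap_apply,
      LinearMap.applyₗ_apply_apply, map_mul, Module.End.mul_apply] at h ⊢
    rw [coprodOp_superLie hl]
    generalize coprodOp k κ u (1 ⊗ₜ 1) = t at h
    induction h using Submodule.span_induction with
    | mem t ht =>
      obtain ⟨a, b, u, v, rfl, hu, hv, rfl⟩ := ht
      simp only [LinearMap.add_apply, TensorProduct.map_tmul, LinearMap.mulLeft_apply,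
        LinearMap.id_apply, AlgHom.toLinearMap_apply]
      exact add_mem
        (tmul_mem_pbwTensor (show 1 + a + b = _ by omega) (mul_mem_pbw hl.mem_pbw_one hu) hv)
        (tmul_mem_pbwTensor (show a + (1 + b) = _ by omega) (parity_pow_mem_pbw p hu)
          (mul_mem_pbw hl.mem_pbw_one hv))
    | zero => rw [map_zero]; exact zero_mem _
    | add x y _ _ hx hy => rw [map_add]; exact add_mem hx hy
    | smul c x _ hx => rw [map_smul]; exact Submodule.smul_mem _ _ hx

/-- Multiplying by a primitive element doubles the Adams operator up to lower order: the coproduct of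
`l` is `l ⊗ 1 + 1 ⊗ l`, and `l` can be moved to the left across the first factor up to lower order. -/
lemma adams_superLie_mul {p q : ℕ} {l u : FreeAlgebra k κ} (hl : SuperLie p l)
    (hu : u ∈ pbw k κ q) : adams k κ (l * u) - (2 : k) • (l * adams k κ u) ∈ pbw k κ q := by
  have h := coprodOp_mem_pbwTensor hu
  rw [adams_apply, adams_apply, map_mul, Module.End.mul_apply, coprodOp_superLie hl]
  generalize coprodOp k κ u (1 ⊗ₜ 1) = t at h
  induction h using Submodule.span_induction with
  | mem t ht =>
    obtain ⟨a, b, u, v, rfl, hu, hv, rfl⟩ := ht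
    have h1 := superComm_mem_pbw hl (parity_pow_mem_pbw p hu)
    have h2 : (parity k κ ^ p) ((parity k κ ^ p) u) = u := by
      rw [← AlgHom.mul_apply, ← pow_add, ← two_mul, pow_mul,
        show parity k κ ^ 2 = 1 from AlgHom.ext fun u => parity_parity u, one_pow, AlgHom.one_apply]
    rw [h2] at h1
    have h3 : l * u * v + (parity k κ ^ p) u * (l * v) - (2 : k) • (l * (u * v)) =
        ((parity k κ ^ p) u * l - l * u) * v := by
      rw [two_smul]; noncomm_ring
    simp only [LinearMap.add_apply, TensorProduct.map_tmul, LinearMap.mulLeft_apply,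
      LinearMap.id_apply, AlgHom.toLinearMap_apply, map_add, LinearMap.mul'_apply]
    rw [h3]
    exact mul_mem_pbw h1 hv
  | zero => simp
  | add x y _ _ hx hy =>
    simp only [map_add, mul_add, smul_add] at hx hy ⊢
    rw [add_sub_add_comm]
    exact add_mem hx hy
  | smul c x _ hx =>
    rw [map_smul, map_smul, map_smul, mul_smul_comm, smul_comm _ c, ← smul_sub]
    exact Submodule.smul_mem _ _ hx

variable (k κ) in
/-- The previous step of the filtration, which is zero in degree zero. -/
def pbwPred : ℕ → Submodule k (FreeAlgebra k κ)
  | 0 => ⊥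
  | q + 1 => pbw k κ q

lemma pbwPred_le (q : ℕ) : pbwPred k κ q ≤ pbw k κ q := by
  cases q with
  | zero => exact bot_le
  | succ q => exact pbw_mono (Nat.le_succ q)

lemma superLie_mul_pbwPred {p q : ℕ} {l u : FreeAlgebra k κ} (hl : SuperLie p l)
    (hu : u ∈ pbwPred k κ q) : l * u ∈ pbw k κ q := by
  cases q with
  | zero =>
    rw [show u = 0 from hu, mul_zero]
    exact zero_mem _
  | succ q => rw [add_comm q 1]; exact mul_mem_pbw hl.mem_pbw_one hu

/-- The Adams operator acts on the associated graded of the filtration in degree `q` by `2^q`. -/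
lemma adams_sub_mem {q : ℕ} {u : FreeAlgebra k κ} (hu : u ∈ pbw k κ q) :
    adams k κ u - (2 : k) ^ q • u ∈ pbwPred k κ q := by
  suffices pbw k κ q ≤ (pbwPred k κ q).comap (adams k κ - (2 : k) ^ q • LinearMap.id) from this hu
  clear hu u
  induction q with
  | zero =>
    intro u hu
    rw [pbw, pow_zero] at hu
    obtain ⟨c, rfl⟩ := Submodule.mem_one.1 hu
    rw [Algebra.algebraMap_eq_smul_one]
    refine Submodule.smul_mem _ _ ?_
    simp [adams_apply]
  | succ q ih =>
    refine pbw_succ_le (fun u hu => ?_) fun p l hl u hu => ?_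
    · have h : adams k κ u - (2 : k) ^ q • u ∈ pbw k κ q := pbwPred_le q (ih hu)
      change adams k κ u - (2 : k) ^ (q + 1) • u ∈ pbw k κ q
      have e : adams k κ u - (2 : k) ^ (q + 1) • u =
          (adams k κ u - (2 : k) ^ q • u) - (2 : k) ^ q • u := by
        rw [pow_succ, mul_comm, mul_smul, two_smul]; abel
      rw [e]
      exact sub_mem h (Submodule.smul_mem _ _ hu)
    · have h : adams k κ u - (2 : k) ^ q • u ∈ pbwPred k κ q := ih hu
      change adams k κ (l * u) - (2 : k) ^ (q + 1) • (l * u) ∈ pbw k κ q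
      have e : adams k κ (l * u) - (2 : k) ^ (q + 1) • (l * u) =
          (adams k κ (l * u) - (2 : k) • (l * adams k κ u)) +
          (2 : k) • (l * (adams k κ u - (2 : k) ^ q • u)) := by
        rw [mul_sub, smul_sub, mul_smul_comm, smul_smul, pow_succ, mul_comm]; abel
      rw [e]
      exact add_mem (adams_superLie_mul hl hu)
        (Submodule.smul_mem _ _ (superLie_mul_pbwPred hl h))

end Adams

/-! ### Shuffles and the coproduct -/

section Shuffles

variable {k : Type u} [Field k] {κ : Type*}

variable (k) in
/-- The monomial of the free algebra given by a list of generators. -/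
def monomial (l : List κ) : FreeAlgebra k κ := (l.map (FreeAlgebra.ι k)).prod

@[simp] lemma monomial_nil : monomial k ([] : List κ) = 1 := rfl

@[simp] lemma monomial_cons (s : κ) (l : List κ) :
    monomial k (s :: l) = FreeAlgebra.ι k s * monomial k l := by simp [monomial]

@[simp] lemma monomial_append (l l' : List κ) :
    monomial k (l ++ l') = monomial k l * monomial k l' := by simp [monomial]

lemma parity_pow_monomial (r : ℕ) (l : List κ) :
    (parity k κ ^ r) (monomial k l) = (-1 : k) ^ (r * l.length) • monomial k l := by
  induction l with
  | nil => simp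
  | cons s l ih =>
    rw [monomial_cons, map_mul, ih, (SuperLie.gen s).parity_pow, smul_mul_smul_comm, ← pow_add,
      List.length_cons, mul_add, add_comm]

lemma monomial_mem_pbw (l : List κ) : monomial k l ∈ pbw k κ l.length := by
  induction l with
  | nil => exact one_mem_pbw 0
  | cons s l ih =>
    rw [monomial_cons, List.length_cons, add_comm]
    exact mul_mem_pbw (SuperLie.gen s).mem_pbw_one ih

/-- The permutation of `{0, …, n}` with `j ↦ 0` that permutes the other elements by `ρ`. -/
def insertPerm {n : ℕ} (j : Fin (n + 1)) (ρ : Equiv.Perm (Fin n)) : Equiv.Perm (Fin (n + 1)) :=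
  Equiv.Perm.decomposeFin.symm (0, ρ) * Fin.cycleRange j

lemma insertPerm_self {n : ℕ} (j : Fin (n + 1)) (ρ : Equiv.Perm (Fin n)) :
    insertPerm j ρ j = 0 := by
  simp [insertPerm, Equiv.Perm.mul_apply, Fin.cycleRange_self]

lemma insertPerm_succAbove {n : ℕ} (j : Fin (n + 1)) (ρ : Equiv.Perm (Fin n)) (q : Fin n) :
    insertPerm j ρ (j.succAbove q) = (ρ q).succ := by
  simp [insertPerm, Equiv.Perm.mul_apply, Fin.cycleRange_succAbove]

lemma sign_insertPerm {n : ℕ} (j : Fin (n + 1)) (ρ : Equiv.Perm (Fin n)) :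
    Equiv.Perm.sign (insertPerm j ρ) = (-1) ^ (j : ℕ) * Equiv.Perm.sign ρ := by
  rw [insertPerm, map_mul, Fin.sign_cycleRange, Equiv.Perm.decomposeFin.symm_sign]
  simp [mul_comm]

lemma insertPerm_bijective (n : ℕ) :
    Function.Bijective fun x : Fin (n + 1) × Equiv.Perm (Fin n) => insertPerm x.1 x.2 := by
  have hinj : Function.Injective fun x : Fin (n + 1) × Equiv.Perm (Fin n) =>
      insertPerm x.1 x.2 := by
    rintro ⟨j, ρ⟩ ⟨j', ρ'⟩ h
    simp only at h
    obtain rfl : j = j' := (insertPerm j' ρ').injective (by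
      rw [insertPerm_self, ← h, insertPerm_self])
    congr 1
    ext q
    have := congrArg (fun π => π (j.succAbove q)) h
    simp only [insertPerm_succAbove] at this
    rw [Fin.succ_inj.1 this]
  refine (Fintype.bijective_iff_injective_and_card _).2 ⟨hinj, ?_⟩
  simp [Fintype.card_perm, Nat.factorial_succ]

lemma mem_shuffles {n i : ℕ} {π : Equiv.Perm (Fin n)} :
    π ∈ shuffles n i ↔ ∀ a b : Fin n, a < b → ((b : ℕ) < i ∨ i ≤ (a : ℕ)) → π a < π b := by
  simp [shuffles]

/-- In a shuffle of two words, the letter that comes first in the result is the first letter of one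
of the words. -/
lemma insertPerm_mem_shuffles {n i : ℕ} (j : Fin (n + 1)) (ρ : Equiv.Perm (Fin n)) :
    insertPerm j ρ ∈ shuffles (n + 1) i ↔
      ((j : ℕ) = 0 ∧ 1 ≤ i ∧ ρ ∈ shuffles n (i - 1)) ∨ ((j : ℕ) = i ∧ ρ ∈ shuffles n i) := by
  have hval (q : Fin n) : ((j.succAbove q : Fin (n + 1)) : ℕ) =
      if (q : ℕ) < j then (q : ℕ) else (q : ℕ) + 1 := by
    simp only [Fin.succAbove, Fin.lt_def]
    split_ifs <;> simp_all
  simp only [mem_shuffles]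
  constructor
  · intro h
    have hj : (j : ℕ) = 0 ∨ (j : ℕ) = i := by
      by_contra hcon
      push Not at hcon
      have hj0 : (0 : ℕ) < j := Nat.pos_of_ne_zero hcon.1
      rcases lt_or_gt_of_ne hcon.2 with hlt | hgt
      · have := h 0 j (Fin.lt_def.2 hj0) (Or.inl hlt)
        rw [insertPerm_self] at this
        exact absurd this (Fin.not_lt_zero _)
      · have := h ⟨i, by omega⟩ j (Fin.lt_def.2 hgt) (Or.inr le_rfl)
        rw [insertPerm_self] at this
        exact absurd this (Fin.not_lt_zero _)
    have key : ∀ a b : Fin n, a < b →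
        ((j.succAbove b : ℕ) < i ∨ i ≤ (j.succAbove a : ℕ)) → ρ a < ρ b := by
      intro a b hab hh
      have := h (j.succAbove a) (j.succAbove b) (Fin.strictMono_succAbove j hab) hh
      rwa [insertPerm_succAbove, insertPerm_succAbove, Fin.succ_lt_succ_iff] at this
    rcases Nat.eq_zero_or_pos i with rfl | hi
    · refine Or.inr ⟨by omega, fun a b hab hh => key a b hab (Or.inr (Nat.zero_le _))⟩
    · rcases hj with hj | hj
      · refine Or.inl ⟨hj, hi, fun a b hab hh => key a b hab ?_⟩
        rw [hval, hval, hj]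
        simp only [Nat.not_lt_zero, if_false]
        omega
      · refine Or.inr ⟨hj, fun a b hab hh => key a b hab ?_⟩
        rw [hval, hval, hj]
        rw [Fin.lt_def] at hab
        split_ifs <;> omega
  · intro h a b hab hh
    rcases Fin.eq_self_or_eq_succAbove j a with rfl | ⟨a, rfl⟩
    · rcases Fin.eq_self_or_eq_succAbove a b with rfl | ⟨b, rfl⟩
      · exact absurd hab (lt_irrefl _)
      · rw [insertPerm_self, insertPerm_succAbove]
        exact Fin.succ_pos _
    · rcases Fin.eq_self_or_eq_succAbove j b with rfl | ⟨b, rfl⟩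
      · exfalso
        rw [Fin.lt_def] at hab
        rcases h with ⟨h, _⟩ | ⟨h, _⟩ <;> omega
      · rw [insertPerm_succAbove, insertPerm_succAbove, Fin.succ_lt_succ_iff]
        have hab' : a < b := (Fin.strictMono_succAbove j).lt_iff_lt.1 hab
        rw [hval, hval] at hh
        rcases h with ⟨h0, hi, h⟩ | ⟨h0, h⟩
        · refine h a b hab' ?_
          rw [h0] at hh
          simp only [Nat.not_lt_zero, if_false] at hh
          omega
        · refine h a b hab' ?_
          rw [Fin.lt_def] at hab'
          split_ifs at hh <;> omega

/-- A sum over the shuffles of `n + 1` letters, split according to the word that contains the letter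
that comes first in the result. -/
lemma sum_shuffles_succ {M : Type*} [AddCommMonoid M] (n i : ℕ)
    (F : Equiv.Perm (Fin (n + 1)) → M) :
    ∑ π ∈ shuffles (n + 1) i, F π =
      (if 1 ≤ i then ∑ ρ ∈ shuffles n (i - 1), F (insertPerm 0 ρ) else 0) +
      (if h : i < n + 1 then ∑ ρ ∈ shuffles n i, F (insertPerm ⟨i, h⟩ ρ) else 0) := by
  classical
  have e1 : ∑ π ∈ shuffles (n + 1) i, F π =
      ∑ π, if π ∈ shuffles (n + 1) i then F π else 0 := by
    rw [← Finset.sum_filter, Finset.filter_mem_eq_inter, Finset.univ_inter]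
  rw [e1, ← (insertPerm_bijective n).sum_comp fun π => if π ∈ shuffles (n + 1) i then F π else 0,
    Fintype.sum_prod_type]
  have e2 (j : Fin (n + 1)) : (∑ ρ, if insertPerm j ρ ∈ shuffles (n + 1) i then
      F (insertPerm j ρ) else 0) =
      (if (j : ℕ) = 0 then (if 1 ≤ i then ∑ ρ ∈ shuffles n (i - 1), F (insertPerm j ρ) else 0)
        else 0) +
      (if (j : ℕ) = i then ∑ ρ ∈ shuffles n i, F (insertPerm j ρ) else 0) := by
    have e3 (t : ℕ) : ∑ ρ ∈ shuffles n t, F (insertPerm j ρ) =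
      ∑ ρ, if ρ ∈ shuffles n t then F (insertPerm j ρ) else 0 := by
      rw [← Finset.sum_filter, Finset.filter_mem_eq_inter, Finset.univ_inter]
    rw [e3, e3]
    simp only [insertPerm_mem_shuffles]
    by_cases h0 : (j : ℕ) = 0 <;> by_cases h1 : 1 ≤ i <;> by_cases h2 : (j : ℕ) = i <;>
      first
        | (exfalso; omega)
        | (have h3 : ¬ i = 0 := by omega
           have h4 : ¬ 0 = i := by omega
           simp [h0, h1, h2, h3, h4])
        | (have h3 : i = 0 := by omega
           simp [h0, h1, h2, h3])
  rw [Finset.sum_congr rfl fun j _ => e2 j, Finset.sum_add_distrib]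
  congr 1
  · rw [Finset.sum_eq_single 0]
    · simp
    · intro b _ hb
      rw [if_neg]
      exact fun h => hb (Fin.ext h)
    · simp
  · split_ifs with h
    · rw [Finset.sum_eq_single ⟨i, h⟩]
      · simp
      · intro b _ hb
        rw [if_neg]
        exact fun h => hb (Fin.ext h)
      · simp
    · refine Finset.sum_eq_zero fun j _ => if_neg ?_
      omega

lemma ofFn_insertNth {n : ℕ} (x : κ) (w : Fin n → κ) (j : Fin (n + 1)) :
    List.ofFn (j.insertNth x w : Fin (n + 1) → κ) =
      (List.ofFn w).take j ++ x :: (List.ofFn w).drop j := by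
  refine List.ext_getElem (by simp; omega) fun q h1 h2 => ?_
  have hq : q < n + 1 := by simpa using h1
  rw [List.getElem_ofFn]
  rcases Fin.eq_self_or_eq_succAbove j ⟨q, hq⟩ with h | ⟨r, h⟩
  · have hj : q = j := congrArg Fin.val h
    rw [show (⟨q, _⟩ : Fin (n + 1)) = j from h, Fin.insertNth_apply_same]
    rw [List.getElem_append_right (by simp; omega)]
    rw [List.getElem_cons, dif_pos (by simp; omega)]
  · rw [show (⟨q, _⟩ : Fin (n + 1)) = j.succAbove r from h, Fin.insertNth_apply_succAbove]
    have hr := congrArg Fin.val h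
    simp only [Fin.succAbove, Fin.lt_def, Fin.val_castSucc] at hr
    split_ifs at hr with hlt
    · have hr' : q = r := hr
      rw [List.getElem_append_left (by simp; omega)]
      simp [hr']
    · have hr' : q = r + 1 := hr
      rw [List.getElem_append_right (by simp; omega)]
      rw [List.getElem_cons, dif_neg (by simp; omega)]
      rw [List.getElem_drop, List.getElem_ofFn]
      congr 1
      ext
      simp
      omega

lemma ofFn_insertPerm {n : ℕ} (x : κ) (w : Fin n → κ) (j : Fin (n + 1))
    (ρ : Equiv.Perm (Fin n)) :
    List.ofFn ((Fin.cons x w : Fin (n + 1) → κ) ∘ insertPerm j ρ) =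
      (List.ofFn (w ∘ ρ)).take j ++ x :: (List.ofFn (w ∘ ρ)).drop j := by
  have : (Fin.cons x w : Fin (n + 1) → κ) ∘ insertPerm j ρ = j.insertNth x (w ∘ ρ) := by
    rw [Fin.eq_insertNth_iff]
    constructor
    · simp [insertPerm_self]
    · funext q
      simp [Fin.removeNth, insertPerm_succAbove]
  rw [this, ofFn_insertNth]

/-- The coproduct of a monomial is the signed sum of its unshuffles. -/
lemma coprodOp_monomial {n : ℕ} (w : Fin n → κ) :
    coprodOp k κ (monomial k (List.ofFn w)) (1 ⊗ₜ 1) =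
      ∑ i ∈ Finset.range (n + 1), ∑ π ∈ shuffles n i, ((Equiv.Perm.sign π : ℤ) : k) •
        (monomial k ((List.ofFn (w ∘ π)).take i) ⊗ₜ[k] monomial k ((List.ofFn (w ∘ π)).drop i)) := by
  induction n with
  | zero =>
    have h : shuffles 0 0 = {1} := by
      ext π
      simp [mem_shuffles, Subsingleton.elim π 1]
    simp [h]
  | succ n ih =>
    obtain ⟨x, w, rfl⟩ : ∃ x w', w = Fin.cons x w' := ⟨w 0, Fin.tail w, (Fin.cons_self_tail w).symm⟩
    rw [List.ofFn_cons, monomial_cons, map_mul, Module.End.mul_apply, ih, coprodOp_superLie (.gen x),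
      LinearMap.add_apply]
    -- the two summands of the coproduct of `x` put `x` in front of the first and the second word
    simp only [sum_shuffles_succ, Finset.sum_add_distrib]
    congr 1
    · rw [Finset.sum_range_succ' _ (n + 1), if_neg (show ¬ 1 ≤ 0 by omega), add_zero, map_sum]
      refine Finset.sum_congr rfl fun i hi => ?_
      rw [if_pos (show 1 ≤ i + 1 by omega), map_sum, Nat.add_sub_cancel]
      refine Finset.sum_congr rfl fun ρ _ => ?_
      rw [map_smul, sign_insertPerm, ofFn_insertPerm]
      simp
    · rw [Finset.sum_range_succ _ (n + 1), dif_neg (by omega), add_zero, map_sum]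
      refine Finset.sum_congr rfl fun i hi => ?_
      have hi' : i < n + 1 := by simpa using hi
      rw [dif_pos hi', map_sum]
      refine Finset.sum_congr rfl fun ρ _ => ?_
      have hlen : ((List.ofFn (w ∘ ρ)).take i).length = i := by simp; omega
      rw [map_smul, sign_insertPerm, ofFn_insertPerm]
      simp only
      rw [List.take_left' hlen, List.drop_left' hlen, TensorProduct.map_tmul, monomial_cons, pow_one]
      have := parity_pow_monomial (k := k) 1 ((List.ofFn (w ∘ ρ)).take i)
      rw [pow_one, one_mul, hlen] at this
      rw [AlgHom.toLinearMap_apply, this]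
      simp [← TensorProduct.smul_tmul', smul_smul, mul_comm]

end Shuffles

/-! ### The Hodge filtration of cochains -/

section HodgeFiltration

variable {k : Type u} [Field k] {A : Type u} [CommRing A] [Algebra k A]

lemma adams_monomial {κ : Type*} {n : ℕ} (w : Fin n → κ) :
    adams k κ (monomial k (List.ofFn w)) =
      ∑ i ∈ Finset.range (n + 1), ∑ π ∈ shuffles n i, ((Equiv.Perm.sign π : ℤ) : k) •
        monomial k (List.ofFn (w ∘ π)) := by
  simp only [adams_apply, coprodOp_monomial, map_sum, map_smul, LinearMap.mul'_apply,
    ← monomial_append, List.take_append_drop]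

lemma perm_eq_one_of_strictMono {n : ℕ} (π : Equiv.Perm (Fin n)) (h : StrictMono π) : π = 1 := by
  have : h.orderIsoOfSurjective π π.surjective = OrderIso.refl _ := Subsingleton.elim _ _
  ext i
  exact congrArg Fin.val (DFunLike.congr_fun this i)

lemma shuffles_zero (n : ℕ) : shuffles n 0 = {1} := by
  ext π
  rw [mem_shuffles, Finset.mem_singleton]
  constructor
  · exact fun h => perm_eq_one_of_strictMono π fun a b hab => h a b hab (Or.inr (Nat.zero_le _))
  · rintro rfl a b hab _
    exact hab

lemma shuffles_self (n : ℕ) : shuffles n n = {1} := by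
  ext π
  rw [mem_shuffles, Finset.mem_singleton]
  constructor
  · exact fun h => perm_eq_one_of_strictMono π fun a b hab => h a b hab (Or.inl b.2)
  · rintro rfl a b hab _
    exact hab

/-- Adding the two trivial shuffles turns the shuffle operator into the Adams operation. -/
lemma shuffleOp_add_two {n : ℕ} (hn : 1 ≤ n) (f : Cochain k A n) :
    shuffleOp k A n f + (2 : k) • f =
      ∑ i ∈ Finset.range (n + 1), ∑ π ∈ shuffles n i, ((Equiv.Perm.sign π : ℤ) : k) •
        f.domDomCongr π⁻¹ := by
  have h1 : (1 : Equiv.Perm (Fin n))⁻¹ = Equiv.refl _ := rfl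
  rw [Finset.sum_range_succ, Finset.range_eq_Ico, Finset.sum_eq_sum_Ico_succ_bot hn, shuffles_zero,
    shuffles_self, Finset.sum_singleton]
  simp only [shuffleOp, LinearMap.sum_apply, LinearMap.smul_apply, two_smul]
  have h2 : f.domDomCongr (1 : Equiv.Perm (Fin n))⁻¹ = f := by ext; rfl
  rw [h2, map_one, Units.val_one, Int.cast_one, one_smul]
  simp only [zero_add]
  have h3 : ∀ a c : Cochain k A n, a + (c + c) = c + a + c := fun a c => by abel
  exact h3 _ f

variable {κ : Type*} [Fintype κ]

/-- The generic value `∑ f(a_{w₁}, …, a_{wₙ}) ⊗ x_{w₁} ⋯ x_{wₙ}` of a cochain, i.e. the value of `f`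
at `n` copies of the generic element `∑ₛ aₛ ⊗ xₛ`. -/
def generic {n : ℕ} (a : κ → A) : Cochain k A n →ₗ[k] A ⊗[k] FreeAlgebra k κ where
  toFun f := ∑ w : Fin n → κ, f (a ∘ w) ⊗ₜ monomial k (List.ofFn w)
  map_add' f g := by
    simp only [add_apply, TensorProduct.add_tmul, Finset.sum_add_distrib]
  map_smul' c f := by
    simp only [smul_apply, ← TensorProduct.smul_tmul', Finset.smul_sum,
      RingHom.id_apply]

lemma generic_apply {n : ℕ} (a : κ → A) (f : Cochain k A n) :
    generic a f = ∑ w : Fin n → κ, f (a ∘ w) ⊗ₜ monomial k (List.ofFn w) := rfl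

lemma generic_domDomCongr {n : ℕ} (a : κ → A) (f : Cochain k A n) (π : Equiv.Perm (Fin n)) :
    generic a (f.domDomCongr π⁻¹) =
      ∑ w : Fin n → κ, f (a ∘ w) ⊗ₜ monomial k (List.ofFn (w ∘ π)) := by
  rw [generic_apply]
  refine Fintype.sum_equiv (Equiv.arrowCongr π (Equiv.refl κ)) _ _ fun w => ?_
  have : (Equiv.arrowCongr π (Equiv.refl κ)) w = w ∘ ⇑π⁻¹ := rfl
  rw [this]
  have h2 : (w ∘ ⇑π⁻¹) ∘ ⇑π = w := by funext i; simp
  rw [h2]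
  rfl

/-- The shuffle operator is dual to the Adams operator: precomposition of a cochain with all the
shuffles is the Adams operator on its generic values. -/
lemma generic_shuffleOp {n : ℕ} (hn : 1 ≤ n) (a : κ → A) (f : Cochain k A n) :
    generic a (shuffleOp k A n f + (2 : k) • f) = (adams k κ).lTensor A (generic a f) := by
  rw [shuffleOp_add_two hn, generic_apply a f]
  simp only [map_sum, map_smul, generic_domDomCongr, LinearMap.lTensor_tmul, adams_monomial,
    TensorProduct.tmul_sum, TensorProduct.tmul_smul, Finset.smul_sum]
  rw [Finset.sum_comm (s := Finset.univ)]
  exact Finset.sum_congr rfl fun i _ => Finset.sum_comm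

variable (k A κ) in
/-- The filtration of `A ⊗ U` induced by the filtration of the free superalgebra `U`. -/
def pbwCoeff (q : ℕ) : Submodule k (A ⊗[k] FreeAlgebra k κ) :=
  LinearMap.range ((pbw k κ q).subtype.lTensor A)

omit [Fintype κ] in
lemma tmul_mem_pbwCoeff {q : ℕ} (a : A) {u : FreeAlgebra k κ} (hu : u ∈ pbw k κ q) :
    a ⊗ₜ u ∈ pbwCoeff k A κ q := ⟨a ⊗ₜ ⟨u, hu⟩, rfl⟩

omit [Fintype κ] in
lemma lTensor_mem_pbwCoeff {κ' : Type*} {q r : ℕ} (T : FreeAlgebra k κ →ₗ[k] FreeAlgebra k κ')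
    (hT : ∀ u ∈ pbw k κ q, T u ∈ pbw k κ' r) {t : A ⊗[k] FreeAlgebra k κ}
    (ht : t ∈ pbwCoeff k A κ q) : T.lTensor A t ∈ pbwCoeff k A κ' r := by
  obtain ⟨t, rfl⟩ := ht
  induction t with
  | zero => simp
  | tmul a u => exact tmul_mem_pbwCoeff a (hT u u.2)
  | add s t hs ht => rw [map_add, map_add]; exact add_mem hs ht

variable (k A) in
/-- The Hodge filtration of `Cⁿ(A)`: the cochains all of whose generic values are in filtration `q`.
It turns out to be the sum of the Hodge pieces of weight at most `q`. -/
def hodgeFil (n q : ℕ) : Submodule k (Cochain k A n) where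
  carrier := {f | ∀ (κ : Type) [Fintype κ] (a : κ → A), generic a f ∈ pbwCoeff k A κ q}
  add_mem' hf hg κ _ a := by rw [map_add]; exact add_mem (hf κ a) (hg κ a)
  zero_mem' κ _ a := by rw [map_zero]; exact zero_mem _
  smul_mem' c f hf κ _ a := by rw [map_smul]; exact Submodule.smul_mem _ _ (hf κ a)

lemma mem_hodgeFil_of_le {n q : ℕ} (h : n ≤ q) (f : Cochain k A n) : f ∈ hodgeFil k A n q := by
  intro κ _ a
  refine sum_mem fun w _ => tmul_mem_pbwCoeff _ (pbw_mono h ?_)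
  simpa using monomial_mem_pbw (k := k) (List.ofFn w)

lemma hodgeFil_mono {n q r : ℕ} (h : q ≤ r) : hodgeFil k A n q ≤ hodgeFil k A n r := by
  intro f hf κ _ a
  simpa using lTensor_mem_pbwCoeff LinearMap.id (fun u hu => pbw_mono h hu) (hf κ a)

variable (k) in
/-- The coefficient of a monomial in an element of the free algebra. -/
def monomialCoeff {κ : Type*} (l : List κ) : FreeAlgebra k κ →ₗ[k] k where
  toFun u := (FreeAlgebra.equivMonoidAlgebraFreeMonoid u).coeff (FreeMonoid.ofList l)
  map_add' u v := by simp
  map_smul' c u := by simp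

lemma monomialCoeff_monomial {κ : Type*} [DecidableEq κ] (l l' : List κ) :
    monomialCoeff k l (monomial k l') = if l' = l then 1 else 0 := by
  have h : FreeAlgebra.equivMonoidAlgebraFreeMonoid (monomial k l') =
      MonoidAlgebra.of k (FreeMonoid κ) (FreeMonoid.ofList l') := by
    induction l' with
    | nil => simp; rfl
    | cons s l' ih =>
      rw [monomial_cons, map_mul, ih, FreeMonoid.ofList_cons, map_mul]
      congr 1
      simp [FreeAlgebra.equivMonoidAlgebraFreeMonoid]
  simp only [monomialCoeff, LinearMap.coe_mk, AddHom.coe_mk, h]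
  classical
  rw [MonoidAlgebra.of_apply, MonoidAlgebra.coeff_single, Finsupp.single_apply]
  simp only [EmbeddingLike.apply_eq_iff_eq]

/-- A cochain is determined by its generic values, for example by the coefficient of `x₁ ⋯ xₙ`. -/
lemma hodgeFil_zero {n : ℕ} (hn : 1 ≤ n) : hodgeFil k A n 0 = ⊥ := by
  rw [eq_bot_iff]
  intro f hf
  rw [Submodule.mem_bot]
  ext a
  have h := hf (Fin n) a
  -- constants do not contain the monomial `x₁ ⋯ xₙ`
  have h1 : ∀ t ∈ pbwCoeff k A (Fin n) 0,
      (monomialCoeff k (List.ofFn (id : Fin n → Fin n))).lTensor A t = 0 := by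
    rintro _ ⟨t, rfl⟩
    induction t with
    | zero => simp
    | tmul a u =>
      obtain ⟨u, hu⟩ := u
      rw [pbw, pow_zero] at hu
      obtain ⟨c, rfl⟩ := Submodule.mem_one.1 hu
      have h0 := monomialCoeff_monomial (k := k) (List.ofFn (id : Fin n → Fin n)) []
      rw [if_neg (by intro h; have := congrArg List.length h; simp at this; omega)] at h0
      simp only [LinearMap.lTensor_tmul, Submodule.coe_subtype, Algebra.algebraMap_eq_smul_one,
        map_smul]
      rw [← monomial_nil, h0]
      simp
    | add s t hs ht => rw [map_add, map_add, hs, ht, add_zero]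
  have h2 := h1 _ h
  rw [generic_apply, map_sum, Finset.sum_eq_single id] at h2
  · rw [LinearMap.lTensor_tmul, monomialCoeff_monomial, if_pos rfl] at h2
    have := congrArg (TensorProduct.rid k A) h2
    simpa using this
  · intro w _ hw
    rw [LinearMap.lTensor_tmul, monomialCoeff_monomial, if_neg, TensorProduct.tmul_zero]
    exact fun h => hw (List.ofFn_injective h)
  · simp

lemma cochain_sub_smul {n : ℕ} (a b : k) (f : Cochain k A n) : (a - b) • f = a • f - b • f := by
  ext x
  exact sub_smul a b (f x)

/-- The shuffle operator acts on the associated graded of the Hodge filtration in degree `q + 1` by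
the eigenvalue `2^(q+1) - 2`. -/
lemma shuffleOp_sub_mem_hodgeFil {n : ℕ} (hn : 1 ≤ n) (q : ℕ) {f : Cochain k A n}
    (hf : f ∈ hodgeFil k A n (q + 1)) :
    shuffleOp k A n f - ((2 : k) ^ (q + 1) - 2) • f ∈ hodgeFil k A n q := by
  intro κ _ a
  have e : shuffleOp k A n f - ((2 : k) ^ (q + 1) - 2) • f =
      (shuffleOp k A n f + (2 : k) • f) - (2 : k) ^ (q + 1) • f := by
    rw [cochain_sub_smul]; abel
  have e2 : generic a (shuffleOp k A n f - ((2 : k) ^ (q + 1) - 2) • f) =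
      (adams k κ - (2 : k) ^ (q + 1) • LinearMap.id).lTensor A (generic a f) := by
    rw [e, map_sub, generic_shuffleOp hn, map_smul, LinearMap.lTensor_sub, LinearMap.lTensor_smul,
      LinearMap.lTensor_id]
    rfl
  rw [e2]
  exact lTensor_mem_pbwCoeff _ (fun u hu => adams_sub_mem hu) (hf κ a)

/-! ### Hodge projectors -/

open Polynomial in
lemma aeval_X_sub_C_apply {V : Type*} [AddCommGroup V] [Module k V] (S : Module.End k V) (c : k)
    (v : V) : aeval S (X - C c) v = S v - c • v := by
  simp [Module.algebraMap_end_apply]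

open Polynomial in
lemma aeval_prod_hodgeFil {n : ℕ} (hn : 1 ≤ n) (q : ℕ) {f : Cochain k A n}
    (hf : f ∈ hodgeFil k A n q) :
    aeval (shuffleOp k A n) (∏ j ∈ Finset.Icc 1 q, (X - C ((2 : k) ^ j - 2))) f = 0 := by
  induction q generalizing f with
  | zero => rw [hodgeFil_zero hn] at hf; rw [show f = 0 from hf, map_zero]
  | succ q ih =>
    rw [← Finset.insert_Icc_right_eq_Icc_add_one (by omega), Finset.prod_insert (by simp), mul_comm,
      map_mul, Module.End.mul_apply]
    refine ih ?_
    rw [aeval_X_sub_C_apply]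
    exact shuffleOp_sub_mem_hodgeFil hn q hf

open Polynomial in
lemma prod_dvd_prod_basisDivisor (s t : Finset ℕ) (i : ℕ) (h : t ⊆ s) :
    (∏ j ∈ t, (X - C ((2 : k) ^ j - 2))) ∣
      ∏ j ∈ s, Lagrange.basisDivisor ((2 : k) ^ i - 2) ((2 : k) ^ j - 2) := by
  refine (Finset.prod_dvd_prod_of_dvd _ _ fun j _ => ?_).trans (Finset.prod_dvd_prod_of_subset t s _ h)
  exact Dvd.intro_left _ rfl

open Polynomial in
lemma aeval_eq_zero_of_dvd {V : Type*} [AddCommGroup V] [Module k V] (S : Module.End k V)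
    {P Q : k[X]} (h : P ∣ Q) {v : V} (hv : aeval S P v = 0) : aeval S Q v = 0 := by
  obtain ⟨R, rfl⟩ := h
  rw [mul_comm, map_mul, Module.End.mul_apply, hv, map_zero]

/-- The projectors of weight bigger than `q` vanish on the `q`-th step of the filtration. -/
lemma hodgeProj_eq_zero {n q i : ℕ} (hq : q < i) (hi : i ≤ n) {f : Cochain k A n}
    (hf : f ∈ hodgeFil k A n q) : hodgeProj k A n i f = 0 := by
  refine aeval_eq_zero_of_dvd _ (prod_dvd_prod_basisDivisor _ _ i ?_)
    (aeval_prod_hodgeFil (by omega) q hf)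
  intro j hj
  simp only [Finset.mem_Icc, Finset.mem_erase] at hj ⊢
  omega

/-- The image of the projector consists of eigenvectors, since the product of all `sₙ - (2ʲ - 2)`
vanishes on `Cⁿ(A)`. -/
lemma shuffleOp_hodgeProj {n i : ℕ} (h1 : 1 ≤ i) (hi : i ≤ n) (f : Cochain k A n) :
    shuffleOp k A n (hodgeProj k A n i f) = ((2 : k) ^ i - 2) • hodgeProj k A n i f := by
  have h := aeval_eq_zero_of_dvd (shuffleOp k A n) (v := f)
    (Q := (Polynomial.X - Polynomial.C ((2 : k) ^ i - 2)) *
      Lagrange.basis (Finset.Icc 1 n) (fun j : ℕ => (2 : k) ^ j - 2) i) ?_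
    (aeval_prod_hodgeFil (by omega) n (mem_hodgeFil_of_le le_rfl f))
  · rw [map_mul, Module.End.mul_apply] at h
    rw [aeval_X_sub_C_apply] at h
    exact sub_eq_zero.1 h
  · rw [← Finset.mul_prod_erase _ _ (Finset.mem_Icc.2 ⟨h1, hi⟩)]
    exact mul_dvd_mul_left _ (prod_dvd_prod_basisDivisor _ _ i subset_rfl)

variable [CharZero k]

lemma hodgeNode_injective : Function.Injective fun j : ℕ => (2 : k) ^ j - 2 := by
  intro i j h
  have h1 : (2 : k) ^ i = 2 ^ j := by simpa using h
  have h2 : (2 : ℕ) ^ i = 2 ^ j := by exact_mod_cast h1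
  exact Nat.pow_right_injective le_rfl h2

/-- An eigenvector of the shuffle operator of weight `i` is in the `i`-th step of the filtration:
while its filtration degree is bigger than `i`, the eigenvalues differ and the degree can be
lowered. -/
lemma mem_hodgeFil_of_eigen {n i : ℕ} (h1 : 1 ≤ i) (hi : i ≤ n) {f : Cochain k A n}
    (hf : shuffleOp k A n f = ((2 : k) ^ i - 2) • f) : f ∈ hodgeFil k A n i := by
  suffices ∀ d, i + d ≤ n → f ∈ hodgeFil k A n (i + d) → f ∈ hodgeFil k A n i from
    this (n - i) (by omega) (mem_hodgeFil_of_le (by omega) f)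
  intro d
  induction d with
  | zero => exact fun _ h => h
  | succ d ih =>
    intro hd h
    refine ih (by omega) ?_
    have h2 := shuffleOp_sub_mem_hodgeFil (by omega) (i + d) h
    rw [hf, ← cochain_sub_smul] at h2
    refine ((hodgeFil k A n (i + d)).smul_mem_iff (sub_ne_zero.2 fun h3 => ?_)).1 h2
    have := hodgeNode_injective (k := k) h3
    omega

lemma hodgeProj_mem_hodgeFil {n i : ℕ} (h1 : 1 ≤ i) (hi : i ≤ n) (f : Cochain k A n) :
    hodgeProj k A n i f ∈ hodgeFil k A n i :=
  mem_hodgeFil_of_eigen h1 hi (shuffleOp_hodgeProj h1 hi f)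

lemma sum_hodgeProj {n : ℕ} (hn : 1 ≤ n) (f : Cochain k A n) :
    ∑ i ∈ Finset.Icc 1 n, hodgeProj k A n i f = f := by
  have h := congrArg (fun P => Polynomial.aeval (shuffleOp k A n) P f)
    (Lagrange.sum_basis (s := Finset.Icc 1 n) (v := fun j : ℕ => (2 : k) ^ j - 2)
      (hodgeNode_injective.injOn) ⟨1, by simpa using hn⟩)
  simpa [hodgeProj, map_sum] using h

/-- The projectors act on eigenvectors by the values of the Lagrange basis polynomials. -/
lemma hodgeProj_of_eigen {n i j : ℕ} (hi : i ∈ Finset.Icc 1 n)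
    {f : Cochain k A n} (hf : shuffleOp k A n f = ((2 : k) ^ i - 2) • f) :
    hodgeProj k A n j f = if j = i then f else 0 := by
  rw [hodgeProj, Module.End.aeval_apply_of_mem_apply_eq_smul hf]
  split_ifs with h
  · subst h
    have := Lagrange.eval_basis_self (v := fun j : ℕ => (2 : k) ^ j - 2)
      (hodgeNode_injective.injOn) hi
    rw [this, one_smul]
  · have := Lagrange.eval_basis_of_ne (v := fun j : ℕ => (2 : k) ^ j - 2) h hi
    rw [this, zero_smul]

/-- Up to lower order, an element of the filtration is its component of top weight. -/
lemma sub_hodgeProj_mem {n q : ℕ} (hq : q + 1 ≤ n) {f : Cochain k A n}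
    (hf : f ∈ hodgeFil k A n (q + 1)) : f - hodgeProj k A n (q + 1) f ∈ hodgeFil k A n q := by
  have h := sum_hodgeProj (show 1 ≤ n by omega) f
  have e : f - hodgeProj k A n (q + 1) f =
      ∑ i ∈ (Finset.Icc 1 n).erase (q + 1), hodgeProj k A n i f := by
    rw [sub_eq_iff_eq_add', Finset.add_sum_erase (Finset.Icc 1 n)
      (fun i => hodgeProj k A n i f) (by simpa using hq), h]
  rw [e]
  refine sum_mem fun i hi => ?_
  simp only [Finset.mem_erase, Finset.mem_Icc] at hi
  rcases Nat.lt_or_ge (q + 1) i with h1 | h1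
  · rw [hodgeProj_eq_zero h1 hi.2.2 hf]; exact zero_mem _
  · exact hodgeFil_mono (by omega) (hodgeProj_mem_hodgeFil hi.2.1 hi.2.2 f)

end HodgeFiltration

/-! ### The composition product and the Hodge filtration -/

section Composition

variable {k : Type u} [Field k] {A : Type u} [CommRing A] [Algebra k A]

/-- The sequences in `m + n + 1` positions, as pairs of the sequence outside of and the sequence
inside of the `n + 1` positions that start at `i`. -/
def splitWord {κ : Type*} (m n : ℕ) (i : Fin (m + 1)) :
    (Fin m → κ) × (Fin (n + 1) → κ) ≃ (Fin (m + n + 1) → κ) where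
  toFun x q :=
    if h : (q : ℕ) < i then x.1 ⟨q, by omega⟩
    else if h' : (q : ℕ) ≤ i + n then x.2 ⟨q - i, by omega⟩ else x.1 ⟨q - n - 1, by omega⟩
  invFun w := (fun j => if (j : ℕ) < i then w ⟨j, by omega⟩ else w ⟨j + n + 1, by omega⟩,
    fun l => w ⟨i + l, by omega⟩)
  left_inv x := by
    refine Prod.ext (funext fun j => ?_) (funext fun l => ?_)
    · simp only
      split_ifs <;> first | omega | rfl | exact congrArg x.1 (Fin.ext (by change _ + n + 1 - n - 1 = _; omega))
    · simp only
      split_ifs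
      · omega
      · exact congrArg x.2 (Fin.ext (by simp))
      · omega
  right_inv w := by
    funext q
    simp only
    split_ifs <;> first | omega | rfl | (congr 1; ext; simp; omega)

lemma ofFn_splitWord {κ : Type*} (m n : ℕ) (i : Fin (m + 1)) (w : Fin m → κ)
    (v : Fin (n + 1) → κ) :
    List.ofFn (splitWord m n i (w, v)) =
      (List.ofFn w).take i ++ (List.ofFn v ++ (List.ofFn w).drop i) := by
  refine List.ext_getElem (by simp; omega) fun q h1 h2 => ?_
  have hq : q < m + n + 1 := by simpa using h1
  rw [List.getElem_ofFn]
  simp only [splitWord, Equiv.coe_fn_mk]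
  split_ifs with h h'
  · rw [List.getElem_append_left (by simp; omega)]
    simp
  · rw [List.getElem_append_right (by simp; omega), List.getElem_append_left (by simp; omega),
      List.getElem_ofFn]
    congr 1
    ext
    simp
    omega
  · rw [List.getElem_append_right (by simp; omega), List.getElem_append_right (by simp; omega),
      List.getElem_drop, List.getElem_ofFn]
    congr 1
    ext
    simp
    omega

lemma insertArg_splitWord {κ : Type*} {m n : ℕ} (g : Cochain k A (n + 1)) (i : Fin (m + 1))
    (a : κ → A) (w : Fin m → κ) (v : Fin (n + 1) → κ) :
    insertArg g i (a ∘ splitWord m n i (w, v)) = i.insertNth (g (a ∘ v)) (a ∘ w) := by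
  rw [Fin.eq_insertNth_iff]
  constructor
  · simp only [insertArg, lt_irrefl, if_false, if_true]
    congr 1
    funext l
    simp only [Function.comp, splitWord, Equiv.coe_fn_mk]
    rw [dif_neg (by omega), dif_pos (by omega)]
    simp
  · funext j
    have hv : ((i.succAbove j : Fin (m + 1)) : ℕ) =
        if (j : ℕ) < i then (j : ℕ) else (j : ℕ) + 1 := by
      simp only [Fin.succAbove, Fin.lt_def]
      split_ifs <;> simp_all
    simp only [Fin.removeNth, insertArg, Fin.lt_def, Fin.ext_iff]
    simp only [Function.comp, splitWord, Equiv.coe_fn_mk, hv]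
    split_ifs <;> first | omega | rfl | (congr 2; ext; simp)

variable {κ : Type*}

/-- The homomorphism that sends the extra generator to zero. -/
def forgetNone : FreeAlgebra k (Option κ) →ₐ[k] FreeAlgebra k κ :=
  FreeAlgebra.lift k fun s => s.elim 0 (FreeAlgebra.ι k)

lemma superLie_forgetNone (s : Option κ) :
    SuperLie 1 (forgetNone (k := k) (FreeAlgebra.ι k s)) := by
  rw [forgetNone, FreeAlgebra.lift_ι_apply]
  cases s with
  | none => exact .zero 1
  | some s => exact .gen s

lemma forgetNone_monomial_some (l : List κ) :
    forgetNone (monomial k (l.map some)) = monomial k l := by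
  induction l with
  | nil => simp
  | cons s l ih =>
    rw [List.map_cons, monomial_cons, map_mul, ih, monomial_cons]
    simp [forgetNone]

lemma forgetNone_monomial_of_mem (l : List (Option κ)) (h : none ∈ l) :
    forgetNone (monomial k l) = 0 := by
  induction l with
  | nil => simp at h
  | cons s l ih =>
    rw [monomial_cons, map_mul]
    rcases List.mem_cons.1 h with rfl | h
    · simp [forgetNone]
    · rw [ih h, mul_zero]

/-- The superderivation of parity `r` that substitutes `Q` for one occurrence of the extra
generator. -/
def substDer (r : ℕ) (Q : FreeAlgebra k κ) : FreeAlgebra k (Option κ) →ₗ[k] FreeAlgebra k κ :=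
  superDer forgetNone r fun s => s.elim Q 0

lemma substDer_mul (r : ℕ) (Q : FreeAlgebra k κ) (u v : FreeAlgebra k (Option κ)) :
    substDer r Q (u * v) =
      substDer r Q u * forgetNone v + (parity k κ ^ r) (forgetNone u) * substDer r Q v :=
  superDer_mul _ _ _ u v

lemma substDer_ι (r : ℕ) (Q : FreeAlgebra k κ) (s : Option κ) :
    substDer r Q (FreeAlgebra.ι k s) = s.elim Q 0 :=
  superDer_ι _ _ _ s

lemma substDer_monomial (r : ℕ) (Q : FreeAlgebra k κ) (l : List (Option κ)) :
    substDer r Q (monomial k l) = ∑ i : Fin l.length,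
      (-1 : k) ^ (r * (i : ℕ)) • (forgetNone (monomial k (l.take i)) *
        ((l[i]).elim Q 0 * forgetNone (monomial k (l.drop (i + 1))))) := by
  induction l with
  | nil => simp [substDer, superDer_one]
  | cons s l ih =>
    rw [monomial_cons, substDer_mul, ih, substDer_ι]
    refine Eq.trans ?_ (Fin.sum_univ_succ (n := l.length) _).symm
    rw [Finset.mul_sum]
    congr 1
    · simp
    · refine Finset.sum_congr rfl fun i _ => ?_
      rw [(superLie_forgetNone s).parity_pow]
      simp [smul_smul, mul_assoc, ← pow_add, mul_add]

lemma substDer_monomial_ofFn {m : ℕ} (r : ℕ) (Q : FreeAlgebra k κ) (w : Fin (m + 1) → Option κ) :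
    substDer r Q (monomial k (List.ofFn w)) = ∑ i : Fin (m + 1),
      (-1 : k) ^ (r * (i : ℕ)) • (forgetNone (monomial k ((List.ofFn w).take i)) *
        ((w i).elim Q 0 * forgetNone (monomial k ((List.ofFn w).drop (i + 1))))) := by
  rw [substDer_monomial]
  refine Fintype.sum_equiv (finCongr (by simp)) _ _ fun i => ?_
  simp only [Fin.getElem_fin, List.getElem_ofFn]
  rfl

variable [Fintype κ]

/-- The generic value of `f` with `b ⊗ Q` substituted for one of the arguments. -/
lemma lTensor_substDer_generic {m : ℕ} (r : ℕ) (Q : FreeAlgebra k κ) (a : κ → A) (b : A)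
    (f : Cochain k A (m + 1)) :
    (substDer r Q).lTensor A (generic (fun s : Option κ => s.elim b a) f) =
      ∑ i : Fin (m + 1), (-1 : k) ^ (r * (i : ℕ)) • ∑ w : Fin m → κ,
        f (i.insertNth b (a ∘ w)) ⊗ₜ[k] (monomial k ((List.ofFn w).take i) *
          (Q * monomial k ((List.ofFn w).drop i))) := by
  classical
  rw [generic_apply, map_sum]
  simp only [LinearMap.lTensor_tmul, substDer_monomial_ofFn, TensorProduct.tmul_sum]
  rw [Finset.sum_comm]
  refine Finset.sum_congr rfl fun i _ => ?_
  simp only [TensorProduct.tmul_smul, ← Finset.smul_sum]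
  congr 1
  rw [← (Fin.insertNthEquiv (fun _ => Option κ) i).sum_comp, Fintype.sum_prod_type,
    Fintype.sum_option]
  have hins (x : Option κ) (w : Fin m → Option κ) :
      Fin.insertNthEquiv (fun _ => Option κ) i (x, w) = i.insertNth x w := rfl
  simp only [hins, Fin.insertNth_apply_same, Option.elim_none,
    Option.elim_some, Pi.zero_apply, zero_mul, mul_zero, TensorProduct.tmul_zero,
    Finset.sum_const_zero, add_zero]
  have htake (x : Option κ) (w : Fin m → Option κ) :
      (List.ofFn (i.insertNth x w : Fin (m + 1) → Option κ)).take i = (List.ofFn w).take i := by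
    rw [ofFn_insertNth, List.take_left' (by simp; omega)]
  have hdrop (x : Option κ) (w : Fin m → Option κ) :
      (List.ofFn (i.insertNth x w : Fin (m + 1) → Option κ)).drop (i + 1) =
        (List.ofFn w).drop i := by
    rw [ofFn_insertNth, ← List.singleton_append, ← List.append_assoc,
      List.drop_left' (by simp; omega)]
  simp only [htake, hdrop]
  -- the words that contain the extra generator a second time contribute zero
  symm
  refine Fintype.sum_of_injective (fun w : Fin m → κ => some ∘ w)
    (fun w w' h => funext fun j => Option.some_injective _ (congrFun h j)) _ _ (fun w hw => ?_)
    (fun w => ?_)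
  · have hmem : none ∈ List.ofFn w := by
      by_contra hcon
      refine hw ?_
      have : ∀ j, ∃ s, some s = w j := fun j => by
        cases h : w j with
        | none => exact absurd ((List.mem_ofFn' _ _).2 ⟨j, h⟩) hcon
        | some s => exact ⟨s, rfl⟩
      choose v hv using this
      exact ⟨v, funext hv⟩
    rw [← List.take_append_drop i (List.ofFn w), List.mem_append] at hmem
    rcases hmem with h | h
    · rw [forgetNone_monomial_of_mem _ h, zero_mul, TensorProduct.tmul_zero]
    · rw [forgetNone_monomial_of_mem _ h, mul_zero, mul_zero, TensorProduct.tmul_zero]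
  · rw [show List.ofFn (some ∘ w) = (List.ofFn w).map some from List.map_ofFn.symm,
      ← List.map_take, ← List.map_drop, forgetNone_monomial_some,
      forgetNone_monomial_some]
    congr 2
    rw [Fin.insertNth_eq_iff]
    constructor
    · simp
    · funext j
      simp [Fin.removeNth]

/-- The generic value of `f ∘ g` is obtained from the generic value of `f` by the substitution of
the generic value of `g`. -/
lemma generic_circ {m n : ℕ} (a : κ → A) (f : Cochain k A (m + 1)) (g : Cochain k A (n + 1)) :
    generic a (circ f g) = ∑ v : Fin (n + 1) → κ,
      (substDer n (monomial k (List.ofFn v))).lTensor A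
        (generic (fun s : Option κ => s.elim (g (a ∘ v)) a) f) := by
  simp only [lTensor_substDer_generic]
  rw [Finset.sum_comm, circ, LinearMap.mk₂_apply, map_sum]
  refine Finset.sum_congr rfl fun i _ => ?_
  rw [← Finset.smul_sum, map_smul, generic_apply, ← (splitWord m n i).sum_comp,
    Fintype.sum_prod_type, Finset.sum_comm, mul_comm]
  simp only [insertAt_apply, insertArg_splitWord, ofFn_splitWord, monomial_append]

/-- The substitution as a bilinear function of the substituted coefficient and element. -/
def substBilin {m : ℕ} (r : ℕ) (a : κ → A) (f : Cochain k A (m + 1)) :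
    A →ₗ[k] FreeAlgebra k κ →ₗ[k] A ⊗[k] FreeAlgebra k κ :=
  LinearMap.mk₂ k (fun b Q => ∑ i : Fin (m + 1), (-1 : k) ^ (r * (i : ℕ)) • ∑ w : Fin m → κ,
        f (i.insertNth b (a ∘ w)) ⊗ₜ[k] (monomial k ((List.ofFn w).take i) *
          (Q * monomial k ((List.ofFn w).drop i))))
    (fun b b' Q => by
      rw [← Finset.sum_add_distrib]
      refine Finset.sum_congr rfl fun i _ => ?_
      rw [← smul_add, ← Finset.sum_add_distrib]
      simp only [f.map_insertNth_add, TensorProduct.add_tmul])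
    (fun c b Q => by
      rw [Finset.smul_sum]
      refine Finset.sum_congr rfl fun i _ => ?_
      rw [smul_comm c]
      congr 1
      rw [Finset.smul_sum]
      refine Finset.sum_congr rfl fun w _ => ?_
      rw [f.map_insertNth_smul, TensorProduct.smul_tmul'])
    (fun b Q Q' => by
      rw [← Finset.sum_add_distrib]
      refine Finset.sum_congr rfl fun i _ => ?_
      rw [← smul_add, ← Finset.sum_add_distrib]
      simp only [add_mul, mul_add, TensorProduct.tmul_add])
    (fun c b Q => by
      rw [Finset.smul_sum]
      refine Finset.sum_congr rfl fun i _ => ?_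
      rw [smul_comm c]
      congr 1
      rw [Finset.smul_sum]
      refine Finset.sum_congr rfl fun w _ => ?_
      rw [smul_mul_assoc, mul_smul_comm, TensorProduct.tmul_smul])

/-- The composition product is compatible with the Hodge filtration: the generic value of `f ∘ g` is
obtained from that of `f` by superderivations that substitute the coefficients `Q` of the generic value
of `g` for an extra generator, and these map `U_i` to `U_{i+j-1}` if `Q` is in `U_j`. -/
lemma circ_mem_hodgeFil [CharZero k] {m n i j : ℕ} {f : Cochain k A (m + 1)}
    {g : Cochain k A (n + 1)} (hf : f ∈ hodgeFil k A (m + 1) i) (hg : g ∈ hodgeFil k A (n + 1) j) :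
    circ f g ∈ hodgeFil k A (m + n + 1) (i + j - 1) := by
  intro κ _ a
  -- the projection onto the elements of the parity of `g`: the superderivations have to be homogeneous
  let E : FreeAlgebra k κ →ₗ[k] FreeAlgebra k κ :=
    (2⁻¹ : k) • (LinearMap.id + (-1 : k) ^ (n + 1) • (parity k κ).toLinearMap)
  have hE1 : E.lTensor A (generic a g) = generic a g := by
    rw [generic_apply, map_sum]
    refine Finset.sum_congr rfl fun w _ => ?_
    have h := parity_pow_monomial (k := k) 1 (List.ofFn w)
    rw [pow_one, one_mul, List.length_ofFn] at h
    rw [LinearMap.lTensor_tmul]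
    simp only [E, LinearMap.smul_apply, LinearMap.add_apply, LinearMap.id_apply,
      AlgHom.toLinearMap_apply, h, smul_smul, ← pow_add]
    rw [Even.neg_one_pow ⟨_, rfl⟩, one_smul, ← two_smul k, smul_smul, inv_mul_cancel₀ two_ne_zero,
      one_smul]
  have hE2 (u : FreeAlgebra k κ) (hu : u ∈ pbw k κ j) : E u ∈ pbw k κ j :=
    Submodule.smul_mem _ _ (add_mem hu (Submodule.smul_mem _ _ (parity_mem_pbw hu)))
  have hE3 (u : FreeAlgebra k κ) : parity k κ (E u) = (-1 : k) ^ (n + 1) • E u := by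
    simp only [E, LinearMap.smul_apply, LinearMap.add_apply, LinearMap.id_apply,
      AlgHom.toLinearMap_apply, map_smul, map_add, parity_parity, smul_add, smul_smul]
    rw [show (-1 : k) ^ (n + 1) * (2⁻¹ * (-1) ^ (n + 1)) = ((-1) ^ (n + 1 + (n + 1))) * 2⁻¹ by ring,
      Even.neg_one_pow ⟨_, rfl⟩, one_mul, mul_comm (2⁻¹ : k), add_comm]
  have hT : TensorProduct.lift (substBilin n a f) (generic a g) = generic a (circ f g) := by
    rw [generic_circ, generic_apply, map_sum]
    refine Finset.sum_congr rfl fun v _ => ?_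
    rw [lTensor_substDer_generic]
    rfl
  rw [← hT, ← hE1]
  obtain ⟨t, ht⟩ := hg κ a
  rw [← ht]
  clear ht
  induction t with
  | zero => simp
  | add s t hs ht => simp only [map_add]; exact add_mem hs ht
  | tmul b Q =>
    simp only [LinearMap.lTensor_tmul, Submodule.coe_subtype, TensorProduct.lift.tmul]
    have : substBilin n a f b (E Q) = (substDer n (E Q)).lTensor A
        (generic (fun s : Option κ => s.elim b a) f) := (lTensor_substDer_generic _ _ _ _ _).symm
    rw [this]
    refine lTensor_mem_pbwCoeff _ (fun u hu => ?_) (hf (Option κ) _)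
    refine superDer_mem_pbw _ _ _ superLie_forgetNone ?_ ?_ i hu
    · rintro (_ | s)
      · exact hE2 _ Q.2
      · exact zero_mem _
    · rintro (_ | s)
      · exact hE3 _
      · simp

end Composition

/-! ### The bracket `[ , ]_p` -/

section HodgeBracket

variable {k : Type u} [Field k] {A : Type u} [CommRing A] [Algebra k A]

lemma gerstenhaber_symm {m n : ℕ} (f : Cochain k A (m + 1)) (g : Cochain k A (n + 1)) :
    gerstenhaber f g =
      -((-1 : k) ^ (m * n) • castArity (show n + m + 1 = m + n + 1 by omega) (gerstenhaber g f)) :=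
  evalSeq_injective (by
    rw [evalSeq_gerstenhaber_symm, evalSeq_neg, evalSeq_smul, evalSeq_castArity])

lemma gerstenhaber_jacobi {m n p : ℕ} (f : Cochain k A (m + 1))
    (g : Cochain k A (n + 1)) (h : Cochain k A (p + 1)) :
    gerstenhaber f (gerstenhaber g h) =
      castArity (show m + n + p + 1 = m + (n + p) + 1 by omega)
        (gerstenhaber (gerstenhaber f g) h) +
      (-1 : k) ^ (m * n) • castArity (show n + (m + p) + 1 = m + (n + p) + 1 by omega)
        (gerstenhaber g (gerstenhaber f h)) :=
  evalSeq_injective (by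
    rw [evalSeq_gerstenhaber_jacobi, evalSeq_add, evalSeq_smul, evalSeq_castArity,
      evalSeq_castArity])

lemma castArity_mem_hodgeFil {m n q : ℕ} (h : m = n) {f : Cochain k A m}
    (hf : f ∈ hodgeFil k A m q) : castArity h f ∈ hodgeFil k A n q := by
  subst h; exact hf

lemma hodgeProj_castArity {m n i : ℕ} (h : m = n) (f : Cochain k A m) :
    hodgeProj k A n i (castArity h f) = castArity h (hodgeProj k A m i f) := by
  subst h; rfl

variable [CharZero k]

lemma gerstenhaber_mem_hodgeFil {m n i j : ℕ} {f : Cochain k A (m + 1)}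
    {g : Cochain k A (n + 1)} (hf : f ∈ hodgeFil k A (m + 1) i) (hg : g ∈ hodgeFil k A (n + 1) j) :
    gerstenhaber f g ∈ hodgeFil k A (m + n + 1) (i + j - 1) := by
  refine sub_mem (circ_mem_hodgeFil hf hg) (Submodule.smul_mem _ _ (castArity_mem_hodgeFil _ ?_))
  rw [add_comm i j]
  exact circ_mem_hodgeFil hg hf

/-- `f` is of Hodge weight `i`, in the range where the Hodge pieces can be nonzero. -/
structure HasWeight {n : ℕ} (i : ℕ) (f : Cochain k A n) : Prop where
  mem : i ∈ Finset.Icc 1 n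
  eigen : shuffleOp k A n f = ((2 : k) ^ i - 2) • f

omit [CharZero k] in
lemma hasWeight_hodgeProj {n i : ℕ} (hi : i ∈ Finset.Icc 1 n) (f : Cochain k A n) :
    HasWeight i (hodgeProj k A n i f) :=
  ⟨hi, shuffleOp_hodgeProj (Finset.mem_Icc.1 hi).1 (Finset.mem_Icc.1 hi).2 f⟩

lemma HasWeight.mem_hodgeFil {n i : ℕ} {f : Cochain k A n} (hf : HasWeight i f) :
    f ∈ hodgeFil k A n i :=
  mem_hodgeFil_of_eigen (Finset.mem_Icc.1 hf.mem).1 (Finset.mem_Icc.1 hf.mem).2 hf.eigen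

lemma HasWeight.hodgeProj {n i j : ℕ} {f : Cochain k A n} (hf : HasWeight i f) :
    hodgeProj k A n j f = if j = i then f else 0 :=
  hodgeProj_of_eigen hf.mem hf.eigen

/-- Every cochain is a sum of cochains of pure weight. -/
lemma weight_induction {n : ℕ} {P : Cochain k A (n + 1) → Prop} (h0 : P 0)
    (hadd : ∀ f g, P f → P g → P (f + g)) (hw : ∀ i f, HasWeight i f → P f)
    (f : Cochain k A (n + 1)) : P f := by
  rw [← sum_hodgeProj (show 1 ≤ n + 1 by omega) f]
  exact Finset.sum_induction _ P hadd h0 fun i hi => hw i _ (hasWeight_hodgeProj hi f)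

omit [CharZero k] in
lemma hodgeBracket_apply {m n : ℕ} (f : Cochain k A (m + 1)) (g : Cochain k A (n + 1)) :
    hodgeBracket f g = ∑ i ∈ Finset.Icc 1 (m + 1), ∑ j ∈ Finset.Icc 1 (n + 1),
      hodgeProj k A (m + n + 1) (i + j - 1)
        (gerstenhaber (hodgeProj k A (m + 1) i f) (hodgeProj k A (n + 1) j g)) := by
  simp only [hodgeBracket, LinearMap.sum_apply, LinearMap.compr₂_apply,
    LinearMap.compl₁₂_apply]

lemma HasWeight.hodgeBracket {m n i j : ℕ} {f : Cochain k A (m + 1)} {g : Cochain k A (n + 1)}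
    (hf : HasWeight i f) (hg : HasWeight j g) :
    hodgeBracket f g = PoissonDef.hodgeProj k A (m + n + 1) (i + j - 1) (gerstenhaber f g) := by
  rw [hodgeBracket_apply, Finset.sum_eq_single i, Finset.sum_eq_single j]
  · rw [hf.hodgeProj, hg.hodgeProj, if_pos rfl, if_pos rfl]
  · intro j' _ hj
    rw [hg.hodgeProj, if_neg hj, map_zero, map_zero]
  · exact fun h => absurd hg.mem h
  · intro i' _ hi
    refine Finset.sum_eq_zero fun j' _ => ?_
    rw [hf.hodgeProj, if_neg hi, map_zero, LinearMap.zero_apply, map_zero]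
  · exact fun h => absurd hf.mem h

lemma HasWeight.hodgeBracket_weight {m n i j : ℕ} {f : Cochain k A (m + 1)}
    {g : Cochain k A (n + 1)} (hf : HasWeight i f) (hg : HasWeight j g) :
    HasWeight (i + j - 1) (PoissonDef.hodgeBracket f g) := by
  rw [hf.hodgeBracket hg]
  refine hasWeight_hodgeProj ?_ _
  have h1 := Finset.mem_Icc.1 hf.mem
  have h2 := Finset.mem_Icc.1 hg.mem
  rw [Finset.mem_Icc]
  omega

/-- Only the top component of an inner bracket contributes to the top component of an iterated
bracket. -/
lemma hodgeProj_gerstenhaber_hodgeProj {m n i q : ℕ} (h1 : 1 ≤ i) (hi : i ≤ m + 1) (hq : q ≤ n)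
    {f : Cochain k A (m + 1)} {x : Cochain k A (n + 1)} (hf : f ∈ hodgeFil k A (m + 1) i)
    (hx : x ∈ hodgeFil k A (n + 1) (q + 1)) :
    hodgeProj k A (m + n + 1) (i + q) (gerstenhaber f (hodgeProj k A (n + 1) (q + 1) x)) =
      hodgeProj k A (m + n + 1) (i + q) (gerstenhaber f x) := by
  have h := gerstenhaber_mem_hodgeFil hf (sub_hodgeProj_mem (by omega) hx)
  have h' := hodgeProj_eq_zero (i := i + q) (by omega) (by omega) h
  rw [map_sub, map_sub, sub_eq_zero] at h'
  exact h'.symm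

lemma hodgeProj_gerstenhaber_hodgeProj' {m n i q : ℕ} (h1 : 1 ≤ i) (hi : i ≤ n + 1) (hq : q ≤ m)
    {f : Cochain k A (n + 1)} {x : Cochain k A (m + 1)} (hf : f ∈ hodgeFil k A (n + 1) i)
    (hx : x ∈ hodgeFil k A (m + 1) (q + 1)) :
    hodgeProj k A (m + n + 1) (q + i) (gerstenhaber (hodgeProj k A (m + 1) (q + 1) x) f) =
      hodgeProj k A (m + n + 1) (q + i) (gerstenhaber x f) := by
  have h := gerstenhaber_mem_hodgeFil (sub_hodgeProj_mem (by omega) hx) hf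
  have h' := hodgeProj_eq_zero (i := q + i) (by omega) (by omega) h
  rw [map_sub, LinearMap.sub_apply, map_sub, sub_eq_zero] at h'
  exact h'.symm

lemma hodgeBracket_symm {m n : ℕ} (f : Cochain k A (m + 1)) (g : Cochain k A (n + 1)) :
    hodgeBracket f g =
      -((-1 : k) ^ (m * n) • castArity (show n + m + 1 = m + n + 1 by omega)
        (hodgeBracket g f)) := by
  induction f using weight_induction with
  | h0 => simp
  | hadd f f' hf hf' => simp only [map_add, LinearMap.add_apply, hf, hf', smul_add, neg_add]
  | hw i f hf =>
    induction g using weight_induction with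
    | h0 => simp
    | hadd g g' hg hg' => simp only [map_add, LinearMap.add_apply, hg, hg', smul_add, neg_add]
    | hw j g hg =>
      rw [hf.hodgeBracket hg, hg.hodgeBracket hf, gerstenhaber_symm f g, map_neg, map_smul,
        hodgeProj_castArity, add_comm i j]

/-- The graded Jacobi identity of the bracket `[ , ]_p`. -/
lemma hodgeBracket_jacobi {m n p : ℕ} (f : Cochain k A (m + 1))
    (g : Cochain k A (n + 1)) (h : Cochain k A (p + 1)) :
    hodgeBracket f (hodgeBracket g h) =
      castArity (show m + n + p + 1 = m + (n + p) + 1 by omega)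
        (hodgeBracket (hodgeBracket f g) h) +
      (-1 : k) ^ (m * n) • castArity (show n + (m + p) + 1 = m + (n + p) + 1 by omega)
        (hodgeBracket g (hodgeBracket f h)) := by
  induction f using weight_induction with
  | h0 => simp
  | hadd f f' hf hf' =>
    simp only [map_add, LinearMap.add_apply, hf, hf', smul_add]; abel
  | hw i f hf =>
  induction g using weight_induction with
  | h0 => simp
  | hadd g g' hg hg' =>
    simp only [map_add, LinearMap.add_apply, hg, hg', smul_add]; abel
  | hw j g hg =>
  induction h using weight_induction with
  | h0 => simp
  | hadd h h' hh hh' =>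
    simp only [map_add, hh, hh', smul_add]; abel
  | hw l h hh =>
    have hi := Finset.mem_Icc.1 hf.mem
    have hj := Finset.mem_Icc.1 hg.mem
    have hl := Finset.mem_Icc.1 hh.mem
    -- an iterated bracket is the component of top weight of the iterated Gerstenhaber bracket
    have key {m n p i j l : ℕ} {f : Cochain k A (m + 1)} {g : Cochain k A (n + 1)}
        {h : Cochain k A (p + 1)} (hf : HasWeight i f) (hg : HasWeight j g)
        (hh : HasWeight l h) : hodgeBracket f (hodgeBracket g h) =
          hodgeProj k A (m + (n + p) + 1) (i + (j + l - 2)) (gerstenhaber f (gerstenhaber g h)) := by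
      have hi := Finset.mem_Icc.1 hf.mem
      have hj := Finset.mem_Icc.1 hg.mem
      have hl := Finset.mem_Icc.1 hh.mem
      rw [hf.hodgeBracket (hg.hodgeBracket_weight hh), hg.hodgeBracket hh]
      have e1 : j + l - 1 = (j + l - 2) + 1 := by omega
      rw [show i + (j + l - 1) - 1 = i + (j + l - 2) by omega, e1]
      refine hodgeProj_gerstenhaber_hodgeProj hi.1 hi.2 (by omega) hf.mem_hodgeFil ?_
      rw [← e1]
      exact gerstenhaber_mem_hodgeFil hg.mem_hodgeFil hh.mem_hodgeFil
    have key' : hodgeBracket (hodgeBracket f g) h =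
        hodgeProj k A (m + n + p + 1) (i + (j + l - 2)) (gerstenhaber (gerstenhaber f g) h) := by
      rw [(hf.hodgeBracket_weight hg).hodgeBracket hh, hf.hodgeBracket hg]
      have e1 : i + j - 1 = (i + j - 2) + 1 := by omega
      rw [show i + j - 1 + l - 1 = (i + j - 2) + l by omega, e1,
        show i + (j + l - 2) = (i + j - 2) + l by omega]
      refine hodgeProj_gerstenhaber_hodgeProj' hl.1 hl.2 (by omega) hh.mem_hodgeFil ?_
      rw [← e1]
      exact gerstenhaber_mem_hodgeFil hf.mem_hodgeFil hg.mem_hodgeFil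
    rw [key hf hg hh, key', key hg hf hh, gerstenhaber_jacobi, map_add, map_smul,
      hodgeProj_castArity, hodgeProj_castArity,
      show j + (i + l - 2) = i + (j + l - 2) by omega]

/-! ### The total bracket -/

omit [CharZero k] in
lemma totalBracket_lof {m n : ℕ} (f : Cochain k A (m + 1)) (g : Cochain k A (n + 1)) :
    totalBracket (DirectSum.lof k ℕ (fun n => Cochain k A (n + 1)) m f)
      (DirectSum.lof k ℕ (fun n => Cochain k A (n + 1)) n g) =
      DirectSum.lof k ℕ (fun n => Cochain k A (n + 1)) (m + n) (hodgeBracket f g) := by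
  simp [totalBracket, DirectSum.toModule_lof]

omit [CharZero k] in
lemma lof_castArity {m n : ℕ} (h : m + 1 = n + 1) (f : Cochain k A (m + 1)) :
    DirectSum.lof k ℕ (fun n => Cochain k A (n + 1)) n (castArity h f) =
      DirectSum.lof k ℕ (fun n => Cochain k A (n + 1)) m f := by
  obtain rfl : m = n := by omega
  rfl

omit [CharZero k] in
lemma negOnePow_smul_eq {V : Type*} [AddCommGroup V] [Module k V] (n : ℕ) (i : ℤ) (hi : i = n)
    (v : V) : (i.negOnePow : ℤ) • v = (-1 : k) ^ n • v := by
  subst hi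
  rcases Nat.even_or_odd n with h | h
  · rw [Int.negOnePow_even _ (by exact_mod_cast h), h.neg_one_pow]; simp
  · rw [Int.negOnePow_odd _ (by exact_mod_cast h), h.neg_one_pow]; simp

omit [CharZero k] in
lemma totalGr_cases {i : ℤ} {x : TotalCochain k A} (hx : x ∈ totalGr i) :
    x = 0 ∨ ∃ (m : ℕ) (f : Cochain k A (m + 1)), i = m ∧
      x = DirectSum.lof k ℕ (fun n => Cochain k A (n + 1)) m f := by
  rcases i with m | m
  · obtain ⟨f, rfl⟩ := hx
    exact Or.inr ⟨m, f, rfl, rfl⟩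
  · exact Or.inl hx

omit [CharZero k] in
lemma lof_mem_totalGr {m : ℕ} (f : Cochain k A (m + 1)) :
    DirectSum.lof k ℕ (fun n => Cochain k A (n + 1)) m f ∈ totalGr (m : ℤ) :=
  ⟨f, rfl⟩

lemma totalBracket_antisymm {i j : ℤ} {x y : TotalCochain k A} (hx : x ∈ totalGr i)
    (hy : y ∈ totalGr j) :
    totalBracket x y = -(((i * j).negOnePow : ℤ) • totalBracket y x) := by
  rcases totalGr_cases hx with rfl | ⟨m, f, rfl, rfl⟩
  · simp
  rcases totalGr_cases hy with rfl | ⟨n, g, rfl, rfl⟩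
  · simp
  rw [negOnePow_smul_eq (k := k) (m * n) _ (by push_cast; rfl), totalBracket_lof, totalBracket_lof,
    hodgeBracket_symm f g, map_neg, map_smul, lof_castArity]

lemma totalBracket_jacobi {i j : ℤ} {x y : TotalCochain k A} (hx : x ∈ totalGr i)
    (hy : y ∈ totalGr j) (z : TotalCochain k A) :
    totalBracket x (totalBracket y z) = totalBracket (totalBracket x y) z +
      ((i * j).negOnePow : ℤ) • totalBracket y (totalBracket x z) := by
  rcases totalGr_cases hx with rfl | ⟨m, f, rfl, rfl⟩
  · simp
  rcases totalGr_cases hy with rfl | ⟨n, g, rfl, rfl⟩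
  · simp
  rw [negOnePow_smul_eq (k := k) (m * n) _ (by push_cast; rfl)]
  induction z using DirectSum.induction_on with
  | zero => simp
  | add z z' hz hz' => simp only [map_add, hz, hz', smul_add]; abel
  | of p h =>
    change totalBracket _ (totalBracket _ (DirectSum.lof k ℕ (fun n => Cochain k A (n + 1)) p h)) =
      totalBracket _ (DirectSum.lof k ℕ (fun n => Cochain k A (n + 1)) p h) + _ • totalBracket _
        (totalBracket _ (DirectSum.lof k ℕ (fun n => Cochain k A (n + 1)) p h))
    simp only [totalBracket_lof]
    rw [hodgeBracket_jacobi f g h, map_add, map_smul, lof_castArity, lof_castArity]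

omit [CharZero k] in
lemma totalBracket_mem {i j : ℤ} {x y : TotalCochain k A} (hx : x ∈ totalGr i)
    (hy : y ∈ totalGr j) : totalBracket x y ∈ (totalGr (i + j) : Submodule k _) := by
  rcases totalGr_cases hx with rfl | ⟨m, f, rfl, rfl⟩
  · simp
  rcases totalGr_cases hy with rfl | ⟨n, g, rfl, rfl⟩
  · simp
  rw [totalBracket_lof]
  exact lof_mem_totalGr _

omit [CharZero k] in
lemma totalGr_isInternal :
    DirectSum.IsInternal (totalGr : ℤ → Submodule k (TotalCochain k A)) := by
  let T : TotalCochain k A →ₗ[k] DirectSum ℤ fun i => (totalGr i : Submodule k (TotalCochain k A)) :=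
    DirectSum.toModule k ℕ _ fun n =>
      DirectSum.lof k ℤ (fun i => (totalGr i : Submodule k (TotalCochain k A))) (n : ℤ) ∘ₗ
        (DirectSum.lof k ℕ (fun n => Cochain k A (n + 1)) n).codRestrict (totalGr (n : ℤ))
          lof_mem_totalGr
  have hT {n : ℕ} (f : Cochain k A (n + 1)) :
      T (DirectSum.lof k ℕ (fun n => Cochain k A (n + 1)) n f) =
        DirectSum.lof k ℤ (fun i => (totalGr i : Submodule k (TotalCochain k A))) (n : ℤ)
          ⟨_, lof_mem_totalGr f⟩ := by
    simp only [T, DirectSum.toModule_lof]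
    rfl
  have hdec := DirectSum.Decomposition.ofLinearMap
    (totalGr : ℤ → Submodule k (TotalCochain k A)) T ?_ ?_
  · exact DirectSum.Decomposition.isInternal _
  · refine DirectSum.linearMap_ext _ fun n => LinearMap.ext fun f => ?_
    simp only [LinearMap.comp_apply, hT, DirectSum.coeLinearMap_lof, LinearMap.id_apply]
  · refine DirectSum.linearMap_ext _ fun i => LinearMap.ext fun ⟨x, hx⟩ => ?_
    simp only [LinearMap.comp_apply, DirectSum.coeLinearMap_lof, LinearMap.id_apply]
    rcases totalGr_cases hx with rfl | ⟨m, f, rfl, rfl⟩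
    · rw [map_zero]
      exact (map_zero _).symm
    · rw [hT]

lemma totalBracket_totalBracket_self (M : TotalCochain k A) (hM : M ∈ totalGr 1)
    (h : totalBracket M M = 0) (x : TotalCochain k A) :
    totalBracket M (totalBracket M x) = 0 := by
  have := totalBracket_jacobi hM hM x
  rw [h, map_zero, LinearMap.zero_apply, zero_add, one_mul,
    negOnePow_smul_eq (k := k) 1 1 (by simp), pow_one, neg_smul, one_smul,
    ← add_eq_zero_iff_eq_neg, ← two_smul k] at this
  exact (smul_eq_zero.1 this).resolve_left two_ne_zero

/-- The algebra of a dgla with an inner differential. -/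
lemma isDGLA_of_structureElement (p : A →ₗ[k] A →ₗ[k] A)
    (h : totalBracket (structureElement p) (structureElement p) = 0) :
    (poissonDGLA p).IsDGLA where
  isInternal := totalGr_isInternal
  d_mem i x hx := by
    rw [add_comm]
    exact totalBracket_mem (i := 1) (lof_mem_totalGr _) hx
  bracket_mem i j x hx y hy := totalBracket_mem hx hy
  d_d x := totalBracket_totalBracket_self (structureElement p) (lof_mem_totalGr _) h x
  antisymm i j x hx y hy := totalBracket_antisymm hx hy
  jacobi i j x hx y hy z := totalBracket_jacobi hx hy z
  leibniz i x hx y := by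
    have := totalBracket_jacobi (i := 1) (lof_mem_totalGr _) hx y (x := structureElement p)
    rw [one_mul] at this
    exact this

end HodgeBracket

/-! ### Shuffle operators and brackets in low degrees -/

section LowDegree

variable {k : Type u} [Field k] {A : Type u} [CommRing A] [Algebra k A]

lemma cochain_ext_two {f g : Cochain k A 2} (h : ∀ a b, f ![a, b] = g ![a, b]) : f = g := by
  ext v
  have hv : v = ![v 0, v 1] := by ext i; fin_cases i <;> rfl
  rw [hv, h]

lemma cochain_ext_three {f g : Cochain k A 3} (h : ∀ a b c, f ![a, b, c] = g ![a, b, c]) :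
    f = g := by
  ext v
  have hv : v = ![v 0, v 1, v 2] := by ext i; fin_cases i <;> rfl
  rw [hv, h]

lemma shuffles_two_one : shuffles 2 1 = {1, Equiv.swap 0 1} := by
  ext π
  rw [mem_shuffles]
  revert π
  decide

lemma shuffles_three_one : shuffles 3 1 = {1, Equiv.swap 0 1, (finRotate 3)⁻¹} := by
  ext π
  rw [mem_shuffles]
  revert π
  decide

lemma shuffles_three_two : shuffles 3 2 = {1, Equiv.swap 1 2, finRotate 3} := by
  ext π
  rw [mem_shuffles]
  revert π
  decide

lemma shuffleOp_two (f : Cochain k A 2) (a b : A) :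
    shuffleOp k A 2 f ![a, b] = f ![a, b] - f ![b, a] := by
  rw [shuffleOp, show Finset.Ico 1 2 = {1} from rfl, Finset.sum_singleton, shuffles_two_one,
    Finset.sum_pair (by decide), Equiv.Perm.sign_swap (by decide)]
  have h : ![a, b] ∘ ⇑(Equiv.swap (0 : Fin 2) 1)⁻¹ = ![b, a] := by ext i; fin_cases i <;> rfl
  have h' : (![a, b] ∘ fun x => x) = ![a, b] := rfl
  simp only [LinearMap.add_apply, LinearMap.smul_apply, add_apply, smul_apply, map_one]
  change _ • f (![a, b] ∘ _) + _ • f (![a, b] ∘ _) = _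
  rw [h, h']
  simp [sub_eq_add_neg]

lemma shuffleOp_three (f : Cochain k A 3) (a b c : A) :
    shuffleOp k A 3 f ![a, b, c] = f ![a, b, c] - f ![b, a, c] + f ![b, c, a] +
      (f ![a, b, c] - f ![a, c, b] + f ![c, a, b]) := by
  rw [shuffleOp, show Finset.Ico 1 3 = {1, 2} from rfl, Finset.sum_pair (by decide),
    shuffles_three_one, shuffles_three_two, Finset.sum_insert (by decide),
    Finset.sum_pair (by decide), Finset.sum_insert (by decide),
    Finset.sum_pair (by decide), Equiv.Perm.sign_swap (by decide), Equiv.Perm.sign_swap (by decide),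
    Equiv.Perm.sign_inv, sign_finRotate]
  have h1 : ![a, b, c] ∘ ⇑(Equiv.swap (0 : Fin 3) 1)⁻¹ = ![b, a, c] := by
    ext i; fin_cases i <;> rfl
  have h2 : ![a, b, c] ∘ ⇑(Equiv.swap (1 : Fin 3) 2)⁻¹ = ![a, c, b] := by
    ext i; fin_cases i <;> rfl
  have h3 : ![a, b, c] ∘ ⇑(finRotate 3)⁻¹ = ![c, a, b] := by ext i; fin_cases i <;> rfl
  have h4 : ![a, b, c] ∘ ⇑(finRotate 3)⁻¹⁻¹ = ![b, c, a] := by ext i; fin_cases i <;> rfl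
  have h' : (![a, b, c] ∘ fun x => x) = ![a, b, c] := rfl
  simp only [LinearMap.add_apply, LinearMap.smul_apply, add_apply, smul_apply, map_one]
  change (_ • f (![a, b, c] ∘ _) + (_ • f (![a, b, c] ∘ _) + _ • f (![a, b, c] ∘ _))) +
    (_ • f (![a, b, c] ∘ _) + (_ • f (![a, b, c] ∘ _) + _ • f (![a, b, c] ∘ _))) = _
  rw [h1, h2, h3, h4, h']
  simp
  abel

lemma circ_two_two (f g : Cochain k A 2) (a b c : A) :
    circ f g ![a, b, c] = f ![g ![a, b], c] - f ![a, g ![b, c]] := by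
  have hg (x y z : A) (i : Fin 2) : (fun l : Fin 2 => ![x, y, z] ⟨(i : ℕ) + l, by omega⟩) =
      ![![x, y, z] i.castSucc, ![x, y, z] i.succ] := by
    funext l
    fin_cases i <;> fin_cases l <;> rfl
  have h0 : insertArg (m := 1) (n := 1) g 0 ![a, b, c] = ![g ![a, b], c] := by
    funext i
    fin_cases i
    · exact congrArg g (hg a b c 0)
    · rfl
  have h1 : insertArg (m := 1) (n := 1) g 1 ![a, b, c] = ![a, g ![b, c]] := by
    funext i
    fin_cases i
    · rfl
    · exact congrArg g (hg a b c 1)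
  rw [circ, LinearMap.mk₂_apply, Fin.sum_univ_two]
  simp only [add_apply, smul_apply, insertAt_apply, h0, h1]
  simp [sub_eq_add_neg]

lemma gerstenhaber_two_two (f g : Cochain k A 2) (a b c : A) :
    gerstenhaber f g ![a, b, c] =
      f ![g ![a, b], c] - f ![a, g ![b, c]] + (g ![f ![a, b], c] - g ![a, f ![b, c]]) := by
  have h : gerstenhaber f g ![a, b, c] =
    circ f g ![a, b, c] - (-1 : k) ^ (1 * 1) • circ g f ![a, b, c] := rfl
  rw [h, circ_two_two, circ_two_two]
  simp only [mul_one, pow_one, neg_smul, one_smul]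
  abel

lemma gerstenhaber_one_two (f : Cochain k A 1) (g : Cochain k A 2) (a b : A) :
    gerstenhaber f g ![a, b] = f ![g ![a, b]] - (g ![f ![a], b] + g ![a, f ![b]]) := by
  have h : gerstenhaber f g ![a, b] =
    circ f g ![a, b] - (-1 : k) ^ (0 * 1) • circ g f ![a, b] := rfl
  have hf (i : Fin 2) : (fun l : Fin 1 => ![a, b] ⟨(i : ℕ) + l, by omega⟩) = ![![a, b] i] := by
    funext l
    fin_cases i <;> fin_cases l <;> rfl
  have hg : (fun l : Fin 2 => ![a, b] ⟨((0 : Fin 1) : ℕ) + l, by omega⟩) = ![a, b] := by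
    funext l
    fin_cases l <;> rfl
  have h0 : insertArg (m := 0) (n := 1) g 0 ![a, b] = ![g ![a, b]] := by
    funext i
    fin_cases i
    exact congrArg g hg
  have h1 : insertArg (m := 1) (n := 0) f 0 ![a, b] = ![f ![a], b] := by
    funext i
    fin_cases i
    · exact congrArg f (hf 0)
    · rfl
  have h2 : insertArg (m := 1) (n := 0) f 1 ![a, b] = ![a, f ![b]] := by
    funext i
    fin_cases i
    · rfl
    · exact congrArg f (hf 1)
  have e1 : circ (m := 0) f g ![a, b] = f ![g ![a, b]] := by
    rw [circ, LinearMap.mk₂_apply, Fin.sum_univ_one]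
    simp only [smul_apply, insertAt_apply, h0]
    simp
  have e2 : circ (m := 1) (n := 0) g f ![a, b] = g ![f ![a], b] + g ![a, f ![b]] := by
    rw [circ, LinearMap.mk₂_apply, Fin.sum_univ_two]
    simp only [add_apply, smul_apply, insertAt_apply, h1, h2]
    simp
  rw [h, e1, e2]
  simp

lemma apply_neg_left (f : Cochain k A 2) (a b : A) : f ![-a, b] = -f ![a, b] :=
  LinearMap.map_neg₂ (toBilin f) a b

lemma apply_neg_right (f : Cochain k A 2) (a b : A) : f ![a, -b] = -f ![a, b] :=
  map_neg (toBilin f a) b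

/-! ### Weights in `C¹`, `C²` and `C³` -/

lemma hasWeight_one_of_arity_one (f : Cochain k A 1) : HasWeight 1 f :=
  ⟨by simp, by simp [shuffleOp]⟩

lemma hasWeight_two_one_iff {f : Cochain k A 2} :
    HasWeight 1 f ↔ ∀ a b, f ![a, b] = f ![b, a] := by
  constructor
  · intro h a b
    have := congrArg (fun f => f ![a, b]) h.eigen
    simp only [shuffleOp_two, pow_one, sub_self, zero_smul] at this
    exact sub_eq_zero.1 this
  · intro h
    refine ⟨by simp, cochain_ext_two fun a b => ?_⟩
    simp [shuffleOp_two, h a b]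

lemma hasWeight_two_two_iff {f : Cochain k A 2} :
    HasWeight 2 f ↔ ∀ a b, f ![a, b] = -f ![b, a] := by
  constructor
  · intro h a b
    have := congrArg (fun f => f ![a, b]) h.eigen
    simp only [shuffleOp_two, smul_apply] at this
    rw [show (2 : k) ^ 2 - 2 = 2 by norm_num, two_smul, sub_eq_add_neg, add_right_inj] at this
    exact this.symm
  · intro h
    refine ⟨by simp, cochain_ext_two fun a b => ?_⟩
    rw [shuffleOp_two, smul_apply, show (2 : k) ^ 2 - 2 = 2 by norm_num, two_smul, h b a,
      sub_neg_eq_add]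

lemma hodgeProj_two_add (f : Cochain k A 2) [CharZero k] :
    hodgeProj k A 2 1 f + hodgeProj k A 2 2 f = f := by
  have := sum_hodgeProj (show 1 ≤ 2 by norm_num) f
  rwa [show Finset.Icc 1 2 = {1, 2} from rfl, Finset.sum_pair (by norm_num)] at this

/-- The sum of the cyclic rotations of a cochain of arity three. -/
def cyclicSum (f : Cochain k A 3) : Cochain k A 3 :=
  f + (f.domDomCongr (finRotate 3) + f.domDomCongr (finRotate 3)⁻¹)

lemma cyclicSum_apply (f : Cochain k A 3) (a b c : A) :
    cyclicSum f ![a, b, c] = f ![a, b, c] + (f ![b, c, a] + f ![c, a, b]) := by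
  have h3 : ![a, b, c] ∘ ⇑(finRotate 3)⁻¹ = ![c, a, b] := by ext i; fin_cases i <;> rfl
  have h4 : ![a, b, c] ∘ ⇑(finRotate 3) = ![b, c, a] := by ext i; fin_cases i <;> rfl
  change f ![a, b, c] + (f (![a, b, c] ∘ _) + f (![a, b, c] ∘ _)) = _
  rw [h3, h4]

variable [CharZero k]

/-- The Gerstenhaber bracket of two symmetric bilinear maps is in the first step of the Hodge
filtration, hence of weight one. -/
lemma hodgeBracket_one_one {f g : Cochain k A 2} (hf : HasWeight 1 f) (hg : HasWeight 1 g) :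
    hodgeBracket f g = gerstenhaber f g := by
  rw [hf.hodgeBracket hg]
  have h := gerstenhaber_mem_hodgeFil hf.mem_hodgeFil hg.mem_hodgeFil
  refine (Finset.sum_eq_single 1 (fun i hi hi' => ?_) (by simp)).symm.trans
    (sum_hodgeProj (n := 1 + 1 + 1) (by omega) _)
  rw [Finset.mem_Icc] at hi
  exact hodgeProj_eq_zero (by omega) hi.2 h

omit [CharZero k] in
/-- The Gerstenhaber bracket of a symmetric and a skew-symmetric bilinear map is invariant under
reversal of the arguments, and therefore of weight two. -/
lemma hasWeight_gerstenhaber_one_two {f g : Cochain k A 2} (hf : HasWeight 1 f)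
    (hg : HasWeight 2 g) : HasWeight 2 (gerstenhaber f g : Cochain k A 3) := by
  rw [hasWeight_two_one_iff] at hf
  rw [hasWeight_two_two_iff] at hg
  have hrev (a b c : A) : (gerstenhaber f g : Cochain k A 3) ![c, b, a] =
      (gerstenhaber f g : Cochain k A 3) ![a, b, c] := by
    rw [gerstenhaber_two_two, gerstenhaber_two_two, hg c b, hg b a, hf c b, hf b a, hf _ a, hf c,
      hg _ a, hg c, apply_neg_left, apply_neg_right]
    abel
  refine ⟨by simp, cochain_ext_three fun a b c => ?_⟩
  rw [shuffleOp_three, smul_apply, show (2 : k) ^ 2 - 2 = 2 by norm_num, two_smul, hrev b c a,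
    hrev c a b]
  abel

omit [CharZero k] in
lemma gerstenhaber_comm_two (f g : Cochain k A 2) :
    (gerstenhaber f g : Cochain k A 3) = gerstenhaber g f :=
  cochain_ext_three fun a b c => by
    rw [gerstenhaber_two_two, gerstenhaber_two_two, add_comm]

lemma hodgeBracket_one_two {f g : Cochain k A 2} (hf : HasWeight 1 f) (hg : HasWeight 2 g) :
    hodgeBracket f g = gerstenhaber f g := by
  rw [hf.hodgeBracket hg]
  exact ((hasWeight_gerstenhaber_one_two hf hg).hodgeProj (j := 2)).trans (if_pos rfl)

lemma hodgeBracket_two_one {f g : Cochain k A 2} (hf : HasWeight 2 f) (hg : HasWeight 1 g) :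
    hodgeBracket f g = gerstenhaber f g := by
  rw [hf.hodgeBracket hg, gerstenhaber_comm_two f g]
  exact ((hasWeight_gerstenhaber_one_two hg hf).hodgeProj (j := 2)).trans (if_pos rfl)

/-- The Gerstenhaber bracket `G` of two skew-symmetric bilinear maps changes its sign under reversal
of the arguments; its component of weight three is the mean of its cyclic rotations. -/
lemma hodgeBracket_two_two {f g : Cochain k A 2} (hf : HasWeight 2 f) (hg : HasWeight 2 g) :
    hodgeBracket f g = (3⁻¹ : k) • cyclicSum (gerstenhaber f g) := by
  have hf' := hasWeight_two_two_iff.1 hf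
  have hg' := hasWeight_two_two_iff.1 hg
  set G : Cochain k A 3 := gerstenhaber f g with hG
  have hrev (a b c : A) : G ![c, b, a] = -G ![a, b, c] := by
    rw [hG, gerstenhaber_two_two, gerstenhaber_two_two, hg' c b, hg' b a, hf' c b, hf' b a,
      hf' _ a, hf' c, hg' _ a, hg' c]
    simp only [apply_neg_left, apply_neg_right]
    abel
  have h3 : (3 : k) ≠ 0 := by norm_num
  have hcyc : HasWeight 3 ((3⁻¹ : k) • cyclicSum G) := by
    refine ⟨by simp, cochain_ext_three fun a b c => ?_⟩
    rw [shuffleOp_three]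
    simp only [smul_apply, cyclicSum_apply]
    rw [hrev c a b, hrev b c a, hrev a b c, show (2 : k) ^ 3 - 2 = 6 by norm_num, smul_smul]
    rw [show (6 : k) * 3⁻¹ = 2 by norm_num, two_smul]
    have e : ∀ x : A, x = (3⁻¹ : k) • (x + x + x) := fun x => by
      have h : x + x + x = (3 : k) • x := by
        rw [show (3 : k) = 1 + 1 + 1 by norm_num, add_smul, add_smul, one_smul]
      rw [h, smul_smul, inv_mul_cancel₀ h3, one_smul]
    rw [e (G ![a, b, c] + (G ![b, c, a] + G ![c, a, b]) +
      (G ![a, b, c] + (G ![b, c, a] + G ![c, a, b]))), ← smul_sub, ← smul_add, ← smul_sub,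
      ← smul_add, ← smul_add]
    congr 1
    abel
  -- the rest is annihilated by the shuffle operator
  have hrest : HasWeight 1 (G - (3⁻¹ : k) • cyclicSum G) := by
    refine ⟨by simp, ?_⟩
    rw [map_sub, hcyc.eigen]
    refine cochain_ext_three fun a b c => ?_
    simp only [sub_apply, smul_apply, shuffleOp_three, cyclicSum_apply]
    rw [hrev c a b, hrev b c a, show (2 : k) ^ 3 - 2 = 6 by norm_num, smul_smul,
      show (6 : k) * 3⁻¹ = 2 by norm_num, two_smul, pow_one, sub_self, zero_smul]
    abel
  rw [hf.hodgeBracket hg]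
  change hodgeProj k A 3 3 G = _
  have e : G = (3⁻¹ : k) • cyclicSum G + (G - (3⁻¹ : k) • cyclicSum G) := by abel
  conv_lhs => rw [e]
  rw [map_add, hcyc.hodgeProj, hrest.hodgeProj, if_pos rfl, if_neg (by norm_num), add_zero]

omit [CharZero k] in
lemma hasWeight_hodgeProj_two_one (f : Cochain k A 2) : HasWeight 1 (hodgeProj k A 2 1 f) :=
  hasWeight_hodgeProj (by simp) f

omit [CharZero k] in
lemma hasWeight_hodgeProj_two_two (f : Cochain k A 2) : HasWeight 2 (hodgeProj k A 2 2 f) :=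
  hasWeight_hodgeProj (by simp) f

lemma hodgeBracket_two_arity (f g : Cochain k A 2) :
    (hodgeBracket f g : Cochain k A 3) =
      gerstenhaber (hodgeProj k A 2 1 f) (hodgeProj k A 2 1 g) +
      (gerstenhaber (hodgeProj k A 2 1 f) (hodgeProj k A 2 2 g) +
        gerstenhaber (hodgeProj k A 2 1 g) (hodgeProj k A 2 2 f)) +
      (3⁻¹ : k) • cyclicSum (gerstenhaber (hodgeProj k A 2 2 f) (hodgeProj k A 2 2 g)) := by
  conv_lhs => rw [← hodgeProj_two_add f, ← hodgeProj_two_add g]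
  simp only [map_add, LinearMap.add_apply]
  rw [hodgeBracket_one_one (hasWeight_hodgeProj_two_one f) (hasWeight_hodgeProj_two_one g),
    hodgeBracket_one_two (hasWeight_hodgeProj_two_one f) (hasWeight_hodgeProj_two_two g),
    hodgeBracket_two_one (hasWeight_hodgeProj_two_two f) (hasWeight_hodgeProj_two_one g),
    hodgeBracket_two_two (hasWeight_hodgeProj_two_two f) (hasWeight_hodgeProj_two_two g),
    gerstenhaber_comm_two (hodgeProj k A 2 2 f) (hodgeProj k A 2 1 g)]
  abel

lemma hasWeight_component_one (f g : Cochain k A 2) : HasWeight 1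
    (gerstenhaber (hodgeProj k A 2 1 f) (hodgeProj k A 2 1 g) : Cochain k A 3) := by
  rw [← hodgeBracket_one_one (hasWeight_hodgeProj_two_one f) (hasWeight_hodgeProj_two_one g)]
  exact (hasWeight_hodgeProj_two_one f).hodgeBracket_weight (hasWeight_hodgeProj_two_one g)

lemma hasWeight_component_three (f g : Cochain k A 2) : HasWeight 3 ((3⁻¹ : k) •
    cyclicSum (gerstenhaber (hodgeProj k A 2 2 f) (hodgeProj k A 2 2 g))) := by
  rw [← hodgeBracket_two_two (hasWeight_hodgeProj_two_two f) (hasWeight_hodgeProj_two_two g)]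
  exact (hasWeight_hodgeProj_two_two f).hodgeBracket_weight (hasWeight_hodgeProj_two_two g)

/-- The components of weight one, two and three of the bracket of two elements of `C²(A)`. -/
lemma hodgeProj_hodgeBracket_two (f g : Cochain k A 2) :
    hodgeProj k A 3 1 (hodgeBracket f g : Cochain k A 3) =
      gerstenhaber (hodgeProj k A 2 1 f) (hodgeProj k A 2 1 g) ∧
    hodgeProj k A 3 2 (hodgeBracket f g : Cochain k A 3) =
      gerstenhaber (hodgeProj k A 2 1 f) (hodgeProj k A 2 2 g) +
        gerstenhaber (hodgeProj k A 2 1 g) (hodgeProj k A 2 2 f) ∧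
    hodgeProj k A 3 3 (hodgeBracket f g : Cochain k A 3) =
      (3⁻¹ : k) • cyclicSum (gerstenhaber (hodgeProj k A 2 2 f) (hodgeProj k A 2 2 g)) := by
  have h1 := hasWeight_component_one f g
  have h2 := hasWeight_gerstenhaber_one_two (hasWeight_hodgeProj_two_one f)
    (hasWeight_hodgeProj_two_two g)
  have h2' := hasWeight_gerstenhaber_one_two (hasWeight_hodgeProj_two_one g)
    (hasWeight_hodgeProj_two_two f)
  have h3 := hasWeight_component_three f g
  rw [hodgeBracket_two_arity]
  simp only [map_add, h1.hodgeProj, h2.hodgeProj, h2'.hodgeProj, h3.hodgeProj]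
  refine ⟨?_, ?_, ?_⟩ <;> simp

/-- The structure element satisfies `[μ + μ_p, μ + μ_p]_p = 0`: the components of weight one, two and
three express associativity, the Leibniz rule and the Jacobi identity. -/
lemma totalBracket_structureElement {p : A →ₗ[k] A →ₗ[k] A}
    (hp : IsPoissonBracket (LinearMap.mul k A) p) :
    totalBracket (structureElement p) (structureElement p) = 0 := by
  have h1 : HasWeight 1 (ofBilin (LinearMap.mul k A)) :=
    hasWeight_two_one_iff.2 fun a b => mul_comm a b
  have h2 : HasWeight 2 (ofBilin p) := hasWeight_two_two_iff.2 fun a b => hp.skew a b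
  rw [structureElement, totalBracket_lof]
  suffices h : (hodgeBracket (ofBilin (LinearMap.mul k A) + ofBilin p)
      (ofBilin (LinearMap.mul k A) + ofBilin p) : Cochain k A 3) = 0 by
    exact (congrArg _ h).trans (map_zero _)
  simp only [map_add, LinearMap.add_apply]
  rw [hodgeBracket_one_one h1 h1, hodgeBracket_one_two h1 h2, hodgeBracket_two_one h2 h1,
    hodgeBracket_two_two h2 h2, gerstenhaber_comm_two (ofBilin p)]
  have ev (f g : A →ₗ[k] A →ₗ[k] A) (a b c : A) :
      (gerstenhaber (ofBilin f) (ofBilin g) : Cochain k A 3) ![a, b, c] =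
        f (g a b) c - f a (g b c) + (g (f a b) c - g a (f b c)) :=
    gerstenhaber_two_two _ _ a b c
  have e1 : (gerstenhaber (ofBilin (LinearMap.mul k A)) (ofBilin (LinearMap.mul k A)) :
      Cochain k A 3) = 0 := cochain_ext_three fun a b c => by
    rw [ev]
    simp [mul_assoc]
  have e2 : (gerstenhaber (ofBilin (LinearMap.mul k A)) (ofBilin p) :
      Cochain k A 3) = 0 := cochain_ext_three fun a b c => by
    rw [ev, hp.leibniz, hp.skew (LinearMap.mul k A a b) c, hp.leibniz, hp.skew c a, hp.skew c b]
    simp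
    ring
  have e3 : cyclicSum (gerstenhaber (ofBilin p) (ofBilin p) : Cochain k A 3) = 0 :=
    cochain_ext_three fun a b c => by
      have hJ := hp.jacobi a b c
      rw [cyclicSum_apply, ev, ev, ev, hp.skew (p a b) c, hp.skew (p b c) a, hp.skew (p c a) b]
      change _ = (0 : A)
      linear_combination (-4 : A) * hJ
  rw [e1, e2, e3]
  simp

lemma poissonDGLA_isDGLA {p : A →ₗ[k] A →ₗ[k] A}
    (hp : IsPoissonBracket (LinearMap.mul k A) p) : (poissonDGLA p).IsDGLA :=
  isDGLA_of_structureElement p (totalBracket_structureElement hp)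

end LowDegree

/-! ### Modules over local Artinian algebras -/

section BaseChange

variable {k : Type u} [Field k] {A : Type u} [CommRing A] [Algebra k A]

lemma ArtAlg.isNilpotent_maximalIdeal (B : ArtAlg k) :
    IsNilpotent (IsLocalRing.maximalIdeal (B : Type u)) := by
  rw [← IsLocalRing.jacobson_eq_maximalIdeal (⊥ : Ideal (B : Type u)) bot_ne_top]
  exact IsArtinianRing.isNilpotent_jacobson_bot

instance ArtAlg.moduleFinite (B : ArtAlg k) : Module.Finite k (B : Type u) := by
  have h : Ring.jacobson (B : Type u) = IsLocalRing.maximalIdeal (B : Type u) :=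
    IsLocalRing.ringJacobson_eq_maximalIdeal _
  have : Module.Finite k ((B : Type u) ⧸ Ring.jacobson (B : Type u)) := by
    rw [h]
    exact Module.Finite.of_surjective (Algebra.linearMap k (IsLocalRing.ResidueField B))
      B.residue_bijective.2
  exact IsSemiprimaryRing.finite_of_isArtinian k B B

/-- A linear map that sends a module `M` to `I M` for a nilpotent ideal `I` is nilpotent. -/
lemma isNilpotent_of_forall_mem_smul_top {R M : Type*} [CommRing R] [AddCommGroup M] [Module R M]
    {I : Ideal R} (hI : IsNilpotent I) {f : Module.End R M}
    (hf : ∀ v, f v ∈ I • (⊤ : Submodule R M)) : IsNilpotent f := by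
  obtain ⟨n, hn⟩ := hI
  have h (j : ℕ) (v : M) : (f ^ j) v ∈ I ^ j • (⊤ : Submodule R M) := by
    induction j with
    | zero => simp
    | succ j ih =>
      rw [pow_succ' f, Module.End.mul_apply]
      have : (I ^ j • (⊤ : Submodule R M)).map f ≤ I ^ (j + 1) • (⊤ : Submodule R M) := by
        rw [Submodule.map_smul'', pow_succ, Submodule.mul_smul]
        refine Submodule.smul_mono le_rfl ?_
        rintro _ ⟨w, -, rfl⟩
        exact hf w
      exact this (Submodule.mem_map_of_mem ih)
  refine ⟨n, LinearMap.ext fun v => ?_⟩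
  have := h n v
  rw [hn] at this
  simpa using this

/-- An endomorphism that is the identity modulo a nilpotent ideal is invertible. -/
lemma isUnit_of_forall_sub_mem_smul_top {R M : Type*} [CommRing R] [AddCommGroup M] [Module R M]
    {I : Ideal R} (hI : IsNilpotent I) {f : Module.End R M}
    (hf : ∀ v, f v - v ∈ I • (⊤ : Submodule R M)) : IsUnit f := by
  have := (isNilpotent_of_forall_mem_smul_top hI (f := f - 1) hf).isUnit_add_one
  rwa [sub_add_cancel] at this

/-- A family of linear maps that is jointly injective remains so after tensoring with a vector
space. -/
lemma eq_zero_of_forall_lTensor {ι X Y : Type*} [AddCommGroup X] [Module k X] [AddCommGroup Y]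
    [Module k Y] {P : Type*} [AddCommGroup P] [Module k P] (φ : ι → X →ₗ[k] Y)
    (hφ : ∀ x, (∀ i, φ i x = 0) → x = 0) {t : P ⊗[k] X}
    (ht : ∀ i, (φ i).lTensor P t = 0) : t = 0 := by
  classical
  let e := Module.Basis.ofVectorSpace k P
  have key (i : ι) (t : P ⊗[k] X) : TensorProduct.equivFinsuppOfBasisLeft e ((φ i).lTensor P t) =
      (TensorProduct.equivFinsuppOfBasisLeft e t).mapRange (φ i) (map_zero _) := by
    induction t with
    | zero => simp
    | add s t hs ht => rw [map_add, map_add, hs, ht, map_add, Finsupp.mapRange_add (map_add _)]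
    | tmul b x =>
      ext j
      simp
  rw [← (TensorProduct.equivFinsuppOfBasisLeft e (N := X)).map_eq_zero_iff]
  ext j
  refine hφ _ fun i => ?_
  have := DFunLike.congr_fun (key i t) j
  rw [ht i] at this
  simpa using this.symm

lemma mem_range_maxIdeal_tmul {B : ArtAlg k} {v : B ⊗[k] A} (hv : v ∈ maxTensor A B) :
    v ∈ LinearMap.range (B.maxIdeal.subtype.rTensor A) := by
  refine Submodule.smul_induction_on hv (fun b hb w _ => ?_) fun x y hx hy => add_mem hx hy
  clear hv
  induction w with
  | zero => simp
  | add x y hx hy => rw [smul_add]; exact add_mem (hx trivial) (hy trivial)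
  | tmul c a =>
    exact ⟨(⟨b * c, Ideal.mul_mem_right c _ hb⟩ : B.maxIdeal) ⊗ₜ a, rfl⟩

lemma tmul_mem_maxTensor {B : ArtAlg k} {b : B} (hb : b ∈ B.maxIdeal) (a : A) :
    b ⊗ₜ[k] a ∈ maxTensor A B := by
  have h : b ⊗ₜ[k] a = b • ((1 : B) ⊗ₜ[k] a) := by rw [smul_tmul', smul_eq_mul, mul_one]
  rw [h]
  exact Submodule.smul_mem_smul hb trivial

/-- Elements of `m_B ⊗ A` expand along a finite family of elements of `m_B`, with coordinates that
depend linearly on them. -/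
lemma exists_expansion (B : ArtAlg k) : ∃ (n : ℕ) (e : Fin n → B)
    (c : Fin n → B ⊗[k] A →ₗ[k] A), (∀ i, e i ∈ B.maxIdeal) ∧
      ∀ v ∈ maxTensor A B, v = ∑ i, e i ⊗ₜ c i v := by
  obtain ⟨r, hr⟩ := B.maxIdeal.subtype.exists_leftInverse_of_injective
    (Submodule.ker_subtype _)
  let e := Module.finBasis k B.maxIdeal
  refine ⟨_, fun i => e i, fun i => TensorProduct.lid k A ∘ₗ
    ((e.coord i ∘ₗ r).rTensor A), fun i => (e i).2, fun v hv => ?_⟩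
  have ht := mem_range_maxIdeal_tmul hv
  clear hv
  obtain ⟨t, rfl⟩ := ht
  induction t with
  | zero => simp
  | add s t hs ht =>
    simp only [map_add, tmul_add, Finset.sum_add_distrib]
    rw [← hs, ← ht]
  | tmul b a =>
    have hb : r b = b := LinearMap.congr_fun hr b
    simp only [LinearMap.rTensor_tmul, Submodule.subtype_apply, LinearMap.comp_apply,
      LinearEquiv.coe_coe, lid_tmul, hb, Module.Basis.coord_apply, tmul_smul, smul_tmul']
    rw [← sum_tmul]
    congr 1
    have := congrArg B.maxIdeal.subtype (e.sum_repr b)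
    rw [map_sum] at this
    exact this.symm

end BaseChange

/-! ### Bilinear maps on a module and their Gerstenhaber bracket -/

section Trilinear

variable {R V : Type*} [CommRing R] [AddCommGroup V] [Module R V]

/-- The Gerstenhaber bracket of two bilinear maps on an `R`-module. -/
def trilin (f g : V →ₗ[R] V →ₗ[R] V) : V →ₗ[R] V →ₗ[R] V →ₗ[R] V :=
  g.compr₂ f - (LinearMap.llcomp R V V V).compl₁₂ f g +
    (f.compr₂ g - (LinearMap.llcomp R V V V).compl₁₂ g f)

lemma trilin_apply (f g : V →ₗ[R] V →ₗ[R] V) (a b c : V) :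
    trilin f g a b c = f (g a b) c - f a (g b c) + (g (f a b) c - g a (f b c)) := rfl

-- the brackets below contain the expressions in question twice
variable (hV : ∀ v : V, v + v = 0 → v = 0)
include hV

/-- A bilinear map is associative if and only if its bracket with itself vanishes. -/
lemma trilin_self_eq_zero_iff {f : V →ₗ[R] V →ₗ[R] V} :
    trilin f f = 0 ↔ ∀ a b c, f (f a b) c = f a (f b c) := by
  constructor
  · intro h a b c
    have := LinearMap.congr_fun₂ (LinearMap.congr_fun h a) b c
    rw [trilin_apply] at this
    exact sub_eq_zero.1 (hV _ this)
  · intro h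
    ext a b c
    simp [trilin_apply, h a b c]

/-- A commutative product `f` and a skew-symmetric `g` satisfy the Leibniz rule if and only if their
bracket vanishes: the bracket is a sum of two values of the defect of the Leibniz rule, and the three
cyclic relations between these values force them to vanish. -/
lemma trilin_eq_zero_iff_leibniz {f g : V →ₗ[R] V →ₗ[R] V} (hf : ∀ a b, f a b = f b a)
    (hg : ∀ a b, g a b = -g b a) :
    trilin f g = 0 ↔ ∀ a b c, g a (f b c) = f (g a b) c + f (g a c) b := by
  let D (a b c : V) : V := g a (f b c) - (f (g a b) c + f (g a c) b)
  have hD (a b c : V) : trilin f g a b c = -(D c a b + D a b c) := by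
    simp only [trilin_apply, D]
    rw [hg (f a b) c, hf a (g b c), hg c a, hg c b]
    simp only [map_neg, LinearMap.neg_apply]
    abel
  have hD' (h : ∀ a b c, D a b c = 0) : trilin f g = 0 := by
    ext a b c
    simp [hD, h]
  constructor
  · intro h
    have h1 (a b c : V) : D a b c = -D c a b := by
      have := hD a b c
      rw [h] at this
      exact eq_neg_of_add_eq_zero_right (neg_eq_zero.1 this.symm)
    intro a b c
    refine sub_eq_zero.1 (hV (D a b c) ?_)
    nth_rewrite 1 [h1 a b c, h1 c a b, h1 b c a]
    simp
  · exact fun h => hD' fun a b c => sub_eq_zero.2 (h a b c)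

/-- A skew-symmetric bilinear map satisfies the Jacobi identity if and only if the cyclic sum of its
bracket with itself vanishes. -/
lemma trilin_cyclic_eq_zero_iff_jacobi {g : V →ₗ[R] V →ₗ[R] V} (hg : ∀ a b, g a b = -g b a) :
    (∀ a b c, trilin g g a b c + (trilin g g b c a + trilin g g c a b) = 0) ↔
      ∀ a b c, g a (g b c) + g b (g c a) + g c (g a b) = 0 := by
  have key (a b c : V) : trilin g g a b c + (trilin g g b c a + trilin g g c a b) =
      -((g a (g b c) + g b (g c a) + g c (g a b) + (g a (g b c) + g b (g c a) + g c (g a b))) +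
       (g a (g b c) + g b (g c a) + g c (g a b) + (g a (g b c) + g b (g c a) + g c (g a b)))) := by
    simp only [trilin_apply]
    rw [hg (g a b) c, hg (g b c) a, hg (g c a) b]
    abel
  simp only [key]
  constructor
  · exact fun h a b c => hV _ (hV _ (neg_eq_zero.1 (h a b c)))
  · intro h a b c
    simp [h a b c]

end Trilinear

/-! ### Bilinear maps on `B ⊗ A` -/

section Extension

variable {k : Type u} [Field k] {A : Type u} [CommRing A] [Algebra k A] (B : ArtAlg k)

variable {B} in
lemma linearMap_ext_one {W : Type*} [AddCommGroup W] [Module B W] {f g : B ⊗[k] A →ₗ[B] W}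
    (h : ∀ a : A, f (1 ⊗ₜ a) = g (1 ⊗ₜ a)) : f = g := by
  refine LinearMap.ext fun v => ?_
  induction v with
  | zero => simp
  | add x y hx hy => rw [map_add, map_add, hx, hy]
  | tmul b a =>
    have hb : b ⊗ₜ[k] a = b • ((1 : B) ⊗ₜ[k] a) := by rw [smul_tmul', smul_eq_mul, mul_one]
    rw [hb, map_smul, map_smul, h]

variable {B} in
lemma bilin_ext_one {W : Type*} [AddCommGroup W] [Module B W]
    {f g : B ⊗[k] A →ₗ[B] B ⊗[k] A →ₗ[B] W}
    (h : ∀ a b : A, f (1 ⊗ₜ a) (1 ⊗ₜ b) = g (1 ⊗ₜ a) (1 ⊗ₜ b)) : f = g :=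
  linearMap_ext_one fun a => linearMap_ext_one (h a)

variable {B} in
lemma trilin_ext_one {W : Type*} [AddCommGroup W] [Module B W]
    {f g : B ⊗[k] A →ₗ[B] B ⊗[k] A →ₗ[B] B ⊗[k] A →ₗ[B] W}
    (h : ∀ a b c : A, f (1 ⊗ₜ a) (1 ⊗ₜ b) (1 ⊗ₜ c) = g (1 ⊗ₜ a) (1 ⊗ₜ b) (1 ⊗ₜ c)) : f = g :=
  linearMap_ext_one fun a => bilin_ext_one (h a)

lemma bilinExt_tmul (f : A →ₗ[k] A →ₗ[k] A) (b c : B) (x y : A) :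
    bilinExt B f (b ⊗ₜ x) (c ⊗ₜ y) = (b * c) ⊗ₜ f x y := by
  change LinearMap.BilinMap.baseChange B f _ _ = _
  rw [LinearMap.BilinMap.baseChange_tmul, mul_comm]

/-- The component of weight `i` of an element of `B ⊗ C²(A)` as a `B`-bilinear map on `B ⊗ A`. -/
def cochainBilin (i : ℕ) :
    B ⊗[k] Cochain k A 2 →ₗ[B] (B ⊗[k] A →ₗ[B] B ⊗[k] A →ₗ[B] B ⊗[k] A) :=
  LinearMap.liftBaseChange B (bilinExt B ∘ₗ toBilin ∘ₗ hodgeProj k A 2 i)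

lemma cochainBilin_tmul (i : ℕ) (b : B) (f : Cochain k A 2) (c d : B) (x y : A) :
    cochainBilin B i (b ⊗ₜ f) (c ⊗ₜ x) (d ⊗ₜ y) =
      (b * (c * d)) ⊗ₜ hodgeProj k A 2 i f ![x, y] := by
  rw [cochainBilin, LinearMap.liftBaseChange_tmul, LinearMap.smul_apply, LinearMap.smul_apply]
  change b • bilinExt B _ _ _ = _
  rw [bilinExt_tmul, smul_tmul', smul_eq_mul]
  rfl

lemma cochainBilin_tmul_one (i : ℕ) (b : B) (f : Cochain k A 2) (x y : A) :
    cochainBilin B i (b ⊗ₜ f) (1 ⊗ₜ x) (1 ⊗ₜ y) = b ⊗ₜ hodgeProj k A 2 i f ![x, y] := by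
  rw [cochainBilin_tmul, mul_one, mul_one]

/-- The inclusion `C²(A) → ⨁ₙ Cⁿ(A)`. -/
abbrev inclTwo : Cochain k A 2 →ₗ[k] TotalCochain k A :=
  DirectSum.lof k ℕ (fun n => Cochain k A (n + 1)) 1

lemma weightBilin_incl (i : ℕ) (Y : B ⊗[k] Cochain k A 2) :
    weightBilin B i (inclTwo.lTensor B Y) = cochainBilin B i Y := by
  induction Y with
  | zero => simp
  | add x y hx hy => rw [map_add, map_add, map_add, hx, hy]
  | tmul b f =>
    rw [LinearMap.lTensor_tmul, weightBilin, cochainBilin, LinearMap.liftBaseChange_tmul,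
      LinearMap.liftBaseChange_tmul]
    congr 1

variable [CharZero k]

omit [CharZero k] in
lemma cochainBilin_one_symm (Y : B ⊗[k] Cochain k A 2) (v w : B ⊗[k] A) :
    cochainBilin B 1 Y v w = cochainBilin B 1 Y w v := by
  refine LinearMap.congr_fun₂ (?_ : cochainBilin B 1 Y = (cochainBilin B 1 Y).flip) v w
  refine bilin_ext_one fun a b => ?_
  rw [LinearMap.flip_apply]
  induction Y with
  | zero => simp
  | add x y hx hy => simp only [map_add, LinearMap.add_apply, hx, hy]
  | tmul c f =>
    rw [cochainBilin_tmul_one, cochainBilin_tmul_one,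
      hasWeight_two_one_iff.1 (hasWeight_hodgeProj_two_one f) a b]

omit [CharZero k] in
lemma cochainBilin_two_skew (Y : B ⊗[k] Cochain k A 2) (v w : B ⊗[k] A) :
    cochainBilin B 2 Y v w = -cochainBilin B 2 Y w v := by
  refine LinearMap.congr_fun₂ (?_ : cochainBilin B 2 Y = -(cochainBilin B 2 Y).flip) v w
  refine bilin_ext_one fun a b => ?_
  rw [LinearMap.neg_apply, LinearMap.neg_apply, LinearMap.flip_apply]
  induction Y with
  | zero => simp
  | add x y hx hy => simp only [map_add, LinearMap.add_apply, hx, hy, neg_add]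
  | tmul c f =>
    rw [cochainBilin_tmul_one, cochainBilin_tmul_one,
      hasWeight_two_two_iff.1 (hasWeight_hodgeProj_two_two f) a b, tmul_neg]

/-- Evaluation of a cochain. -/
def evalCochain {n : ℕ} (v : Fin n → A) : Cochain k A n →ₗ[k] A where
  toFun f := f v
  map_add' _ _ := rfl
  map_smul' _ _ := rfl

omit [CharZero k] in
@[simp] lemma evalCochain_apply {n : ℕ} (v : Fin n → A) (f : Cochain k A n) :
    evalCochain v f = f v := rfl

omit [CharZero k] in
lemma eq_zero_of_forall_evalCochain {n : ℕ} {Y : B ⊗[k] Cochain k A n}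
    (h : ∀ v, (evalCochain v).lTensor B Y = 0) : Y = 0 :=
  eq_zero_of_forall_lTensor (fun v : Fin n → A => evalCochain (k := k) v)
    (fun _ hf => MultilinearMap.ext fun v => hf v) h

lemma evalCochain_two (Y : B ⊗[k] Cochain k A 2) (a b : A) :
    (evalCochain ![a, b]).lTensor B Y =
      cochainBilin B 1 Y (1 ⊗ₜ a) (1 ⊗ₜ b) + cochainBilin B 2 Y (1 ⊗ₜ a) (1 ⊗ₜ b) := by
  induction Y with
  | zero => simp
  | add x y hx hy => simp only [map_add, LinearMap.add_apply, hx, hy]; abel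
  | tmul c f =>
    rw [cochainBilin_tmul_one, cochainBilin_tmul_one, ← tmul_add, LinearMap.lTensor_tmul]
    congr 1
    exact (congrArg (fun f => f ![a, b]) (hodgeProj_two_add f)).symm

/-- An element of `B ⊗ C²(A)` is determined by its components of weight one and two. -/
lemma cochainBilin_injective {Y Z : B ⊗[k] Cochain k A 2}
    (h1 : cochainBilin B 1 Y = cochainBilin B 1 Z) (h2 : cochainBilin B 2 Y = cochainBilin B 2 Z) :
    Y = Z := by
  rw [← sub_eq_zero]
  refine eq_zero_of_forall_evalCochain B fun v => ?_
  have hv : v = ![v 0, v 1] := by ext i; fin_cases i <;> rfl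
  rw [hv, evalCochain_two, map_sub, map_sub, h1, h2, sub_self, sub_self]
  simp

/-- The `B`-bilinear extension of the bracket `C²(A) × C²(A) → C³(A)`. -/
def hodgeBracketTwo :
    B ⊗[k] Cochain k A 2 →ₗ[B] B ⊗[k] Cochain k A 2 →ₗ[B] B ⊗[k] Cochain k A 3 :=
  LinearMap.BilinMap.baseChange B (hodgeBracket (m := 1) (n := 1))

omit [CharZero k] in
lemma hodgeBracketTwo_tmul (b c : B) (f g : Cochain k A 2) :
    hodgeBracketTwo B (b ⊗ₜ f) (c ⊗ₜ g) = (b * c) ⊗ₜ (hodgeBracket f g : Cochain k A 3) := by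
  rw [hodgeBracketTwo, LinearMap.BilinMap.baseChange_tmul, mul_comm]

omit [CharZero k] in
lemma trilin_cochainBilin_tmul (i j : ℕ) (b d : B) (f g : Cochain k A 2) (x y z : A) :
    trilin (cochainBilin B i (b ⊗ₜ f)) (cochainBilin B j (d ⊗ₜ g)) (1 ⊗ₜ x) (1 ⊗ₜ y) (1 ⊗ₜ z) =
      (b * d) ⊗ₜ (gerstenhaber (hodgeProj k A 2 i f) (hodgeProj k A 2 j g) : Cochain k A 3)
        ![x, y, z] := by
  rw [trilin_apply, gerstenhaber_two_two]
  simp only [cochainBilin_tmul, mul_one, one_mul]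
  rw [mul_comm d b, ← tmul_sub, ← tmul_sub, ← tmul_add]

omit [CharZero k] in
lemma trilin_add_left (f f' g : B ⊗[k] A →ₗ[B] B ⊗[k] A →ₗ[B] B ⊗[k] A) :
    trilin (f + f') g = trilin f g + trilin f' g := by
  refine trilin_ext_one fun a b c => ?_
  simp only [LinearMap.add_apply, trilin_apply, map_add]
  abel

omit [CharZero k] in
lemma trilin_add_right (f g g' : B ⊗[k] A →ₗ[B] B ⊗[k] A →ₗ[B] B ⊗[k] A) :
    trilin f (g + g') = trilin f g + trilin f g' := by
  refine trilin_ext_one fun a b c => ?_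
  simp only [LinearMap.add_apply, trilin_apply, map_add]
  abel

omit [CharZero k] in
lemma trilin_zero_left (g : B ⊗[k] A →ₗ[B] B ⊗[k] A →ₗ[B] B ⊗[k] A) : trilin 0 g = 0 := by
  refine trilin_ext_one fun a b c => ?_
  simp [trilin_apply]

omit [CharZero k] in
lemma trilin_zero_right (g : B ⊗[k] A →ₗ[B] B ⊗[k] A →ₗ[B] B ⊗[k] A) : trilin g 0 = 0 := by
  refine trilin_ext_one fun a b c => ?_
  simp [trilin_apply]

/-- The component of weight one of the bracket on `B ⊗ C²(A)`. -/
lemma eval_hodgeBracketTwo_one (Y Z : B ⊗[k] Cochain k A 2) (a b c : A) :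
    (evalCochain ![a, b, c]).lTensor B ((hodgeProj k A 3 1).lTensor B (hodgeBracketTwo B Y Z)) =
      trilin (cochainBilin B 1 Y) (cochainBilin B 1 Z) (1 ⊗ₜ a) (1 ⊗ₜ b) (1 ⊗ₜ c) := by
  induction Y with
  | zero => simp [trilin_zero_left]
  | add x y hx hy =>
    rw [map_add, LinearMap.add_apply, map_add, map_add, hx, hy, map_add, trilin_add_left]; rfl
  | tmul s f =>
  induction Z with
  | zero => simp [trilin_zero_right]
  | add x y hx hy => rw [map_add, map_add, map_add, hx, hy, map_add, trilin_add_right]; rfl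
  | tmul t g =>
    rw [trilin_cochainBilin_tmul, hodgeBracketTwo_tmul, LinearMap.lTensor_tmul,
      LinearMap.lTensor_tmul, (hodgeProj_hodgeBracket_two f g).1]
    rfl

/-- The component of weight two of the bracket on `B ⊗ C²(A)`. -/
lemma eval_hodgeBracketTwo_two (Y Z : B ⊗[k] Cochain k A 2) (a b c : A) :
    (evalCochain ![a, b, c]).lTensor B ((hodgeProj k A 3 2).lTensor B (hodgeBracketTwo B Y Z)) =
      trilin (cochainBilin B 1 Y) (cochainBilin B 2 Z) (1 ⊗ₜ a) (1 ⊗ₜ b) (1 ⊗ₜ c) +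
      trilin (cochainBilin B 1 Z) (cochainBilin B 2 Y) (1 ⊗ₜ a) (1 ⊗ₜ b) (1 ⊗ₜ c) := by
  induction Y with
  | zero => simp [trilin_zero_left, trilin_zero_right]
  | add x y hx hy =>
    rw [map_add, LinearMap.add_apply, map_add, map_add, hx, hy, map_add, map_add, trilin_add_left,
      trilin_add_right]
    simp only [LinearMap.add_apply]
    abel
  | tmul s f =>
  induction Z with
  | zero => simp [trilin_zero_left, trilin_zero_right]
  | add x y hx hy =>
    rw [map_add, map_add, map_add, hx, hy, map_add, map_add, trilin_add_left, trilin_add_right]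
    simp only [LinearMap.add_apply]
    abel
  | tmul t g =>
    rw [trilin_cochainBilin_tmul, trilin_cochainBilin_tmul, hodgeBracketTwo_tmul,
      LinearMap.lTensor_tmul, LinearMap.lTensor_tmul, (hodgeProj_hodgeBracket_two f g).2.1,
      mul_comm t s, ← tmul_add]
    rfl

/-- The component of weight three of the bracket on `B ⊗ C²(A)`. -/
lemma eval_hodgeBracketTwo_three (Y Z : B ⊗[k] Cochain k A 2) (a b c : A) :
    (evalCochain ![a, b, c]).lTensor B ((hodgeProj k A 3 3).lTensor B (hodgeBracketTwo B Y Z)) =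
      (3⁻¹ : k) • (
      trilin (cochainBilin B 2 Y) (cochainBilin B 2 Z) (1 ⊗ₜ a) (1 ⊗ₜ b) (1 ⊗ₜ c) +
      (trilin (cochainBilin B 2 Y) (cochainBilin B 2 Z) (1 ⊗ₜ b) (1 ⊗ₜ c) (1 ⊗ₜ a) +
      trilin (cochainBilin B 2 Y) (cochainBilin B 2 Z) (1 ⊗ₜ c) (1 ⊗ₜ a) (1 ⊗ₜ b))) := by
  induction Y with
  | zero => simp [trilin_zero_left]
  | add x y hx hy =>
    rw [map_add, LinearMap.add_apply, map_add, map_add, hx, hy, map_add, trilin_add_left,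
      ← smul_add]
    simp only [LinearMap.add_apply]
    refine congrArg (fun v => (3⁻¹ : k) • v) ?_
    abel
  | tmul s f =>
  induction Z with
  | zero => simp [trilin_zero_right]
  | add x y hx hy =>
    rw [map_add, map_add, map_add, hx, hy, map_add, trilin_add_right, ← smul_add]
    simp only [LinearMap.add_apply]
    refine congrArg (fun v => (3⁻¹ : k) • v) ?_
    abel
  | tmul t g =>
    have e (G : Cochain k A 3) : evalCochain ![a, b, c] ((3⁻¹ : k) • cyclicSum G) =
        (3⁻¹ : k) • (G ![a, b, c] + (G ![b, c, a] + G ![c, a, b])) := by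
      rw [evalCochain_apply, smul_apply, cyclicSum_apply]
    rw [trilin_cochainBilin_tmul, trilin_cochainBilin_tmul, trilin_cochainBilin_tmul,
      hodgeBracketTwo_tmul, LinearMap.lTensor_tmul, LinearMap.lTensor_tmul,
      (hodgeProj_hodgeBracket_two f g).2.2, e, ← tmul_add, ← tmul_add, ← tmul_smul]

end Extension

/-! ### Maurer–Cartan elements and Poisson products -/

section MaurerCartan

variable {k : Type u} [Field k] {A : Type u} [CommRing A] [Algebra k A] (B : ArtAlg k)

lemma sum_hodgeProj_lTensor [CharZero k] (Y : B ⊗[k] Cochain k A 3) :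
    Y = (hodgeProj k A 3 1).lTensor B Y +
      ((hodgeProj k A 3 2).lTensor B Y + (hodgeProj k A 3 3).lTensor B Y) := by
  induction Y with
  | zero => simp
  | add x y hx hy =>
    simp only [map_add]
    nth_rewrite 1 [hx, hy]
    abel
  | tmul b f =>
    rw [LinearMap.lTensor_tmul, LinearMap.lTensor_tmul, LinearMap.lTensor_tmul, ← tmul_add,
      ← tmul_add]
    congr 1
    have := sum_hodgeProj (show 1 ≤ 3 by norm_num) f
    rw [show Finset.Icc 1 3 = {1, 2, 3} from rfl, Finset.sum_insert (by decide),
      Finset.sum_pair (by decide)] at this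
    exact this.symm

lemma eq_zero_of_add_self [CharZero k] {V : Type*} [AddCommGroup V] [Module k V] (v : V)
    (h : v + v = 0) : v = 0 := by
  rw [← two_smul k] at h
  exact (smul_eq_zero.1 h).resolve_left two_ne_zero

lemma lTensor_eq_zero_iff_eval (Y : B ⊗[k] Cochain k A 3) :
    Y = 0 ↔ ∀ a b c : A, (evalCochain ![a, b, c]).lTensor B Y = 0 := by
  refine ⟨fun h => by simp [h], fun h => eq_zero_of_forall_evalCochain B fun v => ?_⟩
  have hv : v = ![v 0, v 1, v 2] := by ext i; fin_cases i <;> rfl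
  rw [hv, h]

/-- The three weight components of the Maurer–Cartan equation: associativity, the Leibniz rule and
the Jacobi identity. -/
lemma hodgeBracketTwo_self_eq_zero_iff [CharZero k] (Y : B ⊗[k] Cochain k A 2) :
    hodgeBracketTwo B Y Y = 0 ↔
      (∀ a b c, cochainBilin B 1 Y (cochainBilin B 1 Y a b) c =
        cochainBilin B 1 Y a (cochainBilin B 1 Y b c)) ∧
      (∀ a b c, cochainBilin B 2 Y a (cochainBilin B 1 Y b c) =
        cochainBilin B 1 Y (cochainBilin B 2 Y a b) c +
          cochainBilin B 1 Y (cochainBilin B 2 Y a c) b) ∧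
      (∀ a b c, cochainBilin B 2 Y a (cochainBilin B 2 Y b c) +
        cochainBilin B 2 Y b (cochainBilin B 2 Y c a) +
          cochainBilin B 2 Y c (cochainBilin B 2 Y a b) = 0) := by
  have hV : ∀ v : B ⊗[k] A, v + v = 0 → v = 0 := eq_zero_of_add_self (k := k)
  rw [← trilin_self_eq_zero_iff hV,
    ← trilin_eq_zero_iff_leibniz hV (cochainBilin_one_symm B Y) (cochainBilin_two_skew B Y),
    ← trilin_cyclic_eq_zero_iff_jacobi hV (cochainBilin_two_skew B Y)]
  constructor
  · intro h
    refine ⟨trilin_ext_one fun a b c => ?_, trilin_ext_one fun a b c => hV _ ?_, ?_⟩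
    · rw [← eval_hodgeBracketTwo_one, h]
      simp
    · rw [← eval_hodgeBracketTwo_two, h]
      simp
    -- the cyclic sum as a trilinear map, in order to extend the identity from `A` to `B ⊗ A`
    · let T := trilin (cochainBilin B 2 Y) (cochainBilin B 2 Y)
      let rot : (B ⊗[k] A →ₗ[B] B ⊗[k] A →ₗ[B] B ⊗[k] A →ₗ[B] B ⊗[k] A) →
          (B ⊗[k] A →ₗ[B] B ⊗[k] A →ₗ[B] B ⊗[k] A →ₗ[B] B ⊗[k] A) := fun t =>
        (LinearMap.lflip.comp t).flip
      have hT : T + (rot T + rot (rot T)) = 0 := trilin_ext_one fun a b c => by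
        change T (1 ⊗ₜ a) (1 ⊗ₜ b) (1 ⊗ₜ c) + (T (1 ⊗ₜ b) (1 ⊗ₜ c) (1 ⊗ₜ a) +
          T (1 ⊗ₜ c) (1 ⊗ₜ a) (1 ⊗ₜ b)) = 0
        have := eval_hodgeBracketTwo_three B Y Y a b c
        rw [h, map_zero, map_zero] at this
        exact (smul_eq_zero.1 this.symm).resolve_left (by norm_num)
      exact fun a b c => LinearMap.congr_fun (LinearMap.congr_fun₂ hT a b) c
  · rintro ⟨h1, h2, h3⟩
    rw [sum_hodgeProj_lTensor B (hodgeBracketTwo B Y Y)]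
    have e1 : (hodgeProj k A 3 1).lTensor B (hodgeBracketTwo B Y Y) = 0 := by
      rw [lTensor_eq_zero_iff_eval]
      intro a b c
      rw [eval_hodgeBracketTwo_one, h1]
      rfl
    have e2 : (hodgeProj k A 3 2).lTensor B (hodgeBracketTwo B Y Y) = 0 := by
      rw [lTensor_eq_zero_iff_eval]
      intro a b c
      rw [eval_hodgeBracketTwo_two, h2]
      simp
    have e3 : (hodgeProj k A 3 3).lTensor B (hodgeBracketTwo B Y Y) = 0 := by
      rw [lTensor_eq_zero_iff_eval]
      intro a b c
      rw [eval_hodgeBracketTwo_three, h3, smul_zero]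
    rw [e1, e2, e3, add_zero, add_zero]

/-- The inclusion `C³(A) → ⨁ₙ Cⁿ(A)`. -/
abbrev inclThree : Cochain k A 3 →ₗ[k] TotalCochain k A :=
  DirectSum.lof k ℕ (fun n => Cochain k A (n + 1)) 2

lemma totalBracket_inclTwo (f g : Cochain k A 2) :
    totalBracket (inclTwo f) (inclTwo g) = inclThree (hodgeBracket f g) :=
  totalBracket_lof f g

variable (p : A →ₗ[k] A →ₗ[k] A)

/-- The structure element `μ + μ_p` as an element of `B ⊗ C²(A)`. -/
def structureCochain : B ⊗[k] Cochain k A 2 := 1 ⊗ₜ (ofBilin (LinearMap.mul k A) + ofBilin p)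

lemma bracketExt_incl (Y Z : B ⊗[k] Cochain k A 2) :
    (poissonDGLA p).bracketExt B (inclTwo.lTensor B Y) (inclTwo.lTensor B Z) =
      inclThree.lTensor B (hodgeBracketTwo B Y Z) := by
  change LinearMap.BilinMap.baseChange B totalBracket _ _ = _
  induction Y with
  | zero => simp
  | add x y hx hy => simp only [map_add, LinearMap.add_apply, hx, hy]
  | tmul b f =>
  induction Z with
  | zero => simp
  | add x y hx hy => simp only [map_add, hx, hy]
  | tmul c g =>
    rw [hodgeBracketTwo_tmul, LinearMap.lTensor_tmul, LinearMap.lTensor_tmul,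
      LinearMap.lTensor_tmul, LinearMap.BilinMap.baseChange_tmul, totalBracket_inclTwo, mul_comm]

lemma dExt_incl (Y : B ⊗[k] Cochain k A 2) :
    (poissonDGLA p).dExt B (inclTwo.lTensor B Y) =
      inclThree.lTensor B (hodgeBracketTwo B (structureCochain B p) Y) := by
  change (totalBracket (structureElement p)).baseChange B _ = _
  induction Y with
  | zero => simp
  | add x y hx hy => simp only [map_add, hx, hy]
  | tmul b f =>
    rw [structureCochain, hodgeBracketTwo_tmul, LinearMap.lTensor_tmul, LinearMap.lTensor_tmul,
      one_mul, LinearMap.baseChange_tmul]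
    exact congrArg _ (totalBracket_inclTwo _ f)

lemma inclThree_lTensor_injective :
    Function.Injective (inclThree.lTensor B : B ⊗[k] Cochain k A 3 →ₗ[k] _) := by
  refine Function.LeftInverse.injective
    (g := (DirectSum.component k ℕ (fun n => Cochain k A (n + 1)) 2).lTensor B) fun Y => ?_
  rw [← LinearMap.comp_apply, ← LinearMap.lTensor_comp]
  have h : DirectSum.component k ℕ (fun n => Cochain k A (n + 1)) 2 ∘ₗ inclThree =
      LinearMap.id := LinearMap.ext fun f =>
    DirectSum.component.lof_self k (M := fun n => Cochain k A (n + 1)) 2 f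
  rw [h, LinearMap.lTensor_id, LinearMap.id_apply]

lemma hodgeBracketTwo_comm [CharZero k] (Y Z : B ⊗[k] Cochain k A 2) :
    hodgeBracketTwo B Y Z = hodgeBracketTwo B Z Y := by
  induction Y with
  | zero => simp
  | add x y hx hy => simp only [map_add, LinearMap.add_apply, hx, hy]
  | tmul b f =>
  induction Z with
  | zero => simp
  | add x y hx hy => simp only [map_add, LinearMap.add_apply, hx, hy]
  | tmul c g =>
    rw [hodgeBracketTwo_tmul, hodgeBracketTwo_tmul, mul_comm]
    congr 1
    rw [hodgeBracket_two_arity, hodgeBracket_two_arity g, gerstenhaber_comm_two (hodgeProj k A 2 1 f),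
      gerstenhaber_comm_two (hodgeProj k A 2 2 f) (hodgeProj k A 2 2 g),
      add_comm (gerstenhaber (hodgeProj k A 2 1 f) (hodgeProj k A 2 2 g) : Cochain k A 3)]

variable {p}

lemma hodgeBracketTwo_structureCochain [CharZero k]
    (hp : IsPoissonBracket (LinearMap.mul k A) p) :
    hodgeBracketTwo B (structureCochain B p) (structureCochain B p) = 0 := by
  apply inclThree_lTensor_injective
  rw [structureCochain, hodgeBracketTwo_tmul, map_zero, LinearMap.lTensor_tmul,
    ← totalBracket_inclTwo]
  have := totalBracket_structureElement hp
  rw [structureElement] at this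
  rw [this, tmul_zero]

/-- The Maurer–Cartan equation for `x` says that the bracket of `μ + μ_p + x` with itself
vanishes. -/
lemma maurerCartan_iff [CharZero k] (hp : IsPoissonBracket (LinearMap.mul k A) p)
    (X : B ⊗[k] Cochain k A 2) :
    (poissonDGLA p).dExt B (inclTwo.lTensor B X) + (2⁻¹ : k) • (poissonDGLA p).bracketExt B
      (inclTwo.lTensor B X) (inclTwo.lTensor B X) = 0 ↔
    hodgeBracketTwo B (structureCochain B p + X) (structureCochain B p + X) = 0 := by
  rw [bracketExt_incl, dExt_incl]
  have h : hodgeBracketTwo B (structureCochain B p + X) (structureCochain B p + X) =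
      (2 : k) • (hodgeBracketTwo B (structureCochain B p) X +
        (2⁻¹ : k) • hodgeBracketTwo B X X) := by
    rw [smul_add, smul_smul, mul_inv_cancel₀ two_ne_zero, one_smul, two_smul, map_add, map_add,
      LinearMap.add_apply, LinearMap.add_apply, hodgeBracketTwo_structureCochain B hp,
      hodgeBracketTwo_comm B X (structureCochain B p)]
    abel
  rw [h, smul_eq_zero_iff_right two_ne_zero]
  constructor
  · intro h0
    apply inclThree_lTensor_injective
    rw [map_zero, map_add, map_smul]
    exact h0
  · intro h0
    have := congrArg (inclThree.lTensor B) h0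
    rw [map_zero, map_add, map_smul] at this
    exact this

end MaurerCartan

/-! ### Poisson products lifting that of `A` -/

section PoissonLift

variable {k : Type u} [Field k] {A : Type u} [CommRing A] [Algebra k A] (B : ArtAlg k)

variable (k A) in
/-- The subspace `m_B ⊗ C²(A)` of `B ⊗ C²(A)`. -/
def maxCochain : Submodule k (B ⊗[k] Cochain k A 2) :=
  LinearMap.range (B.maxIdeal.subtype.rTensor (Cochain k A 2))

lemma mem_grMax_one_iff (p : A →ₗ[k] A →ₗ[k] A) (x : B ⊗[k] TotalCochain k A) :
    x ∈ (poissonDGLA p).grMax B 1 ↔ ∃ X ∈ maxCochain k A B, inclTwo.lTensor B X = x := by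
  constructor
  · rintro ⟨t, rfl⟩
    induction t with
    | zero => exact ⟨0, zero_mem _, (map_zero _).trans (map_zero _).symm⟩
    | add s t hs ht =>
      obtain ⟨X, hX, hX'⟩ := hs
      obtain ⟨Y, hY, hY'⟩ := ht
      exact ⟨X + Y, add_mem hX hY, by rw [map_add, map_add, hX', hY']; rfl⟩
    | tmul b f =>
      obtain ⟨f, g, rfl⟩ := f
      exact ⟨(b : B) ⊗ₜ g, ⟨b ⊗ₜ g, rfl⟩, rfl⟩
  · rintro ⟨_, ⟨t, rfl⟩, rfl⟩
    induction t with
    | zero => rw [map_zero, map_zero]; exact zero_mem _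
    | add s t hs ht => rw [map_add, map_add]; exact add_mem hs ht
    | tmul b f =>
      let f' : (poissonDGLA (A := A) p).gr 1 := ⟨inclTwo f, f, rfl⟩
      exact ⟨b ⊗ₜ f', rfl⟩

lemma smul_mem_maxTensor {b : B} (hb : b ∈ B.maxIdeal) (v : B ⊗[k] A) :
    b • v ∈ maxTensor A B :=
  Submodule.smul_mem_smul hb trivial

lemma cochainBilin_mem_maxTensor (i : ℕ) {X : B ⊗[k] Cochain k A 2} (hX : X ∈ maxCochain k A B)
    (v w : B ⊗[k] A) : cochainBilin B i X v w ∈ maxTensor A B := by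
  obtain ⟨t, rfl⟩ := hX
  induction t with
  | zero => simp
  | add s t hs ht =>
    rw [map_add, map_add, LinearMap.add_apply, LinearMap.add_apply]
    exact add_mem hs ht
  | tmul b f =>
    rw [LinearMap.rTensor_tmul, cochainBilin, LinearMap.liftBaseChange_tmul, LinearMap.smul_apply,
      LinearMap.smul_apply]
    exact smul_mem_maxTensor B b.2 _

variable [CharZero k]

lemma hodgeProj_ofBilin_symm {f : A →ₗ[k] A →ₗ[k] A} (hf : ∀ a b, f a b = f b a) :
    hodgeProj k A 2 1 (ofBilin f) = ofBilin f ∧ hodgeProj k A 2 2 (ofBilin f) = 0 := by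
  have h : HasWeight 1 (ofBilin f) := hasWeight_two_one_iff.2 fun a b => hf a b
  exact ⟨by rw [h.hodgeProj, if_pos rfl], by rw [h.hodgeProj, if_neg (by norm_num)]⟩

lemma hodgeProj_ofBilin_skew {f : A →ₗ[k] A →ₗ[k] A} (hf : ∀ a b, f a b = -f b a) :
    hodgeProj k A 2 1 (ofBilin f) = 0 ∧ hodgeProj k A 2 2 (ofBilin f) = ofBilin f := by
  have h : HasWeight 2 (ofBilin f) := hasWeight_two_two_iff.2 fun a b => hf a b
  exact ⟨by rw [h.hodgeProj, if_neg (by norm_num)], by rw [h.hodgeProj, if_pos rfl]⟩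

variable {p : A →ₗ[k] A →ₗ[k] A}

lemma cochainBilin_structureCochain_one (hp : IsPoissonBracket (LinearMap.mul k A) p) :
    cochainBilin B 1 (structureCochain B p) = bilinExt B (LinearMap.mul k A) :=
  bilin_ext_one fun a b => by
    rw [structureCochain, cochainBilin_tmul_one, map_add,
      (hodgeProj_ofBilin_symm fun a b => mul_comm a b).1, (hodgeProj_ofBilin_skew hp.skew).1,
      add_zero, bilinExt_tmul, mul_one]
    rfl

lemma cochainBilin_structureCochain_two (hp : IsPoissonBracket (LinearMap.mul k A) p) :
    cochainBilin B 2 (structureCochain B p) = bilinExt B p :=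
  bilin_ext_one fun a b => by
    rw [structureCochain, cochainBilin_tmul_one, map_add,
      (hodgeProj_ofBilin_symm fun a b => mul_comm a b).2, (hodgeProj_ofBilin_skew hp.skew).2,
      zero_add, bilinExt_tmul, mul_one]
    rfl

lemma deformedMul_incl (hp : IsPoissonBracket (LinearMap.mul k A) p) (X : B ⊗[k] Cochain k A 2) :
    deformedMul B (inclTwo.lTensor B X) = cochainBilin B 1 (structureCochain B p + X) := by
  rw [deformedMul, weightBilin_incl, map_add, cochainBilin_structureCochain_one B hp]

lemma deformedBracket_incl (hp : IsPoissonBracket (LinearMap.mul k A) p)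
    (X : B ⊗[k] Cochain k A 2) :
    deformedBracket p B (inclTwo.lTensor B X) = cochainBilin B 2 (structureCochain B p + X) := by
  rw [deformedBracket, weightBilin_incl, map_add, cochainBilin_structureCochain_two B hp]

omit [CharZero k] in
variable {B} in
/-- A commutative and associative product on `B ⊗ A` that lifts the product of `A` has a unit: the
multiplication by `1 ⊗ 1` is invertible. -/
lemma exists_unit_of_lift {m : B ⊗[k] A →ₗ[B] B ⊗[k] A →ₗ[B] B ⊗[k] A}
    (hcomm : ∀ a b, m a b = m b a) (hassoc : ∀ a b c, m (m a b) c = m a (m b c))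
    (hm : ∀ v w, m v w - bilinExt B (LinearMap.mul k A) v w ∈ maxTensor A B) :
    ∃ e, ∀ a, m e a = a := by
  have h1 (v : B ⊗[k] A) : bilinExt B (LinearMap.mul k A) (1 ⊗ₜ 1) v = v := by
    refine LinearMap.congr_fun (g := LinearMap.id) (linearMap_ext_one fun a => ?_) v
    rw [bilinExt_tmul]
    simp
  have hL : IsUnit (m (1 ⊗ₜ 1) : Module.End B (B ⊗[k] A)) :=
    isUnit_of_forall_sub_mem_smul_top B.isNilpotent_maximalIdeal fun v => by
      have := hm (1 ⊗ₜ 1) v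
      rwa [h1] at this
  have hs := ((Module.End.isUnit_iff _).1 hL).2
  obtain ⟨e, he⟩ := hs (1 ⊗ₜ 1)
  -- `e` with `1 e = 1` is a unit on all multiples of `1`
  refine ⟨e, fun a => ?_⟩
  obtain ⟨a, rfl⟩ := hs a
  rw [← hassoc, hcomm e, he]

variable {B} in
/-- The products attached to a Maurer–Cartan element form a Poisson product lifting that
of `A`. -/
lemma isPoissonLift_of_mc (hp : IsPoissonBracket (LinearMap.mul k A) p)
    (x : (poissonDGLA p).MC B) : IsPoissonLift p B (deformedMul B x.1) (deformedBracket p B x.1) := by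
  obtain ⟨x, hx, hmc⟩ := x
  obtain ⟨X, hX, rfl⟩ := (mem_grMax_one_iff B p x).1 hx
  rw [maurerCartan_iff B hp, hodgeBracketTwo_self_eq_zero_iff] at hmc
  obtain ⟨h1, h2, h3⟩ := hmc
  have hm (v w : B ⊗[k] A) : cochainBilin B 1 (structureCochain B p + X) v w -
      bilinExt B (LinearMap.mul k A) v w ∈ maxTensor A B := by
    rw [map_add, cochainBilin_structureCochain_one B hp]
    simpa using cochainBilin_mem_maxTensor B 1 hX v w
  have hb (v w : B ⊗[k] A) : cochainBilin B 2 (structureCochain B p + X) v w -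
      bilinExt B p v w ∈ maxTensor A B := by
    rw [map_add, cochainBilin_structureCochain_two B hp]
    simpa using cochainBilin_mem_maxTensor B 2 hX v w
  dsimp only
  rw [deformedMul_incl B hp, deformedBracket_incl B hp]
  exact ⟨⟨cochainBilin_one_symm B _, h1, exists_unit_of_lift (cochainBilin_one_symm B _) h1 hm⟩,
    ⟨cochainBilin_two_skew B _, h2, h3⟩, hm, hb⟩

variable {B} in
lemma deformed_injective (hp : IsPoissonBracket (LinearMap.mul k A) p) :
    Function.Injective (fun x : (poissonDGLA p).MC B =>
      (deformedMul B x.1, deformedBracket p B x.1)) := by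
  rintro ⟨x, hx, hmc⟩ ⟨y, hy, hmc'⟩ h
  obtain ⟨X, hX, rfl⟩ := (mem_grMax_one_iff B p x).1 hx
  obtain ⟨Y, hY, rfl⟩ := (mem_grMax_one_iff B p y).1 hy
  rw [Prod.mk.injEq] at h
  dsimp only at h
  rw [deformedMul_incl B hp, deformedBracket_incl B hp, deformedMul_incl B hp,
    deformedBracket_incl B hp] at h
  have := add_left_cancel (cochainBilin_injective B h.1 h.2)
  subst this
  rfl

variable {B} in
/-- A bilinear map on `B ⊗ A` with a symmetric and a skew-symmetric part and values in `m_B ⊗ A`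
comes from an element of `m_B ⊗ C²(A)`. -/
lemma exists_cochain_of_bilin {g h : B ⊗[k] A →ₗ[B] B ⊗[k] A →ₗ[B] B ⊗[k] A}
    (hg : ∀ v w, g v w = g w v) (hh : ∀ v w, h v w = -h w v)
    (hg' : ∀ v w, g v w ∈ maxTensor A B) (hh' : ∀ v w, h v w ∈ maxTensor A B) :
    ∃ X ∈ maxCochain k A B, cochainBilin B 1 X = g ∧ cochainBilin B 2 X = h := by
  -- the coordinates of `g` and `h` in a basis of `m_B` are bilinear maps on `A`
  obtain ⟨n, e, c, he, hc⟩ := exists_expansion (A := A) B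
  let F (f : B ⊗[k] A →ₗ[B] B ⊗[k] A →ₗ[B] B ⊗[k] A) (i : Fin n) : A →ₗ[k] A →ₗ[k] A :=
    LinearMap.mk₂ k (fun a b => c i (f (1 ⊗ₜ a) (1 ⊗ₜ b)))
      (fun a a' b => by rw [tmul_add, map_add, LinearMap.add_apply, map_add])
      (fun s a b => by
        rw [tmul_smul, LinearMap.map_smul_of_tower, LinearMap.smul_apply, map_smul])
      (fun a b b' => by rw [tmul_add, map_add, map_add])
      (fun s a b => by rw [tmul_smul, LinearMap.map_smul_of_tower, map_smul])
  have hFg (i : Fin n) : ∀ a b, F g i a b = F g i b a := fun a b =>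
    congrArg (c i) (hg (1 ⊗ₜ a) (1 ⊗ₜ b))
  have hFh (i : Fin n) : ∀ a b, F h i a b = -F h i b a := fun a b =>
    (congrArg (c i) (hh (1 ⊗ₜ a) (1 ⊗ₜ b))).trans (map_neg _ _)
  refine ⟨∑ i, e i ⊗ₜ (ofBilin (F g i) + ofBilin (F h i)),
    sum_mem fun i _ => ⟨(⟨e i, he i⟩ : B.maxIdeal) ⊗ₜ _, rfl⟩,
    bilin_ext_one fun a b => ?_, bilin_ext_one fun a b => ?_⟩
  · rw [hc _ (hg' (1 ⊗ₜ a) (1 ⊗ₜ b)), map_sum, LinearMap.sum_apply, LinearMap.sum_apply]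
    refine Finset.sum_congr rfl fun i _ => ?_
    rw [cochainBilin_tmul_one, map_add, (hodgeProj_ofBilin_symm (hFg i)).1,
      (hodgeProj_ofBilin_skew (hFh i)).1, add_zero]
    rfl
  · rw [hc _ (hh' (1 ⊗ₜ a) (1 ⊗ₜ b)), map_sum, LinearMap.sum_apply, LinearMap.sum_apply]
    refine Finset.sum_congr rfl fun i _ => ?_
    rw [cochainBilin_tmul_one, map_add, (hodgeProj_ofBilin_symm (hFg i)).2,
      (hodgeProj_ofBilin_skew (hFh i)).2, zero_add]
    rfl

omit [CharZero k] in
lemma bilinExt_symm {f : A →ₗ[k] A →ₗ[k] A} (hf : ∀ a b, f a b = f b a) (v w : B ⊗[k] A) :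
    bilinExt B f v w = bilinExt B f w v := by
  refine LinearMap.congr_fun₂ (?_ : bilinExt B f = (bilinExt B f).flip) v w
  refine bilin_ext_one fun a b => ?_
  rw [LinearMap.flip_apply, bilinExt_tmul, bilinExt_tmul, hf]

omit [CharZero k] in
lemma bilinExt_skew {f : A →ₗ[k] A →ₗ[k] A} (hf : ∀ a b, f a b = -f b a) (v w : B ⊗[k] A) :
    bilinExt B f v w = -bilinExt B f w v := by
  refine LinearMap.congr_fun₂ (?_ : bilinExt B f = -(bilinExt B f).flip) v w
  refine bilin_ext_one fun a b => ?_
  rw [LinearMap.neg_apply, LinearMap.neg_apply, LinearMap.flip_apply, bilinExt_tmul, bilinExt_tmul,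
    hf, tmul_neg]

variable {B} in
/-- Every Poisson product lifting that of `A` comes from a Maurer–Cartan element, whose components are
the differences of the products and the bilinear extensions of `μ` and `μ_p`. -/
lemma exists_mc_of_isPoissonLift (hp : IsPoissonBracket (LinearMap.mul k A) p)
    {m q : B ⊗[k] A →ₗ[B] B ⊗[k] A →ₗ[B] B ⊗[k] A} (h : IsPoissonLift p B m q) :
    ∃ x : (poissonDGLA p).MC B, deformedMul B x.1 = m ∧ deformedBracket p B x.1 = q := by
  obtain ⟨X, hX, h1, h2⟩ := exists_cochain_of_bilin (g := m - bilinExt B (LinearMap.mul k A))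
    (h := q - bilinExt B p)
    (fun v w => by
      simp only [LinearMap.sub_apply]
      rw [h.isCommProduct.comm v w, bilinExt_symm B (fun a b => mul_comm a b) v w])
    (fun v w => by
      simp only [LinearMap.sub_apply]
      rw [h.isPoissonBracket.skew v w, bilinExt_skew B hp.skew v w]
      abel)
    h.mul_sub_mem h.bracket_sub_mem
  have e1 : cochainBilin B 1 (structureCochain B p + X) = m := by
    rw [map_add, cochainBilin_structureCochain_one B hp, h1]
    exact LinearMap.ext₂ fun v w => add_sub_cancel (bilinExt B (LinearMap.mul k A) v w) (m v w)
  have e2 : cochainBilin B 2 (structureCochain B p + X) = q := by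
    rw [map_add, cochainBilin_structureCochain_two B hp, h2]
    exact LinearMap.ext₂ fun v w => add_sub_cancel (bilinExt B p v w) (q v w)
  refine ⟨⟨inclTwo.lTensor B X, (mem_grMax_one_iff B p _).2 ⟨X, hX, rfl⟩, ?_⟩, ?_, ?_⟩
  · rw [maurerCartan_iff B hp, hodgeBracketTwo_self_eq_zero_iff, e1, e2]
    exact ⟨h.isCommProduct.assoc, h.isPoissonBracket.leibniz, h.isPoissonBracket.jacobi⟩
  · exact (deformedMul_incl B hp X).trans e1
  · exact (deformedBracket_incl B hp X).trans e2

lemma range_deformed (hp : IsPoissonBracket (LinearMap.mul k A) p) :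
    Set.range (fun x : (poissonDGLA p).MC B => (deformedMul B x.1, deformedBracket p B x.1)) =
      {q | IsPoissonLift p B q.1 q.2} := by
  ext ⟨m, q⟩
  constructor
  · rintro ⟨x, hx⟩
    rw [Prod.mk.injEq] at hx
    rw [← hx.1, ← hx.2]
    exact isPoissonLift_of_mc hp x
  · intro h
    obtain ⟨x, rfl, rfl⟩ := exists_mc_of_isPoissonLift hp h
    exact ⟨x, rfl⟩

end PoissonLift

/-! ### Exponentials of nilpotent endomorphisms -/

section Exponential

/-- The exponential series, split after the linear term. -/
lemma exists_exp_eq_one_add_add {R : Type*} [CommRing R] [Algebra ℚ R] {a : R}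
    (ha : IsNilpotent a) : ∃ s, IsNilpotent.exp a = 1 + a + a ^ 2 * s := by
  obtain ⟨n, hn⟩ := ha
  refine ⟨∑ i ∈ Finset.range n, ((i + 2).factorial : ℚ)⁻¹ • a ^ i, ?_⟩
  have hn' : a ^ (n + 1 + 1) = 0 := by rw [pow_succ, pow_succ, hn, zero_mul, zero_mul]
  rw [IsNilpotent.exp_eq_sum hn', Finset.sum_range_succ', Finset.sum_range_succ', Finset.mul_sum]
  simp only [mul_smul_comm, ← pow_add, add_comm 2, add_assoc, Nat.reduceAdd, zero_add,
    Nat.factorial_one, Nat.factorial_zero, Nat.cast_one, inv_one, one_smul, pow_one, pow_zero]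
  abel

/-- In a commutative ring, `1 + u` with `u` nilpotent is the exponential of a multiple of `u`, up to
any given power of `u`: the error is removed degree by degree. -/
lemma exists_exp_eq_one_add_mod {R : Type*} [CommRing R] [Algebra ℚ R] {u : R}
    (hu : IsNilpotent u) (r : ℕ) :
    ∃ z w, IsNilpotent.exp (u * z) = 1 + u + u ^ (r + 1) * w := by
  induction r with
  | zero => exact ⟨0, -1, by simp⟩
  | succ r ih =>
    obtain ⟨z, w, h⟩ := ih
    have hz : IsNilpotent (u * z) := (Commute.all u z).isNilpotent_mul_right hu
    have ha : IsNilpotent (-(u ^ (r + 1) * w)) :=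
      ((Commute.all _ w).isNilpotent_mul_right (hu.pow_of_pos (Nat.succ_ne_zero r))).neg
    obtain ⟨s, hs⟩ := exists_exp_eq_one_add_add ha
    -- the exponent is corrected by the leading term of the error
    refine ⟨z - u ^ r * w,
      -w - u ^ r * w ^ 2 + (1 + u + u ^ (r + 1) * w) * (u ^ r * w ^ 2 * s), ?_⟩
    rw [show u * (z - u ^ r * w) = u * z + -(u ^ (r + 1) * w) by ring,
      IsNilpotent.exp_add_of_commute (Commute.all _ _) hz ha, h, hs]
    ring

/-- A unipotent element `1 + u` of a `ℚ`-algebra is an exponential of a nilpotent multiple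
of `u`. -/
lemma exists_exp_eq_one_add {E : Type*} [Ring E] [Module ℚ E] {u : E} (hu : IsNilpotent u) :
    ∃ z : E, IsNilpotent (u * z) ∧ IsNilpotent.exp (u * z) = 1 + u := by
  let : Algebra ℚ E := Algebra.ofModule smul_mul_assoc mul_smul_comm
  -- the subalgebra generated by `u` is commutative
  let S := Algebra.adjoin ℚ {u}
  have : IsMulCommutative S := Algebra.isMulCommutative_adjoin ℚ (by simp)
  let u' : S := ⟨u, Algebra.subset_adjoin (Set.mem_singleton u)⟩
  have hu' : IsNilpotent u' := by
    obtain ⟨n, hn⟩ := hu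
    exact ⟨n, Subtype.ext hn⟩
  obtain ⟨n, hn⟩ := hu'
  obtain ⟨z, w, h⟩ := exists_exp_eq_one_add_mod ⟨n, hn⟩ n
  rw [pow_succ, hn, zero_mul, zero_mul, add_zero] at h
  have hz : IsNilpotent (u' * z) := (Commute.all u' z).isNilpotent_mul_right ⟨n, hn⟩
  refine ⟨z, hz.map S.val, ?_⟩
  have := hz.map_exp S.val
  rw [h] at this
  exact this.symm

variable {R V : Type*} [CommRing R] [AddCommGroup V] [Module R V]

lemma exp_apply_eq_sum {W : Type*} [AddCommGroup W] [Module R W] [Module ℚ W]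
    {a : Module.End R W} (ha : IsNilpotent a) {m : W} {N : ℕ} (h : (a ^ N) m = 0) :
    IsNilpotent.exp a m = ∑ n ∈ Finset.range N, (n.factorial : ℚ)⁻¹ • (a ^ n) m :=
  IsNilpotent.exp_smul_eq_sum (A := Module.End R W) (M := W) h ha

/-- The action `Y ↦ D ∘ Y` of an endomorphism on bilinear maps. -/
def postComp (D : Module.End R V) : Module.End R (V →ₗ[R] V →ₗ[R] V) where
  toFun Y := Y.compr₂ D
  map_add' _ _ := LinearMap.ext₂ fun _ _ => map_add D _ _
  map_smul' _ _ := LinearMap.ext₂ fun _ _ => map_smul D _ _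

/-- The action `Y ↦ Y(D ·, ·)` of an endomorphism on bilinear maps. -/
def preComp₁ (D : Module.End R V) : Module.End R (V →ₗ[R] V →ₗ[R] V) where
  toFun Y := Y ∘ₗ D
  map_add' _ _ := rfl
  map_smul' _ _ := rfl

/-- The action `Y ↦ Y(·, D ·)` of an endomorphism on bilinear maps. -/
def preComp₂ (D : Module.End R V) : Module.End R (V →ₗ[R] V →ₗ[R] V) where
  toFun Y := Y.compl₂ D
  map_add' _ _ := rfl
  map_smul' _ _ := rfl

/-- The action `Y ↦ D ∘ Y - Y(D ·, ·) - Y(·, D ·)` of an endomorphism `D` on bilinear maps. -/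
def bilinAction (D : Module.End R V) : Module.End R (V →ₗ[R] V →ₗ[R] V) :=
  postComp D - (preComp₁ D + preComp₂ D)

lemma bilinAction_apply (D : Module.End R V) (Y : V →ₗ[R] V →ₗ[R] V) (v w : V) :
    bilinAction D Y v w = D (Y v w) - (Y (D v) w + Y v (D w)) := rfl

lemma postComp_pow_apply (D : Module.End R V) (n : ℕ) (Y : V →ₗ[R] V →ₗ[R] V) (v w : V) :
    (postComp D ^ n) Y v w = (D ^ n) (Y v w) := by
  induction n generalizing Y with
  | zero => rfl
  | succ n ih => rw [pow_succ, pow_succ, Module.End.mul_apply, ih]; rfl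

lemma preComp₁_pow_apply (D : Module.End R V) (n : ℕ) (Y : V →ₗ[R] V →ₗ[R] V) (v w : V) :
    (preComp₁ D ^ n) Y v w = Y ((D ^ n) v) w := by
  induction n generalizing Y with
  | zero => rfl
  | succ n ih => rw [pow_succ, pow_succ', Module.End.mul_apply, ih]; rfl

lemma preComp₂_pow_apply (D : Module.End R V) (n : ℕ) (Y : V →ₗ[R] V →ₗ[R] V) (v w : V) :
    (preComp₂ D ^ n) Y v w = Y v ((D ^ n) w) := by
  induction n generalizing Y with
  | zero => rfl
  | succ n ih => rw [pow_succ, pow_succ', Module.End.mul_apply, ih]; rfl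

lemma commute_postComp_preComp₁ (D D' : Module.End R V) :
    Commute (postComp D) (preComp₁ D') := rfl

lemma commute_postComp_preComp₂ (D D' : Module.End R V) :
    Commute (postComp D) (preComp₂ D') := rfl

lemma commute_preComp₁_preComp₂ (D D' : Module.End R V) :
    Commute (preComp₁ D) (preComp₂ D') := rfl

variable {D : Module.End R V}

lemma isNilpotent_postComp (hD : IsNilpotent D) : IsNilpotent (postComp D) := by
  obtain ⟨n, hn⟩ := hD
  exact ⟨n, LinearMap.ext fun Y => LinearMap.ext₂ fun v w => by
    rw [postComp_pow_apply, hn]; rfl⟩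

lemma isNilpotent_preComp₁ (hD : IsNilpotent D) : IsNilpotent (preComp₁ D) := by
  obtain ⟨n, hn⟩ := hD
  exact ⟨n, LinearMap.ext fun Y => LinearMap.ext₂ fun v w => by
    rw [preComp₁_pow_apply, hn, LinearMap.zero_apply, map_zero]; rfl⟩

lemma isNilpotent_preComp₂ (hD : IsNilpotent D) : IsNilpotent (preComp₂ D) := by
  obtain ⟨n, hn⟩ := hD
  exact ⟨n, LinearMap.ext fun Y => LinearMap.ext₂ fun v w => by
    rw [preComp₂_pow_apply, hn, LinearMap.zero_apply, map_zero]; rfl⟩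

lemma isNilpotent_preComp_add (hD : IsNilpotent D) :
    IsNilpotent (preComp₁ D + preComp₂ D) :=
  (commute_preComp₁_preComp₂ D D).isNilpotent_add (isNilpotent_preComp₁ hD)
    (isNilpotent_preComp₂ hD)

lemma commute_postComp_preComp_add (D : Module.End R V) :
    Commute (postComp D) (preComp₁ D + preComp₂ D) :=
  (commute_postComp_preComp₁ D D).add_right (commute_postComp_preComp₂ D D)

lemma isNilpotent_bilinAction (hD : IsNilpotent D) : IsNilpotent (bilinAction D) := by
  rw [bilinAction]
  exact Commute.isNilpotent_sub (R := Module.End R (V →ₗ[R] V →ₗ[R] V))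
    (commute_postComp_preComp_add D) (isNilpotent_postComp hD)
    (isNilpotent_preComp_add hD)

variable [Module ℚ V]

lemma exp_postComp_apply (hD : IsNilpotent D) (Y : V →ₗ[R] V →ₗ[R] V) (v w : V) :
    IsNilpotent.exp (postComp D) Y v w = IsNilpotent.exp D (Y v w) := by
  obtain ⟨n, hn⟩ := hD
  have hn' : postComp D ^ n = 0 := LinearMap.ext fun Y => LinearMap.ext₂ fun v w => by
    rw [postComp_pow_apply, hn]; rfl
  rw [IsNilpotent.exp_eq_sum hn, IsNilpotent.exp_eq_sum hn']
  simp only [LinearMap.sum_apply, LinearMap.smul_apply, postComp_pow_apply]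

lemma exp_preComp₁_apply (hD : IsNilpotent D) (Y : V →ₗ[R] V →ₗ[R] V) (v w : V) :
    IsNilpotent.exp (preComp₁ D) Y v w = Y (IsNilpotent.exp D v) w := by
  obtain ⟨n, hn⟩ := hD
  have hn' : preComp₁ D ^ n = 0 := LinearMap.ext fun Y => LinearMap.ext₂ fun v w => by
    rw [preComp₁_pow_apply, hn, LinearMap.zero_apply, map_zero]; rfl
  rw [IsNilpotent.exp_eq_sum hn, IsNilpotent.exp_eq_sum hn']
  simp only [LinearMap.sum_apply, LinearMap.smul_apply, preComp₁_pow_apply, map_sum, map_rat_smul]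

lemma exp_preComp₂_apply (hD : IsNilpotent D) (Y : V →ₗ[R] V →ₗ[R] V) (v w : V) :
    IsNilpotent.exp (preComp₂ D) Y v w = Y v (IsNilpotent.exp D w) := by
  obtain ⟨n, hn⟩ := hD
  have hn' : preComp₂ D ^ n = 0 := LinearMap.ext fun Y => LinearMap.ext₂ fun v w => by
    rw [preComp₂_pow_apply, hn, LinearMap.zero_apply, map_zero]; rfl
  rw [IsNilpotent.exp_eq_sum hn, IsNilpotent.exp_eq_sum hn']
  simp only [LinearMap.sum_apply, LinearMap.smul_apply, preComp₂_pow_apply, map_sum, map_rat_smul]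

/-- The bilinear map `e^D (Y(e^{-D} ·, e^{-D} ·))` obtained from `Y` by transport along `e^D`,
expressed as the exponential of the action of `D`. -/
def expTransport (D : Module.End R V) (Y : V →ₗ[R] V →ₗ[R] V) : V →ₗ[R] V →ₗ[R] V :=
  IsNilpotent.exp (bilinAction D) Y

lemma expTransport_eq_sum (hD : IsNilpotent D) {Y : V →ₗ[R] V →ₗ[R] V} {N : ℕ}
    (hN : (bilinAction D ^ N) Y = 0) :
    expTransport D Y = ∑ n ∈ Finset.range N, (n.factorial : ℚ)⁻¹ • (bilinAction D ^ n) Y :=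
  exp_apply_eq_sum (isNilpotent_bilinAction hD) hN

/-- The transport of `Y` is transport along `e^D`: post- and precomposition commute, so that the
exponential of their combination is the product of the exponentials. -/
lemma expTransport_apply (hD : IsNilpotent D) (Y : V →ₗ[R] V →ₗ[R] V) (v w : V) :
    expTransport D Y (IsNilpotent.exp D v) (IsNilpotent.exp D w) =
      IsNilpotent.exp D (Y v w) := by
  have hc : Commute (preComp₁ D + preComp₂ D) (bilinAction D) := by
    rw [bilinAction]
    exact Commute.sub_right (R := Module.End R (V →ₗ[R] V →ₗ[R] V))
      (commute_postComp_preComp_add D).symm (Commute.refl _)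
  have e : preComp₁ D + preComp₂ D + bilinAction D = postComp D :=
    LinearMap.ext fun Y => LinearMap.ext₂ fun v w =>
      add_sub_cancel (Y (D v) w + Y v (D w)) (D (Y v w))
  have h : IsNilpotent.exp (postComp D) = IsNilpotent.exp (preComp₁ D) *
      IsNilpotent.exp (preComp₂ D) * IsNilpotent.exp (bilinAction D) := by
    rw [← IsNilpotent.exp_add_of_commute (commute_preComp₁_preComp₂ D D)
      (isNilpotent_preComp₁ hD) (isNilpotent_preComp₂ hD),
      ← IsNilpotent.exp_add_of_commute hc (isNilpotent_preComp_add hD)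
      (isNilpotent_bilinAction hD), e]
  rw [← exp_postComp_apply hD, h, Module.End.mul_apply, Module.End.mul_apply,
    exp_preComp₁_apply hD, exp_preComp₂_apply hD]
  rfl

/-- The transport of `Y` is the only bilinear map to which `e^D` carries `Y`. -/
lemma eq_expTransport (hD : IsNilpotent D) {Y Z : V →ₗ[R] V →ₗ[R] V}
    (h : ∀ v w, Z (IsNilpotent.exp D v) (IsNilpotent.exp D w) = IsNilpotent.exp D (Y v w)) :
    Z = expTransport D Y := by
  have hs := ((Module.End.isUnit_iff _).1 (IsNilpotent.isUnit_exp hD)).2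
  refine LinearMap.ext₂ fun v w => ?_
  obtain ⟨v, rfl⟩ := hs v
  obtain ⟨w, rfl⟩ := hs w
  rw [h, expTransport_apply hD]

/-- An endomorphism `φ` with `φ ≡ 1` modulo a nilpotent ideal is `e^D` for some `D ≡ 0` modulo that
ideal. -/
lemma exists_exp_eq {I : Ideal R} (hI : IsNilpotent I) {φ : Module.End R V}
    (hφ : ∀ v, φ v - v ∈ I • (⊤ : Submodule R V)) :
    ∃ D : Module.End R V, (∀ v, D v ∈ I • (⊤ : Submodule R V)) ∧ IsNilpotent.exp D = φ := by
  obtain ⟨z, hz, hz'⟩ := exists_exp_eq_one_add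
    (isNilpotent_of_forall_mem_smul_top hI (f := φ - 1) hφ)
  exact ⟨(φ - 1) * z, fun v => hφ (z v), hz'.trans (LinearMap.ext fun v => add_sub_cancel v (φ v))⟩

/-- The exponential of `D ≡ 0` modulo an ideal is the identity modulo that ideal. -/
lemma exp_sub_mem {I : Ideal R} (hI : IsNilpotent I) {D : Module.End R V}
    (hD : ∀ v, D v ∈ I • (⊤ : Submodule R V)) (v : V) :
    IsNilpotent.exp D v - v ∈ I • (⊤ : Submodule R V) := by
  obtain ⟨n, hn⟩ := isNilpotent_of_forall_mem_smul_top hI hD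
  have hn' : D ^ (n + 1) = 0 := by rw [pow_succ, hn, zero_mul]
  rw [IsNilpotent.exp_eq_sum hn', Finset.sum_range_succ']
  simp only [pow_zero, Nat.factorial_zero, Nat.cast_one, inv_one, one_smul, LinearMap.add_apply,
    Module.End.one_apply, add_sub_cancel_right, LinearMap.sum_apply]
  refine sum_mem fun i _ => ?_
  rw [LinearMap.smul_apply, pow_succ', Module.End.mul_apply,
    ← map_rat_smul D]
  exact hD _

end Exponential

/-! ### The gauge action -/

section Gauge

variable {k : Type u} [Field k] {A : Type u} [CommRing A] [Algebra k A] (B : ArtAlg k)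

/-- A cochain of arity one as a linear map. -/
def toLinear : Cochain k A 1 →ₗ[k] A →ₗ[k] A where
  toFun f :=
    { toFun := fun a => f ![a]
      map_add' := fun a b => f.cons_add ![] a b
      map_smul' := fun c a => f.cons_smul ![] c a }
  map_add' _ _ := rfl
  map_smul' _ _ := rfl

/-- A linear map as a cochain of arity one. -/
def ofLinear (f : A →ₗ[k] A) : Cochain k A 1 :=
  MultilinearMap.mk' (fun a => f (a 0))
    (fun a i x y => by fin_cases i; simp)
    (fun a i c x => by fin_cases i; simp)

/-- The `B`-linear endomorphism of `B ⊗ A` given by an element of `B ⊗ C¹(A)`. -/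
def cochainOp : B ⊗[k] Cochain k A 1 →ₗ[B] Module.End B (B ⊗[k] A) :=
  LinearMap.liftBaseChange B (LinearMap.baseChangeHom k B A A ∘ₗ toLinear)

lemma cochainOp_tmul (b : B) (f : Cochain k A 1) (c : B) (x : A) :
    cochainOp B (b ⊗ₜ f) (c ⊗ₜ x) = (b * c) ⊗ₜ f ![x] := by
  rw [cochainOp, LinearMap.liftBaseChange_tmul, LinearMap.smul_apply]
  change b • (c ⊗ₜ[k] f ![x]) = _
  rw [smul_tmul', smul_eq_mul]

variable (k A) in
/-- The subspace `m_B ⊗ C¹(A)` of `B ⊗ C¹(A)`. -/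
def maxCochainOne : Submodule k (B ⊗[k] Cochain k A 1) :=
  LinearMap.range (B.maxIdeal.subtype.rTensor (Cochain k A 1))

lemma cochainOp_mem_maxTensor {β : B ⊗[k] Cochain k A 1} (hβ : β ∈ maxCochainOne k A B)
    (v : B ⊗[k] A) : cochainOp B β v ∈ maxTensor A B := by
  obtain ⟨t, rfl⟩ := hβ
  induction t with
  | zero => simp
  | add s t hs ht =>
    rw [map_add, map_add, LinearMap.add_apply]
    exact add_mem hs ht
  | tmul b f =>
    rw [LinearMap.rTensor_tmul, cochainOp, LinearMap.liftBaseChange_tmul, LinearMap.smul_apply]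
    exact smul_mem_maxTensor B b.2 _

variable {B} in
/-- Every endomorphism of `B ⊗ A` with values in `m_B ⊗ A` is given by an element of
`m_B ⊗ C¹(A)`. -/
lemma exists_cochain_of_linear {D : Module.End B (B ⊗[k] A)} (hD : ∀ v, D v ∈ maxTensor A B) :
    ∃ β ∈ maxCochainOne k A B, cochainOp B β = D := by
  obtain ⟨n, e, c, he, hc⟩ := exists_expansion (A := A) B
  let F (i : Fin n) : A →ₗ[k] A :=
    { toFun := fun a => c i (D (1 ⊗ₜ a))
      map_add' := fun a b => by rw [tmul_add, map_add, map_add]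
      map_smul' := fun s a => by
        rw [tmul_smul, LinearMap.map_smul_of_tower, map_smul, RingHom.id_apply] }
  refine ⟨∑ i, e i ⊗ₜ ofLinear (F i),
    sum_mem fun i _ => ⟨(⟨e i, he i⟩ : B.maxIdeal) ⊗ₜ _, rfl⟩, linearMap_ext_one fun a => ?_⟩
  rw [hc _ (hD (1 ⊗ₜ a)), map_sum, LinearMap.sum_apply]
  refine Finset.sum_congr rfl fun i _ => ?_
  rw [cochainOp_tmul, mul_one]
  rfl

/-- The inclusion `C¹(A) → ⨁ₙ Cⁿ(A)`. -/
abbrev inclOne : Cochain k A 1 →ₗ[k] TotalCochain k A :=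
  DirectSum.lof k ℕ (fun n => Cochain k A (n + 1)) 0

lemma mem_grMax_zero_iff (p : A →ₗ[k] A →ₗ[k] A) (x : B ⊗[k] TotalCochain k A) :
    x ∈ (poissonDGLA p).grMax B 0 ↔ ∃ β ∈ maxCochainOne k A B, inclOne.lTensor B β = x := by
  constructor
  · rintro ⟨t, rfl⟩
    induction t with
    | zero => exact ⟨0, zero_mem _, (map_zero _).trans (map_zero _).symm⟩
    | add s t hs ht =>
      obtain ⟨X, hX, hX'⟩ := hs
      obtain ⟨Y, hY, hY'⟩ := ht
      exact ⟨X + Y, add_mem hX hY, by rw [map_add, map_add, hX', hY']; rfl⟩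
    | tmul b f =>
      obtain ⟨f, g, rfl⟩ := f
      exact ⟨(b : B) ⊗ₜ g, ⟨b ⊗ₜ g, rfl⟩, rfl⟩
  · rintro ⟨_, ⟨t, rfl⟩, rfl⟩
    induction t with
    | zero => rw [map_zero, map_zero]; exact zero_mem _
    | add s t hs ht => rw [map_add, map_add]; exact add_mem hs ht
    | tmul b f =>
      let f' : (poissonDGLA (A := A) p).gr 0 := ⟨inclOne f, f, rfl⟩
      exact ⟨b ⊗ₜ f', rfl⟩

/-- The `B`-bilinear extension of the bracket `C¹(A) × C²(A) → C²(A)`. -/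
def hodgeBracketOneTwo :
    B ⊗[k] Cochain k A 1 →ₗ[B] B ⊗[k] Cochain k A 2 →ₗ[B] B ⊗[k] Cochain k A 2 :=
  LinearMap.liftBaseChange B (LinearMap.baseChangeHom k B (Cochain k A 2) (Cochain k A 2) ∘ₗ
    hodgeBracket (m := 0) (n := 1))

lemma hodgeBracketOneTwo_tmul (b c : B) (f : Cochain k A 1) (g : Cochain k A 2) :
    hodgeBracketOneTwo B (b ⊗ₜ f) (c ⊗ₜ g) = (b * c) ⊗ₜ (hodgeBracket f g : Cochain k A 2) := by
  rw [hodgeBracketOneTwo, LinearMap.liftBaseChange_tmul, LinearMap.smul_apply]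
  change b • (c ⊗ₜ[k] (hodgeBracket f g : Cochain k A 2)) = _
  rw [smul_tmul', smul_eq_mul]

lemma totalBracket_inclOne_inclTwo (f : Cochain k A 1) (g : Cochain k A 2) :
    totalBracket (inclOne f) (inclTwo g) = inclTwo (hodgeBracket f g : Cochain k A 2) :=
  totalBracket_lof f g

variable [CharZero k]

/-- The bracket with an element of `C¹(A)` preserves the weights in `C²(A)`. -/
lemma hodgeBracket_one_arity (f : Cochain k A 1) (g : Cochain k A 2) :
    (hodgeBracket f g : Cochain k A 2) = gerstenhaber f g ∧
    hodgeProj k A 2 1 (hodgeBracket f g : Cochain k A 2) = gerstenhaber f (hodgeProj k A 2 1 g) ∧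
    hodgeProj k A 2 2 (hodgeBracket f g : Cochain k A 2) =
      gerstenhaber f (hodgeProj k A 2 2 g) := by
  have hf := hasWeight_one_of_arity_one f
  have h1 : HasWeight 1 (gerstenhaber f (hodgeProj k A 2 1 g) : Cochain k A 2) := by
    have := hasWeight_two_one_iff.1 (hasWeight_hodgeProj_two_one g)
    refine hasWeight_two_one_iff.2 fun a b => ?_
    rw [gerstenhaber_one_two, gerstenhaber_one_two, this b a, this (f ![b]), this b, add_comm]
  have h2 : HasWeight 2 (gerstenhaber f (hodgeProj k A 2 2 g) : Cochain k A 2) := by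
    have := hasWeight_two_two_iff.1 (hasWeight_hodgeProj_two_two g)
    refine hasWeight_two_two_iff.2 fun a b => ?_
    rw [gerstenhaber_one_two, gerstenhaber_one_two, this b a, this (f ![b]), this b (f ![a]),
      show f ![-hodgeProj k A 2 2 g ![a, b]] = -f ![hodgeProj k A 2 2 g ![a, b]] from
        map_neg (toLinear f) _]
    abel
  have e1 : (hodgeBracket f (hodgeProj k A 2 1 g) : Cochain k A 2) =
      gerstenhaber f (hodgeProj k A 2 1 g) := by
    refine (hf.hodgeBracket (hasWeight_hodgeProj_two_one g)).trans ?_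
    exact h1.hodgeProj.trans (if_pos rfl)
  have e2 : (hodgeBracket f (hodgeProj k A 2 2 g) : Cochain k A 2) =
      gerstenhaber f (hodgeProj k A 2 2 g) := by
    refine (hf.hodgeBracket (hasWeight_hodgeProj_two_two g)).trans ?_
    exact h2.hodgeProj.trans (if_pos rfl)
  have e : (hodgeBracket f g : Cochain k A 2) =
      gerstenhaber f (hodgeProj k A 2 1 g) + gerstenhaber f (hodgeProj k A 2 2 g) := by
    conv_lhs => rw [← hodgeProj_two_add g, map_add]
    rw [e1, e2]
  refine ⟨?_, ?_, ?_⟩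
  · rw [e]
    conv_rhs => rw [← hodgeProj_two_add g, map_add]
  · rw [e, map_add, h1.hodgeProj, h2.hodgeProj]
    simp
  · rw [e, map_add, h1.hodgeProj, h2.hodgeProj]
    simp

omit [CharZero k] in
lemma bilinAction_add_left {R V : Type*} [CommRing R] [AddCommGroup V] [Module R V]
    (D D' : Module.End R V) (Y : V →ₗ[R] V →ₗ[R] V) :
    bilinAction (D + D') Y = bilinAction D Y + bilinAction D' Y :=
  LinearMap.ext₂ fun v w => by
    simp only [bilinAction_apply, LinearMap.add_apply, map_add]
    abel

omit [CharZero k] in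
lemma bilinAction_zero_left {R V : Type*} [CommRing R] [AddCommGroup V] [Module R V]
    (Y : V →ₗ[R] V →ₗ[R] V) : bilinAction (0 : Module.End R V) Y = 0 :=
  LinearMap.ext₂ fun v w => by simp [bilinAction_apply]

/-- On the bilinear maps attached to its weight components, the bracket with an element of
`B ⊗ C¹(A)` is the action of the corresponding endomorphism. -/
lemma cochainBilin_hodgeBracketOneTwo {i : ℕ} (hi : i = 1 ∨ i = 2) (β : B ⊗[k] Cochain k A 1)
    (Y : B ⊗[k] Cochain k A 2) :
    cochainBilin B i (hodgeBracketOneTwo B β Y) =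
      bilinAction (cochainOp B β) (cochainBilin B i Y) := by
  induction β with
  | zero => rw [map_zero, LinearMap.zero_apply, map_zero, map_zero, bilinAction_zero_left]
  | add x y hx hy =>
    rw [map_add, LinearMap.add_apply, map_add, hx, hy, map_add, bilinAction_add_left]
  | tmul b f =>
  induction Y with
  | zero => rw [map_zero, map_zero, map_zero]
  | add x y hx hy => rw [map_add, map_add, hx, hy, map_add, map_add]
  | tmul c g =>
    refine bilin_ext_one fun x y => ?_
    have h : hodgeProj k A 2 i (hodgeBracket f g : Cochain k A 2) =
        gerstenhaber f (hodgeProj k A 2 i g) := by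
      obtain rfl | rfl := hi
      exacts [(hodgeBracket_one_arity f g).2.1, (hodgeBracket_one_arity f g).2.2]
    rw [hodgeBracketOneTwo_tmul, cochainBilin_tmul_one, h, gerstenhaber_one_two, bilinAction_apply,
      cochainOp_tmul, cochainOp_tmul, cochainBilin_tmul_one, cochainOp_tmul, cochainBilin_tmul,
      cochainBilin_tmul]
    simp only [mul_one, one_mul]
    rw [mul_comm c b, ← tmul_add, ← tmul_sub]

variable (p : A →ₗ[k] A →ₗ[k] A)

omit [CharZero k] in
lemma bracketExt_inclOne_inclTwo (β : B ⊗[k] Cochain k A 1) (Y : B ⊗[k] Cochain k A 2) :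
    (poissonDGLA p).bracketExt B (inclOne.lTensor B β) (inclTwo.lTensor B Y) =
      inclTwo.lTensor B (hodgeBracketOneTwo B β Y) := by
  change LinearMap.BilinMap.baseChange B totalBracket _ _ = _
  induction β with
  | zero => simp
  | add x y hx hy => simp only [map_add, LinearMap.add_apply, hx, hy]
  | tmul b f =>
  induction Y with
  | zero => simp
  | add x y hx hy => simp only [map_add, hx, hy]
  | tmul c g =>
    rw [hodgeBracketOneTwo_tmul, LinearMap.lTensor_tmul, LinearMap.lTensor_tmul,
      LinearMap.lTensor_tmul, LinearMap.BilinMap.baseChange_tmul, totalBracket_inclOne_inclTwo,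
      mul_comm]

lemma totalBracket_structureElement_inclOne (f : Cochain k A 1) :
    totalBracket (structureElement p) (inclOne f) =
      -inclTwo (hodgeBracket f (ofBilin (LinearMap.mul k A) + ofBilin p) : Cochain k A 2) := by
  rw [← totalBracket_inclOne_inclTwo]
  have := totalBracket_antisymm (k := k) (A := A) (i := 1) (j := 0) (x := structureElement p)
    (y := inclOne f) ⟨_, rfl⟩ ⟨_, rfl⟩
  rw [this, mul_zero, Int.negOnePow_zero, Units.val_one, one_smul]
  rfl

lemma dExt_inclOne (β : B ⊗[k] Cochain k A 1) :
    (poissonDGLA p).dExt B (inclOne.lTensor B β) =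
      -inclTwo.lTensor B (hodgeBracketOneTwo B β (structureCochain B p)) := by
  change (totalBracket (structureElement p)).baseChange B _ = _
  induction β with
  | zero => simp
  | add x y hx hy => simp only [map_add, LinearMap.add_apply, hx, hy, neg_add]
  | tmul b f =>
    rw [structureCochain, hodgeBracketOneTwo_tmul, LinearMap.lTensor_tmul, LinearMap.lTensor_tmul,
      mul_one, LinearMap.baseChange_tmul, totalBracket_structureElement_inclOne]
    exact tmul_neg _ _

/-- The infinitesimal gauge action on `x` is the bracket with `μ + μ_p + x`. -/
lemma gauge_term (β : B ⊗[k] Cochain k A 1) (X : B ⊗[k] Cochain k A 2) (n : ℕ) :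
    ((poissonDGLA p).bracketExt B (inclOne.lTensor B β) ^ n)
      ((poissonDGLA p).bracketExt B (inclOne.lTensor B β) (inclTwo.lTensor B X) -
        (poissonDGLA p).dExt B (inclOne.lTensor B β)) =
    inclTwo.lTensor B ((hodgeBracketOneTwo B β ^ (n + 1)) (structureCochain B p + X)) := by
  induction n with
  | zero =>
    rw [bracketExt_inclOne_inclTwo, dExt_inclOne, zero_add, pow_one, map_add, map_add, pow_zero,
      Module.End.one_apply]
    exact (sub_neg_eq_add _ _).trans (add_comm _ _)
  | succ n ih =>
    rw [pow_succ', Module.End.mul_apply, ih, bracketExt_inclOne_inclTwo, pow_succ' _ (n + 1),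
      Module.End.mul_apply]

end Gauge

/-! ### Gauge equivalence and isomorphism of Poisson products -/

section GaugeEquivalence

variable {k : Type u} [Field k] {A : Type u} [CommRing A] [Algebra k A] {B : ArtAlg k}

lemma inclTwo_lTensor_injective :
    Function.Injective (inclTwo.lTensor B : B ⊗[k] Cochain k A 2 →ₗ[k] _) := by
  refine Function.LeftInverse.injective
    (g := (DirectSum.component k ℕ (fun n => Cochain k A (n + 1)) 1).lTensor B) fun Y => ?_
  rw [← LinearMap.comp_apply, ← LinearMap.lTensor_comp]
  have h : DirectSum.component k ℕ (fun n => Cochain k A (n + 1)) 1 ∘ₗ inclTwo =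
      LinearMap.id := LinearMap.ext fun f =>
    DirectSum.component.lof_self k (M := fun n => Cochain k A (n + 1)) 1 f
  rw [h, LinearMap.lTensor_id, LinearMap.id_apply]

variable [CharZero k] {p : A →ₗ[k] A →ₗ[k] A}

/-- The gauge relation in terms of the structure `μ + μ_p + x`: it says that
`μ + μ_p + y = e^{[β, ·]} (μ + μ_p + x)`. -/
lemma gaugeRel_iff_exp {x y : (poissonDGLA p).MC B} {X X' : B ⊗[k] Cochain k A 2}
    (hx : inclTwo.lTensor B X = x.1) (hy : inclTwo.lTensor B X' = y.1) :
    (poissonDGLA p).GaugeRel B x y ↔ ∃ β ∈ maxCochainOne k A B, ∃ N : ℕ,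
      (hodgeBracketOneTwo B β ^ (N + 1)) (structureCochain B p + X) = 0 ∧
      structureCochain B p + X' = ∑ n ∈ Finset.range (N + 1), ((n.factorial : k)⁻¹) •
        (hodgeBracketOneTwo B β ^ n) (structureCochain B p + X) := by
  have key (β : B ⊗[k] Cochain k A 1) (N : ℕ) :
      (((poissonDGLA p).bracketExt B (inclOne.lTensor B β) ^ N)
        ((poissonDGLA p).bracketExt B (inclOne.lTensor B β) x.1 -
          (poissonDGLA p).dExt B (inclOne.lTensor B β)) = 0 ∧
      y.1 = x.1 + ∑ n ∈ Finset.range N, (((n + 1).factorial : k)⁻¹) •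
        ((poissonDGLA p).bracketExt B (inclOne.lTensor B β) ^ n)
        ((poissonDGLA p).bracketExt B (inclOne.lTensor B β) x.1 -
          (poissonDGLA p).dExt B (inclOne.lTensor B β))) ↔
      ((hodgeBracketOneTwo B β ^ (N + 1)) (structureCochain B p + X) = 0 ∧
      structureCochain B p + X' = ∑ n ∈ Finset.range (N + 1), ((n.factorial : k)⁻¹) •
        (hodgeBracketOneTwo B β ^ n) (structureCochain B p + X)) := by
    rw [← hx, ← hy]
    simp only [gauge_term]
    refine and_congr ?_ ?_
    · exact ⟨fun h => inclTwo_lTensor_injective (h.trans (map_zero _).symm),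
        fun h => (congrArg _ h).trans (map_zero _)⟩
    · have e : inclTwo.lTensor B X + ∑ n ∈ Finset.range N, (((n + 1).factorial : k)⁻¹) •
          inclTwo.lTensor B ((hodgeBracketOneTwo B β ^ (n + 1)) (structureCochain B p + X)) =
          inclTwo.lTensor B (X + ∑ n ∈ Finset.range N, (((n + 1).factorial : k)⁻¹) •
            (hodgeBracketOneTwo B β ^ (n + 1)) (structureCochain B p + X)) := by
        simp only [map_add, map_sum, map_smul]
      rw [Finset.sum_range_succ']
      simp only [pow_zero, Module.End.one_apply, Nat.factorial_zero, Nat.cast_one, inv_one,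
        one_smul]
      rw [add_comm _ (structureCochain B p + X), add_assoc, add_right_inj]
      exact ⟨fun h => inclTwo_lTensor_injective (h.trans e), fun h => (congrArg _ h).trans e.symm⟩
  constructor
  · rintro ⟨b, hb, N, h⟩
    obtain ⟨β, hβ, rfl⟩ := (mem_grMax_zero_iff B p b).1 hb
    exact ⟨β, hβ, N, (key β N).1 h⟩
  · rintro ⟨β, hβ, N, h⟩
    exact ⟨inclOne.lTensor B β, (mem_grMax_zero_iff B p _).2 ⟨β, hβ, rfl⟩, N, (key β N).2 h⟩

lemma cochainBilin_pow {i : ℕ} (hi : i = 1 ∨ i = 2) (β : B ⊗[k] Cochain k A 1)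
    (Y : B ⊗[k] Cochain k A 2) (n : ℕ) :
    cochainBilin B i ((hodgeBracketOneTwo B β ^ n) Y) =
      (bilinAction (cochainOp B β) ^ n) (cochainBilin B i Y) := by
  induction n with
  | zero => rfl
  | succ n ih => rw [pow_succ', pow_succ', Module.End.mul_apply, Module.End.mul_apply, ← ih,
      cochainBilin_hodgeBracketOneTwo B hi]

lemma cochainBilin_sum_pow [Module ℚ (B ⊗[k] A)] {i : ℕ} (hi : i = 1 ∨ i = 2)
    {β : B ⊗[k] Cochain k A 1} (hβ : IsNilpotent (cochainOp B β))
    {Y : B ⊗[k] Cochain k A 2} {N : ℕ}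
    (hN : (bilinAction (cochainOp B β) ^ N) (cochainBilin B i Y) = 0) :
    cochainBilin B i (∑ n ∈ Finset.range N, ((n.factorial : k)⁻¹) •
      (hodgeBracketOneTwo B β ^ n) Y) =
        expTransport (cochainOp B β) (cochainBilin B i Y) := by
  rw [map_sum]
  refine Eq.trans ?_ (expTransport_eq_sum hβ hN).symm
  refine Finset.sum_congr rfl fun n _ => ?_
  rw [LinearMap.map_smul_of_tower, cochainBilin_pow hi]
  exact inv_natCast_smul_eq k ℚ n.factorial _

/-- The gauge action of `β ∈ m_B ⊗ C¹(A)` on the attached Poisson products is the transport along the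
automorphism `e^β` of `B ⊗ A`, and all automorphisms that are the identity modulo `m_B` are of this
form. -/
lemma gaugeRel_iff_productsEquivalent (hp : IsPoissonBracket (LinearMap.mul k A) p)
    (x y : (poissonDGLA p).MC B) :
    (poissonDGLA p).GaugeRel B x y ↔ ProductsEquivalent B
      (deformedMul B x.1) (deformedBracket p B x.1)
      (deformedMul B y.1) (deformedBracket p B y.1) := by
  let _ : Module ℚ (B ⊗[k] A) := Module.compHom _ (algebraMap ℚ k)
  obtain ⟨X, -, hX⟩ := (mem_grMax_one_iff B p x.1).1 x.2.1
  obtain ⟨X', -, hX'⟩ := (mem_grMax_one_iff B p y.1).1 y.2.1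
  rw [gaugeRel_iff_exp hX hX', ← hX, ← hX', deformedMul_incl B hp, deformedBracket_incl B hp,
    deformedMul_incl B hp, deformedBracket_incl B hp]
  set Y := structureCochain B p + X
  set Y' := structureCochain B p + X'
  have hmax := B.isNilpotent_maximalIdeal
  constructor
  · rintro ⟨β, hβ, N, h0, h1⟩
    have hDmem := cochainOp_mem_maxTensor B hβ
    have hD : IsNilpotent (cochainOp B β) := isNilpotent_of_forall_mem_smul_top hmax hDmem
    have e (i : ℕ) (hi : i = 1 ∨ i = 2) : cochainBilin B i Y' =
        expTransport (cochainOp B β) (cochainBilin B i Y) := by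
      rw [h1, cochainBilin_sum_pow hi hD]
      rw [← cochainBilin_pow hi, h0, map_zero]
    let φ : B ⊗[k] A ≃ₗ[B] B ⊗[k] A := LinearEquiv.ofBijective
      (IsNilpotent.exp (cochainOp B β)) ((Module.End.isUnit_iff _).1 (IsNilpotent.isUnit_exp hD))
    have hφ (i : ℕ) (hi : i = 1 ∨ i = 2) (v w : B ⊗[k] A) :
        φ (cochainBilin B i Y v w) = cochainBilin B i Y' (φ v) (φ w) := by
      rw [e i hi]
      exact (expTransport_apply hD _ v w).symm
    exact ⟨φ, exp_sub_mem hmax hDmem, hφ 1 (.inl rfl), hφ 2 (.inr rfl)⟩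
  · rintro ⟨φ, hφ, h1, h2⟩
    obtain ⟨D, hDmem, hDφ⟩ := exists_exp_eq hmax (φ := φ.toLinearMap) hφ
    obtain ⟨β, hβ, rfl⟩ := exists_cochain_of_linear hDmem
    have hD : IsNilpotent (cochainOp B β) := isNilpotent_of_forall_mem_smul_top hmax hDmem
    obtain ⟨N, hN⟩ := isNilpotent_bilinAction hD
    have hN' : bilinAction (cochainOp B β) ^ (N + 1) = 0 := by rw [pow_succ, hN, zero_mul]
    have h1' : cochainBilin B 1 Y' =
        expTransport (cochainOp B β) (cochainBilin B 1 Y) :=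
      eq_expTransport hD fun v w => by
        rw [hDφ]
        exact (h1 v w).symm
    have h2' : cochainBilin B 2 Y' =
        expTransport (cochainOp B β) (cochainBilin B 2 Y) :=
      eq_expTransport hD fun v w => by
        rw [hDφ]
        exact (h2 v w).symm
    refine ⟨β, hβ, N, cochainBilin_injective B ?_ ?_, cochainBilin_injective B ?_ ?_⟩
    · rw [cochainBilin_pow (.inl rfl), hN', map_zero]; rfl
    · rw [cochainBilin_pow (.inr rfl), hN', map_zero]; rfl
    · rw [h1', cochainBilin_sum_pow (.inl rfl) hD (by rw [hN']; rfl)]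
    · rw [h2', cochainBilin_sum_pow (.inr rfl) hD (by rw [hN']; rfl)]

end GaugeEquivalence

/-! ### The fibre of `B ⊗ A` -/

section Reduction

variable {k : Type u} [Field k] {A : Type u} [CommRing A] [Algebra k A]

/-- The identification of `k` with the residue field of `B`. -/
def ArtAlg.residueEquiv (B : ArtAlg k) : k ≃ₐ[k] IsLocalRing.ResidueField B :=
  AlgEquiv.ofBijective (Algebra.ofId k _) B.residue_bijective

/-- The `k`-algebra homomorphism `B → k` with kernel `m_B`. -/
def ArtAlg.augmentation (B : ArtAlg k) : B →ₐ[k] k :=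
  (B.residueEquiv.symm : IsLocalRing.ResidueField B →ₐ[k] k).comp
    (IsScalarTower.toAlgHom k B (IsLocalRing.ResidueField B))

lemma ArtAlg.augmentation_eq_zero_iff (B : ArtAlg k) {b : B} :
    B.augmentation b = 0 ↔ b ∈ B.maxIdeal := by
  change B.residueEquiv.symm (IsLocalRing.residue B b) = 0 ↔
    b ∈ IsLocalRing.maximalIdeal (B : Type u)
  rw [map_eq_zero_iff _ B.residueEquiv.symm.injective, IsLocalRing.residue_eq_zero_iff]

lemma ArtAlg.sub_augmentation_mem (B : ArtAlg k) (b : B) :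
    b - algebraMap k B (B.augmentation b) ∈ B.maxIdeal := by
  rw [← B.augmentation_eq_zero_iff, map_sub, AlgHom.commutes]
  exact sub_self _

variable (B : ArtAlg k)

variable (A) in
/-- The reduction `B ⊗ A → A` modulo `m_B`. -/
def reduction : B ⊗[k] A →ₗ[k] A :=
  TensorProduct.lid k A ∘ₗ B.augmentation.toLinearMap.rTensor A

lemma reduction_tmul (b : B) (a : A) : reduction A B (b ⊗ₜ a) = B.augmentation b • a := rfl

@[simp] lemma reduction_one_tmul (a : A) : reduction A B (1 ⊗ₜ a) = a := by
  rw [reduction_tmul, map_one, one_smul]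

lemma reduction_smul (b : B) (v : B ⊗[k] A) :
    reduction A B (b • v) = B.augmentation b • reduction A B v := by
  induction v with
  | zero => simp
  | add x y hx hy => rw [smul_add, map_add, map_add, smul_add, hx, hy]
  | tmul c a => rw [smul_tmul', reduction_tmul, reduction_tmul, smul_eq_mul, map_mul, mul_smul]

lemma sub_reduction_mem (v : B ⊗[k] A) : v - 1 ⊗ₜ reduction A B v ∈ maxTensor A B := by
  induction v with
  | zero => simp
  | add x y hx hy =>
    rw [map_add, tmul_add, add_sub_add_comm]
    exact add_mem hx hy
  | tmul b a =>
    rw [reduction_tmul, tmul_smul, smul_tmul', ← sub_tmul, ← Algebra.algebraMap_eq_smul_one]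
    exact tmul_mem_maxTensor (B.sub_augmentation_mem b) a

lemma reduction_eq_zero_iff {v : B ⊗[k] A} : reduction A B v = 0 ↔ v ∈ maxTensor A B := by
  constructor
  · intro h
    have := sub_reduction_mem B v
    rwa [h, tmul_zero, sub_zero] at this
  · intro h
    refine Submodule.smul_induction_on h (fun b hb w _ => ?_) fun x y hx hy => by
      rw [map_add, hx, hy, add_zero]
    rw [reduction_smul, B.augmentation_eq_zero_iff.2 hb, zero_smul]

lemma sub_mem_maxTensor_iff {v w : B ⊗[k] A} :
    v - w ∈ maxTensor A B ↔ reduction A B v = reduction A B w := by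
  rw [← reduction_eq_zero_iff, map_sub, sub_eq_zero]

lemma reduction_bilinExt (f : A →ₗ[k] A →ₗ[k] A) (v w : B ⊗[k] A) :
    reduction A B (bilinExt B f v w) = f (reduction A B v) (reduction A B w) := by
  induction v with
  | zero => simp
  | add x y hx hy => simp only [map_add, LinearMap.add_apply, hx, hy]
  | tmul b x =>
  induction w with
  | zero => simp
  | add x y hx hy => simp only [map_add, hx, hy]
  | tmul c y =>
    rw [bilinExt_tmul, reduction_tmul, reduction_tmul, reduction_tmul, map_mul, map_smul, map_smul,
      LinearMap.smul_apply, smul_smul, mul_comm]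

lemma residueEquiv_augmentation (b : B) :
    B.residueEquiv (B.augmentation b) = algebraMap B (IsLocalRing.ResidueField B) b :=
  AlgEquiv.apply_symm_apply _ _

end Reduction

/-! ### Rings from products -/

section ProductRing

variable {R V : Type*} [CommRing R] [AddCommGroup V] [Module R V] {mul : V →ₗ[R] V →ₗ[R] V}

/-- The module `V` as a ring with the product `mul`. -/
def ProductRing (_ : IsCommProduct mul) : Type _ := V

namespace ProductRing

variable (h : IsCommProduct mul)

instance : CommRing (ProductRing h) :=
  { (inferInstanceAs (AddCommGroup V) : AddCommGroup (ProductRing h)) with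
    mul := fun a b => mul a b
    one := h.unit.choose
    left_distrib := fun a b c => (mul a).map_add b c
    right_distrib := fun a b c => mul.map_add₂ a b c
    zero_mul := fun a => mul.map_zero₂ a
    mul_zero := fun a => (mul a).map_zero
    mul_assoc := h.assoc
    mul_comm := h.comm
    one_mul := h.unit.choose_spec
    mul_one := fun a => (h.comm a _).trans (h.unit.choose_spec a) }

instance : Algebra R (ProductRing h) :=
  letI : Module R (ProductRing h) := inferInstanceAs (Module R V)
  Algebra.ofModule (fun r a b => mul.map_smul₂ r a b) (fun r a b => (mul a).map_smul r b)

/-- The identity map from `V` to the ring that it underlies. -/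
def equiv : V ≃ₗ[R] ProductRing h where
  toFun v := v
  invFun v := v
  map_add' _ _ := rfl
  map_smul' _ _ := rfl

lemma equiv_mul (a b : V) : equiv h (mul a b) = equiv h a * equiv h b := rfl

end ProductRing

end ProductRing

/-! ### Poisson deformations and Poisson products on `B ⊗ A` -/

section Realization

variable {k : Type u} [Field k] {A : Type u} [CommRing A] [Algebra k A]

variable {p : A →ₗ[k] A →ₗ[k] A} {B : ArtAlg k}

lemma tmul_eq_smul_one_tmul {E : Type u} [AddCommGroup E] [Module B E]
    (c : IsLocalRing.ResidueField B) (y : E) :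
    c ⊗ₜ[B] y = B.residueEquiv.symm c • ((1 : IsLocalRing.ResidueField B) ⊗ₜ[B] y) := by
  rw [smul_tmul', ← Algebra.algebraMap_eq_smul_one]
  congr 1
  exact (B.residueEquiv.apply_symm_apply c).symm

lemma one_tmul_smul {E : Type u} [AddCommGroup E] [Module B E] (b : B) (y : E) :
    (1 : IsLocalRing.ResidueField B) ⊗ₜ[B] (b • y) =
      B.augmentation b • ((1 : IsLocalRing.ResidueField B) ⊗ₜ[B] y) := by
  rw [← smul_tmul, smul_tmul' (B.augmentation b), ← Algebra.algebraMap_eq_smul_one,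
    ← Algebra.algebraMap_eq_smul_one, ← residueEquiv_augmentation]
  rfl

/-- The identification of the fibre of `B ⊗ A` with `A`. -/
def fibreReduction (B : ArtAlg k) :
    IsLocalRing.ResidueField B ⊗[B] (B ⊗[k] A) ≃ₗ[k] A :=
  ((AlgebraTensorModule.cancelBaseChange k B (IsLocalRing.ResidueField B)
    (IsLocalRing.ResidueField B) A).restrictScalars k).trans
  ((TensorProduct.congr B.residueEquiv.symm.toLinearEquiv (LinearEquiv.refl k A)).trans
    (TensorProduct.lid k A))

lemma fibreReduction_one_tmul (v : B ⊗[k] A) :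
    fibreReduction B (1 ⊗ₜ v) = reduction A B v := by
  induction v with
  | zero => simp
  | add x y hx hy => rw [tmul_add, map_add, map_add, hx, hy]
  | tmul b a =>
    rw [reduction_tmul]
    change B.residueEquiv.symm (b • (1 : IsLocalRing.ResidueField B)) • a = _
    rw [← Algebra.algebraMap_eq_smul_one]
    rfl

end Realization

section Realization

variable {k : Type u} [Field k] {A : Type u} [CommRing A] [Algebra k A]

variable {p : A →ₗ[k] A →ₗ[k] A} {B : ArtAlg k}
  {m q : B ⊗[k] A →ₗ[B] B ⊗[k] A →ₗ[B] B ⊗[k] A}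

lemma IsPoissonLift.reduction_mul (h : IsPoissonLift p B m q) (v w : B ⊗[k] A) :
    reduction A B (m v w) = reduction A B v * reduction A B w := by
  rw [(sub_mem_maxTensor_iff B).1 (h.mul_sub_mem v w), reduction_bilinExt]
  rfl

lemma IsPoissonLift.reduction_bracket (h : IsPoissonLift p B m q) (v w : B ⊗[k] A) :
    reduction A B (q v w) = p (reduction A B v) (reduction A B w) := by
  rw [(sub_mem_maxTensor_iff B).1 (h.bracket_sub_mem v w), reduction_bilinExt]

/-- The fibre of the ring `B ⊗ A` with a product lifting that of `A` is `A`, as a vector space. -/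
def liftFibre (h : IsPoissonLift p B m q) :
    IsLocalRing.ResidueField B ⊗[B] ProductRing h.isCommProduct ≃ₗ[k] A :=
  ((AlgebraTensorModule.congr (LinearEquiv.refl (IsLocalRing.ResidueField B)
    (IsLocalRing.ResidueField B)) (ProductRing.equiv h.isCommProduct).symm).restrictScalars k).trans
    (fibreReduction B)

lemma liftFibre_one_tmul (h : IsPoissonLift p B m q) (v : B ⊗[k] A) :
    liftFibre h (1 ⊗ₜ ProductRing.equiv h.isCommProduct v) = reduction A B v :=
  fibreReduction_one_tmul v

lemma liftFibre_mul (h : IsPoissonLift p B m q)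
    (x y : IsLocalRing.ResidueField B ⊗[B] ProductRing h.isCommProduct) :
    liftFibre h (x * y) = liftFibre h x * liftFibre h y := by
  induction x with
  | zero => simp
  | add x x' hx hx' => rw [add_mul, map_add, map_add, hx, hx', add_mul]
  | tmul c x =>
  induction y with
  | zero => simp
  | add y y' hy hy' => rw [mul_add, map_add, map_add, hy, hy', mul_add]
  | tmul d y =>
    obtain ⟨v, rfl⟩ := (ProductRing.equiv h.isCommProduct).surjective x
    obtain ⟨w, rfl⟩ := (ProductRing.equiv h.isCommProduct).surjective y
    rw [Algebra.TensorProduct.tmul_mul_tmul, ← ProductRing.equiv_mul, tmul_eq_smul_one_tmul (c * d),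
      tmul_eq_smul_one_tmul c, tmul_eq_smul_one_tmul d, map_smul, map_smul, map_smul,
      liftFibre_one_tmul, liftFibre_one_tmul, liftFibre_one_tmul, h.reduction_mul, map_mul,
      smul_mul_smul_comm]

/-- A surjective multiplicative map preserves the unit. -/
lemma map_one_of_map_mul_of_surjective {R S : Type*} [MulOneClass R] [CommMonoid S] {f : R → S}
    (hf : ∀ x y, f (x * y) = f x * f y) (hs : Function.Surjective f) : f 1 = 1 := by
  obtain ⟨x, hx⟩ := hs 1
  have := hf 1 x
  rw [one_mul, hx, mul_one] at this
  exact this.symm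

/-- The Poisson deformation given by a Poisson product on `B ⊗ A` that lifts the Poisson product
of `A`. -/
def deformationOfLift (h : IsPoissonLift p B m q) : PoissonDeformation p B where
  carrier := ProductRing h.isCommProduct
  flat := Module.Flat.of_linearEquiv (ProductRing.equiv h.isCommProduct).symm
  bracket := q.compl₁₂ (ProductRing.equiv h.isCommProduct).symm.toLinearMap
    (ProductRing.equiv h.isCommProduct).symm.toLinearMap |>.compr₂
      (ProductRing.equiv h.isCommProduct).toLinearMap
  isPoisson :=
    { skew := h.isPoissonBracket.skew
      leibniz := h.isPoissonBracket.leibniz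
      jacobi := h.isPoissonBracket.jacobi }
  π := AlgEquiv.ofLinearEquiv (liftFibre h)
    (map_one_of_map_mul_of_surjective (liftFibre_mul h) (liftFibre h).surjective) (liftFibre_mul h)
  π_bracket x y := by
    change liftFibre h _ = p (liftFibre h x) (liftFibre h y)
    induction x with
    | zero => simp
    | add x x' hx hx' => simp only [map_add, LinearMap.add_apply, hx, hx']
    | tmul c x =>
    induction y with
    | zero => simp
    | add y y' hy hy' => simp only [map_add, hy, hy']
    | tmul d y =>
      obtain ⟨v, rfl⟩ := (ProductRing.equiv h.isCommProduct).surjective x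
      obtain ⟨w, rfl⟩ := (ProductRing.equiv h.isCommProduct).surjective y
      rw [LinearMap.BilinMap.baseChange_tmul, tmul_eq_smul_one_tmul c, tmul_eq_smul_one_tmul d,
        tmul_eq_smul_one_tmul (c * d)]
      simp only [map_smul, LinearMap.smul_apply, liftFibre_one_tmul]
      rw [← h.reduction_bracket, map_mul, smul_smul, mul_comm (B.residueEquiv.symm d)]
      exact congrArg _ (liftFibre_one_tmul h _)

lemma deformationOfLift_isRealizedBy (h : IsPoissonLift p B m q) :
    (deformationOfLift h).IsRealizedBy m q :=
  ⟨ProductRing.equiv h.isCommProduct, fun _ _ => rfl, fun _ _ => rfl, fun a =>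
    (liftFibre_one_tmul h _).trans (reduction_one_tmul B a)⟩

namespace PoissonDeformation

lemma π_one_tmul_eq_reduction {E : PoissonDeformation p B} {θ : B ⊗[k] A →ₗ[B] E}
    (hθ : ∀ a : A, E.π (1 ⊗ₜ[B] θ (1 ⊗ₜ[k] a)) = a) (v : B ⊗[k] A) :
    E.π (1 ⊗ₜ[B] θ v) = reduction A B v := by
  induction v with
  | zero => simp
  | add x y hx hy => rw [map_add, tmul_add, map_add, map_add, hx, hy]
  | tmul b a =>
    have hb : b ⊗ₜ[k] a = b • ((1 : B) ⊗ₜ[k] a) := by rw [smul_tmul', smul_eq_mul, mul_one]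
    rw [hb, map_smul, one_tmul_smul, map_smul, hθ, reduction_smul, reduction_one_tmul]

lemma IsRealizedBy.of_equivalent {E F : PoissonDeformation p B} (hE : E.IsRealizedBy m q)
    (h : Equivalent E F) : F.IsRealizedBy m q := by
  obtain ⟨θ, h1, h2, h3⟩ := hE
  obtain ⟨ψ, h4, h5⟩ := h
  refine ⟨θ.trans ψ.toLinearEquiv, fun v w => ?_, fun v w => ?_, fun a => ?_⟩
  · change ψ (θ (m v w)) = ψ (θ v) * ψ (θ w)
    rw [h1, map_mul]
  · change ψ (θ (q v w)) = F.bracket (ψ (θ v)) (ψ (θ w))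
    rw [h2, h4]
  · exact (h5 (1 ⊗ₜ θ (1 ⊗ₜ a))).trans (h3 a)

variable {m' q' : B ⊗[k] A →ₗ[B] B ⊗[k] A →ₗ[B] B ⊗[k] A}

/-- Deformations realized by two Poisson products are equivalent if and only if the products are
isomorphic via an automorphism that is the identity modulo `m_B`. -/
lemma equivalent_iff_productsEquivalent {E F : PoissonDeformation p B} (hE : E.IsRealizedBy m q)
    (hF : F.IsRealizedBy m' q') : Equivalent E F ↔ ProductsEquivalent B m q m' q' := by
  obtain ⟨θ, h1, h2, h3⟩ := hE
  obtain ⟨θ', h1', h2', h3'⟩ := hF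
  have hr := π_one_tmul_eq_reduction (θ := θ.toLinearMap) h3
  have hr' := π_one_tmul_eq_reduction (θ := θ'.toLinearMap) h3'
  constructor
  · rintro ⟨ψ, h4, h5⟩
    have e (v : B ⊗[k] A) : θ' ((θ.trans ψ.toLinearEquiv |>.trans θ'.symm) v) = ψ (θ v) :=
      θ'.apply_symm_apply _
    refine ⟨θ.trans ψ.toLinearEquiv |>.trans θ'.symm, fun v => ?_, fun v w => ?_, fun v w => ?_⟩
    · rw [sub_mem_maxTensor_iff, ← hr', ← hr, ← h5]
      exact congrArg (fun y => F.π (1 ⊗ₜ y)) (e v)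
    · apply θ'.injective
      rw [h1', e, e, e, h1, map_mul]
    · apply θ'.injective
      rw [h2', e, e, e, h2, h4]
  · rintro ⟨φ, h4, h5, h6⟩
    let l : E ≃ₗ[B] F := θ.symm.trans (φ.trans θ')
    have hl (v : B ⊗[k] A) : l (θ v) = θ' (φ v) := by
      change θ' (φ (θ.symm (θ v))) = _
      rw [θ.symm_apply_apply]
    have hmul (x y : E) : l (x * y) = l x * l y := by
      obtain ⟨v, rfl⟩ := θ.surjective x
      obtain ⟨w, rfl⟩ := θ.surjective y
      rw [← h1, hl, hl, hl, h5, h1']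
    refine ⟨AlgEquiv.ofLinearEquiv l (map_one_of_map_mul_of_surjective hmul l.surjective) hmul,
      fun x y => ?_, fun z => ?_⟩
    · change l (E.bracket x y) = F.bracket (l x) (l y)
      obtain ⟨v, rfl⟩ := θ.surjective x
      obtain ⟨w, rfl⟩ := θ.surjective y
      rw [← h2, hl, hl, hl, h6, h2']
    · induction z with
      | zero => simp
      | add x y hx hy => rw [map_add, map_add, map_add, hx, hy]
      | tmul c x =>
        obtain ⟨v, rfl⟩ := θ.surjective x
        change F.π (c ⊗ₜ[B] l (θ v)) = _
        rw [hl, tmul_eq_smul_one_tmul c, tmul_eq_smul_one_tmul c, map_smul, map_smul]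
        congr 1
        exact (hr' _).trans (((sub_mem_maxTensor_iff B).1 (h4 v)).trans (hr v).symm)

end PoissonDeformation

end Realization

/-! ### Trivialization of flat deformations -/

section Trivialization

/-- Nakayama's lemma for a nilpotent ideal. -/
lemma eq_top_of_sup_smul_top_eq_top {R M : Type*} [CommRing R] [AddCommGroup M] [Module R M]
    {I : Ideal R} (hI : IsNilpotent I) {N : Submodule R M}
    (h : N ⊔ I • (⊤ : Submodule R M) = ⊤) : N = ⊤ := by
  obtain ⟨n, hn⟩ := hI
  have key (j : ℕ) : N ⊔ I ^ j • (⊤ : Submodule R M) = ⊤ := by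
    induction j with
    | zero => simp
    | succ j ih =>
      refine top_le_iff.1 ?_
      calc (⊤ : Submodule R M) = N ⊔ I • (N ⊔ I ^ j • (⊤ : Submodule R M)) := by rw [ih, h]
        _ ≤ N ⊔ I ^ (j + 1) • (⊤ : Submodule R M) := by
          rw [Submodule.smul_sup, ← Submodule.mul_smul, ← pow_succ']
          exact sup_le le_sup_left (sup_le (Submodule.smul_le_right.trans le_sup_left)
            le_sup_right)
  simpa [hn] using key n

variable {k : Type u} [Field k] {A : Type u} [CommRing A] [Algebra k A]

variable {p : A →ₗ[k] A →ₗ[k] A} {B : ArtAlg k}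

lemma one_tmul_eq_zero_iff {E : Type u} [AddCommGroup E] [Module B E] {y : E} :
    (1 : IsLocalRing.ResidueField B) ⊗ₜ[B] y = 0 ↔
      y ∈ IsLocalRing.maximalIdeal (B : Type u) • (⊤ : Submodule B E) := by
  rw [← Submodule.Quotient.mk_eq_zero, ← quotTensorEquivQuotSMul_mk_one_tmul,
    LinearEquiv.map_eq_zero_iff]
  exact Iff.rfl

namespace PoissonDeformation

/-- As a `B`-module, a flat deformation of `A` is isomorphic to `B ⊗ A`: lifts of a basis of `A`
form a basis, since they are independent by flatness and generate by Nakayama's lemma, which holds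
without finiteness because `m_B` is nilpotent. -/
lemma exists_linearEquiv (E : PoissonDeformation p B) :
    ∃ θ : B ⊗[k] A ≃ₗ[B] E, ∀ a : A, E.π (1 ⊗ₜ[B] θ (1 ⊗ₜ[k] a)) = a := by
  let b := Module.Basis.ofVectorSpace k A
  have hsurj (a : A) : ∃ y : E, E.π (1 ⊗ₜ y) = a := by
    obtain ⟨y, hy⟩ := TensorProduct.mk_surjective B E (IsLocalRing.ResidueField B)
      IsLocalRing.residue_surjective (E.π.symm a)
    exact ⟨y, by rw [AlgEquiv.eq_symm_apply] at hy; exact hy⟩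
  choose s hs using hsurj
  let θ : B ⊗[k] A →ₗ[B] E := (b.baseChange B).constr B fun i => s (b i)
  have hθb (i) : θ (1 ⊗ₜ b i) = s (b i) := by
    rw [← Module.Basis.baseChange_apply, Module.Basis.constr_basis]
  let g : A →ₗ[k] A :=
    { toFun := fun a => E.π (1 ⊗ₜ[B] θ (1 ⊗ₜ[k] a))
      map_add' := fun x y => by rw [tmul_add, map_add, tmul_add, map_add]
      map_smul' := fun c x => by
        rw [tmul_smul, ← algebraMap_smul (B : Type u) c ((1 : B) ⊗ₜ[k] x), map_smul,
          one_tmul_smul, map_smul, AlgHom.commutes]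
        rfl }
  have hθ (a : A) : E.π (1 ⊗ₜ[B] θ (1 ⊗ₜ[k] a)) = a := by
    refine LinearMap.congr_fun (f := g) (g := LinearMap.id) (b.ext fun i => ?_) a
    change E.π (1 ⊗ₜ[B] θ (1 ⊗ₜ[k] b i)) = b i
    rw [hθb, hs]
  -- flatness enters here: independence modulo `m_B` implies independence
  have hli : LinearIndependent B fun i => s (b i) := by
    refine Module.IsLocalRing.linearIndependent_of_flat _ ?_
    have := b.linearIndependent.map_of_surjective_injective (B.residueEquiv : k → _)
      E.π.symm.toLinearMap.toAddMonoidHom B.residueEquiv.surjective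
      (fun a ha => (map_eq_zero_iff E.π.symm E.π.symm.injective).1 ha) (fun c a => ?_)
    · convert this using 1
      ext i
      exact (E.π.symm_apply_eq.2 (hs (b i)).symm).symm
    · change E.π.symm (c • a) = _ • E.π.symm a
      rw [map_smul, ← algebraMap_smul (IsLocalRing.ResidueField B) c]
      rfl
  have hrange : LinearMap.range θ = ⊤ := by
    refine eq_top_of_sup_smul_top_eq_top B.isNilpotent_maximalIdeal (top_le_iff.1 fun y _ => ?_)
    rw [← add_sub_cancel (θ (1 ⊗ₜ E.π (1 ⊗ₜ y))) y]
    refine Submodule.add_mem_sup ⟨_, rfl⟩ (one_tmul_eq_zero_iff.1 ?_)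
    apply E.π.injective
    rw [tmul_sub, map_sub, hθ, sub_self, map_zero]
  have hspan : ⊤ ≤ Submodule.span B (Set.range fun i => s (b i)) := by
    rw [← hrange, Module.Basis.constr_range]
  refine ⟨(b.baseChange B).equiv (Module.Basis.mk hli hspan) (Equiv.refl _), fun a => ?_⟩
  have e : ((b.baseChange B).equiv (Module.Basis.mk hli hspan) (Equiv.refl _)).toLinearMap = θ :=
    (b.baseChange B).ext fun i => by
      rw [LinearEquiv.coe_coe, Module.Basis.equiv_apply, Module.Basis.mk_apply,
        Module.Basis.constr_basis]
      rfl
  exact (congrArg (fun f : B ⊗[k] A →ₗ[B] E => E.π (1 ⊗ₜ f (1 ⊗ₜ a))) e).trans (hθ a)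

/-- Every deformation of `A` is realized by a Poisson product on `B ⊗ A` that lifts the Poisson
product of `A`. -/
lemma exists_isRealizedBy (E : PoissonDeformation p B) :
    ∃ m q, IsPoissonLift p B m q ∧ E.IsRealizedBy m q := by
  obtain ⟨θ, hθ⟩ := E.exists_linearEquiv
  have hr := π_one_tmul_eq_reduction (θ := θ.toLinearMap) hθ
  let m : B ⊗[k] A →ₗ[B] B ⊗[k] A →ₗ[B] B ⊗[k] A :=
    ((LinearMap.mul B E).compl₁₂ θ.toLinearMap θ.toLinearMap).compr₂ θ.symm.toLinearMap
  let q : B ⊗[k] A →ₗ[B] B ⊗[k] A →ₗ[B] B ⊗[k] A :=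
    (E.bracket.compl₁₂ θ.toLinearMap θ.toLinearMap).compr₂ θ.symm.toLinearMap
  have hm (v w : B ⊗[k] A) : θ (m v w) = θ v * θ w := θ.apply_symm_apply _
  have hq (v w : B ⊗[k] A) : θ (q v w) = E.bracket (θ v) (θ w) := θ.apply_symm_apply _
  refine ⟨m, q, ⟨⟨fun v w => ?_, fun u v w => ?_, θ.symm 1, fun v => ?_⟩,
    ⟨fun v w => ?_, fun u v w => ?_, fun u v w => ?_⟩, fun v w => ?_, fun v w => ?_⟩,
    θ, hm, hq, hθ⟩
  · apply θ.injective
    rw [hm, hm, mul_comm]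
  · apply θ.injective
    rw [hm, hm, hm, hm, mul_assoc]
  · apply θ.injective
    rw [hm, θ.apply_symm_apply, one_mul]
  · apply θ.injective
    rw [map_neg, hq, hq, E.isPoisson.skew]
  · apply θ.injective
    rw [map_add, hq, hm, hm, hm, hq, hq]
    exact E.isPoisson.leibniz _ _ _
  · apply θ.injective
    rw [map_add, map_add, map_zero, hq, hq, hq, hq, hq, hq, E.isPoisson.jacobi]
  · rw [sub_mem_maxTensor_iff, reduction_bilinExt, ← hr, ← hr, ← hr]
    change E.π (1 ⊗ₜ θ (m v w)) = E.π (1 ⊗ₜ θ v) * E.π (1 ⊗ₜ θ w)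
    rw [hm, ← map_mul E.π, Algebra.TensorProduct.tmul_mul_tmul, one_mul]
  · rw [sub_mem_maxTensor_iff, reduction_bilinExt, ← hr, ← hr, ← hr]
    change E.π (1 ⊗ₜ θ (q v w)) = p (E.π (1 ⊗ₜ θ v)) (E.π (1 ⊗ₜ θ w))
    rw [hq, ← E.π_bracket, LinearMap.BilinMap.baseChange_tmul, one_mul]

end PoissonDeformation

end Trivialization

/-! ### Base change -/

section Naturality

variable {k : Type u} [Field k] {A : Type u} [CommRing A] [Algebra k A]

variable {p : A →ₗ[k] A →ₗ[k] A} {B B' : ArtAlg k}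

namespace PoissonDeformation

lemma IsRealizedBy.baseChange [Algebra B B'] [IsScalarTower k B B'] [IsLocalHom (algebraMap B B')]
    {E : PoissonDeformation p B} {m q : B ⊗[k] A →ₗ[B] B ⊗[k] A →ₗ[B] B ⊗[k] A}
    {m' q' : B' ⊗[k] A →ₗ[B'] B' ⊗[k] A →ₗ[B'] B' ⊗[k] A} (h : E.IsRealizedBy m q)
    (hm : ∀ a b : A, m' (1 ⊗ₜ a) (1 ⊗ₜ b) =
      TensorProduct.map (IsScalarTower.toAlgHom k B B').toLinearMap LinearMap.id
        (m (1 ⊗ₜ a) (1 ⊗ₜ b)))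
    (hq : ∀ a b : A, q' (1 ⊗ₜ a) (1 ⊗ₜ b) =
      TensorProduct.map (IsScalarTower.toAlgHom k B B').toLinearMap LinearMap.id
        (q (1 ⊗ₜ a) (1 ⊗ₜ b))) :
    (E.baseChange B').IsRealizedBy m' q' := by
  obtain ⟨θ, h1, h2, h3⟩ := h
  let θ' : B' ⊗[k] A ≃ₗ[B'] B' ⊗[B] E.carrier :=
    (AlgebraTensorModule.cancelBaseChange k B B' B' A).symm.trans
      (AlgebraTensorModule.congr (LinearEquiv.refl B' B') θ)
  have e (b : B') (a : A) : θ' (b ⊗ₜ a) = b ⊗ₜ θ (1 ⊗ₜ a) := rfl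
  have e' (v : B ⊗[k] A) : θ' (TensorProduct.map (IsScalarTower.toAlgHom k B B').toLinearMap
      LinearMap.id v) = 1 ⊗ₜ θ v := by
    induction v with
    | zero => simp
    | add v w hv hw => rw [map_add, map_add, hv, hw, map_add, tmul_add]
    | tmul b a =>
      have hb : b ⊗ₜ[k] a = b • ((1 : B) ⊗ₜ[k] a) := by rw [smul_tmul', smul_eq_mul, mul_one]
      rw [map_tmul, e, hb, map_smul, ← smul_tmul, Algebra.smul_def, mul_one]
      rfl
  refine ⟨θ', fun v w => ?_, fun v w => ?_, fun a => ?_⟩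
  · have := bilin_ext_one (f := m'.compr₂ θ'.toLinearMap)
      (g := (LinearMap.mul B' (B' ⊗[B] E.carrier)).compl₁₂ θ'.toLinearMap θ'.toLinearMap)
      fun a b => by
        change θ' (m' (1 ⊗ₜ a) (1 ⊗ₜ b)) = θ' (1 ⊗ₜ a) * θ' (1 ⊗ₜ b)
        rw [hm, e', h1, e, e, Algebra.TensorProduct.tmul_mul_tmul, one_mul]
    exact LinearMap.congr_fun₂ this v w
  · have := bilin_ext_one (f := q'.compr₂ θ'.toLinearMap)
      (g := (LinearMap.BilinMap.baseChange B' E.bracket).compl₁₂ θ'.toLinearMap θ'.toLinearMap)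
      fun a b => by
        change θ' (q' (1 ⊗ₜ a) (1 ⊗ₜ b)) =
          LinearMap.BilinMap.baseChange B' E.bracket (θ' (1 ⊗ₜ a)) (θ' (1 ⊗ₜ b))
        rw [hq, e', h2, e, e, LinearMap.BilinMap.baseChange_tmul, one_mul]
    exact LinearMap.congr_fun₂ this v w
  · change E.π (fibreEquiv B' E.carrier (1 ⊗ₜ θ' (1 ⊗ₜ a))) = a
    rw [e, fibreEquiv_tmul, one_smul, map_one, h3]

/-- Base change of deformations corresponds to extension of scalars of Poisson products. -/
lemma IsRealizedBy.pushforward (f : B ⟶ B')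
    {E : PoissonDeformation p B} {m q : B ⊗[k] A →ₗ[B] B ⊗[k] A →ₗ[B] B ⊗[k] A}
    {m' q' : B' ⊗[k] A →ₗ[B'] B' ⊗[k] A →ₗ[B'] B' ⊗[k] A} (h : E.IsRealizedBy m q)
    (hm : ∀ a b : A, m' (1 ⊗ₜ a) (1 ⊗ₜ b) =
      TensorProduct.map f.toAlgHom.toLinearMap LinearMap.id (m (1 ⊗ₜ a) (1 ⊗ₜ b)))
    (hq : ∀ a b : A, q' (1 ⊗ₜ a) (1 ⊗ₜ b) =
      TensorProduct.map f.toAlgHom.toLinearMap LinearMap.id (q (1 ⊗ₜ a) (1 ⊗ₜ b))) :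
    (E.pushforward f).IsRealizedBy m' q' :=
  let : Algebra B B' := f.toAlgHom.toRingHom.toAlgebra
  have : IsScalarTower k B B' := .of_algebraMap_eq fun c => (f.toAlgHom.commutes c).symm
  have : IsLocalHom (algebraMap B B') := f.isLocalHom
  h.baseChange hm hq

end PoissonDeformation

/-- The map `B ⊗ M → B' ⊗ M` induced by a morphism `B ⟶ B'`. -/
def scalarMap (M : Type u) [AddCommMonoid M] [Module k M] (f : B ⟶ B') : B ⊗[k] M →ₗ[k] B' ⊗[k] M :=
  TensorProduct.map f.toAlgHom.toLinearMap LinearMap.id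

lemma weightBilin_scalarMap (f : B ⟶ B') (i : ℕ) (x : B ⊗[k] TotalCochain k A) (a b : A) :
    weightBilin B' i (scalarMap _ f x) (1 ⊗ₜ a) (1 ⊗ₜ b) =
      scalarMap A f (weightBilin B i x (1 ⊗ₜ a) (1 ⊗ₜ b)) := by
  induction x with
  | zero => simp
  | add x y hx hy => simp only [map_add, LinearMap.add_apply, hx, hy]
  | tmul c t => simp [scalarMap, weightBilin, bilinExt_tmul, smul_tmul']

lemma bilinExt_scalarMap (f : B ⟶ B') (g : A →ₗ[k] A →ₗ[k] A) (a b : A) :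
    bilinExt B' g (1 ⊗ₜ a) (1 ⊗ₜ b) = scalarMap A f (bilinExt B g (1 ⊗ₜ a) (1 ⊗ₜ b)) := by
  simp [scalarMap, bilinExt_tmul]

/-- The Poisson products of the image of a Maurer–Cartan element under `B ⟶ B'` realize the base
change of the corresponding deformation. -/
lemma isRealizedBy_map (f : B ⟶ B') (x : (poissonDGLA p).MC B) {E : PoissonDeformation p B}
    (h : E.IsRealizedBy (deformedMul B x.1) (deformedBracket p B x.1)) :
    (E.pushforward f).IsRealizedBy (deformedMul B' (DGLAData.MC.map _ f x).1)
      (deformedBracket p B' (DGLAData.MC.map _ f x).1) :=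
  h.pushforward f
    (fun a b => (congrArg₂ (· + ·) (bilinExt_scalarMap f _ a b)
      (weightBilin_scalarMap f 1 x.1 a b)).trans (map_add (scalarMap A f) _ _).symm)
    (fun a b => (congrArg₂ (· + ·) (bilinExt_scalarMap f _ a b)
      (weightBilin_scalarMap f 2 x.1 a b)).trans (map_add (scalarMap A f) _ _).symm)

end Naturality

/-! ### The isomorphism of functors -/

section Functors

variable {k : Type u} [Field k] [CharZero k] {A : Type u} [CommRing A] [Algebra k A]

variable {p : A →ₗ[k] A →ₗ[k] A}

omit [CharZero k] in
lemma ProductsEquivalent.refl {B : ArtAlg k} (m q : B ⊗[k] A →ₗ[B] B ⊗[k] A →ₗ[B] B ⊗[k] A) :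
    ProductsEquivalent B m q m q :=
  ⟨LinearEquiv.refl B _, fun v => by simp, fun _ _ => rfl, fun _ _ => rfl⟩

variable (hp : IsPoissonBracket (LinearMap.mul k A) p)

/-- The map `Def(B) → PDef(B)` that sends the class of a Maurer–Cartan element to the class of
`B ⊗ A` with the corresponding Poisson product. -/
def defToPDef (B : ArtAlg k) : Quot ((poissonDGLA p).GaugeRel B) →
    Quotient (PoissonDeformation.setoid p B) :=
  Quot.lift (fun x => Quotient.mk _ (deformationOfLift (isPoissonLift_of_mc hp x))) fun x y h =>
    Quotient.sound <| (PoissonDeformation.equivalent_iff_productsEquivalent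
      (deformationOfLift_isRealizedBy _) (deformationOfLift_isRealizedBy _)).2
      ((gaugeRel_iff_productsEquivalent hp x y).1 h)

lemma defToPDef_mk_eq_iff {B : ArtAlg k} (x : (poissonDGLA p).MC B) (E : PoissonDeformation p B) :
    defToPDef hp B (Quot.mk _ x) = Quotient.mk _ E ↔
      E.IsRealizedBy (deformedMul B x.1) (deformedBracket p B x.1) :=
  ⟨fun h => (deformationOfLift_isRealizedBy _).of_equivalent (Quotient.exact h), fun h =>
    Quotient.sound ((PoissonDeformation.equivalent_iff_productsEquivalent
      (deformationOfLift_isRealizedBy _) h).2 (.refl _ _))⟩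

/-- Injectivity holds because equivalent deformations have isomorphic products and therefore gauge
equivalent Maurer–Cartan elements, surjectivity because flat deformations are trivial as modules. -/
lemma defToPDef_bijective (B : ArtAlg k) : Function.Bijective (defToPDef hp B) := by
  constructor
  · rintro ⟨x⟩ ⟨y⟩ h
    exact Quot.sound ((gaugeRel_iff_productsEquivalent hp x y).2
      ((PoissonDeformation.equivalent_iff_productsEquivalent (deformationOfLift_isRealizedBy _)
        (deformationOfLift_isRealizedBy _)).1 (Quotient.exact h)))
  · rintro ⟨E⟩
    obtain ⟨m, q, hmq, hE⟩ := E.exists_isRealizedBy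
    obtain ⟨x, rfl, rfl⟩ := exists_mc_of_isPoissonLift hp hmq
    exact ⟨Quot.mk _ x, (defToPDef_mk_eq_iff hp x E).2 hE⟩

lemma defToPDef_naturality {B B' : ArtAlg k} (f : B ⟶ B') (x : (poissonDGLA p).MC B) :
    defToPDef hp B' (Quot.mk _ (DGLAData.MC.map _ f x)) =
      (PDef p).map f (defToPDef hp B (Quot.mk _ x)) :=
  (defToPDef_mk_eq_iff hp _ _).2 (isRealizedBy_map f x (deformationOfLift_isRealizedBy _))

/-- The isomorphism of the deformation functor of `C_p(A)[1]` with `PDef_A`. -/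
def defIsoPDef : (poissonDGLA p).Def ⋙ uliftFunctor.{u + 1, u} ≅ PDef p :=
  NatIso.ofComponents
    (fun B => (Equiv.ulift.trans (Equiv.ofBijective _ (defToPDef_bijective hp B))).toIso)
    fun {B B'} f => by
      ext ⟨x⟩
      obtain ⟨x, rfl⟩ := Quot.exists_rep x
      exact defToPDef_naturality hp f x

end Functors

end PoissonDef

end

theorem proposition3p5 {k : Type u} [Field k] [CharZero k] {A : Type u} [CommRing A] [Algebra k A]
    (p : A →ₗ[k] A →ₗ[k] A) (hp : PoissonDef.IsPoissonBracket (LinearMap.mul k A) p) :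
    -- `C_p(A)[1]` is a dgla
    (PoissonDef.poissonDGLA p).IsDGLA ∧
    -- Maurer–Cartan elements correspond to Poisson products on `B ⊗ A` lifting that of `A`
    (∀ B : PoissonDef.ArtAlg k,
      Function.Injective (fun x : (PoissonDef.poissonDGLA p).MC B =>
        (PoissonDef.deformedMul B x.1, PoissonDef.deformedBracket p B x.1)) ∧
      Set.range (fun x : (PoissonDef.poissonDGLA p).MC B =>
        (PoissonDef.deformedMul B x.1, PoissonDef.deformedBracket p B x.1)) =
        {q | PoissonDef.IsPoissonLift p B q.1 q.2}) ∧
    -- gauge equivalence corresponds to isomorphism of Poisson products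
    (∀ (B : PoissonDef.ArtAlg k) (x y : (PoissonDef.poissonDGLA p).MC B),
      (PoissonDef.poissonDGLA p).GaugeRel B x y ↔
        PoissonDef.ProductsEquivalent B
          (PoissonDef.deformedMul B x.1) (PoissonDef.deformedBracket p B x.1)
          (PoissonDef.deformedMul B y.1) (PoissonDef.deformedBracket p B y.1)) ∧
    -- the deformation functor of `C_p(A)[1]` is isomorphic to `PDef_A`
    ∃ Φ : (PoissonDef.poissonDGLA p).Def ⋙ uliftFunctor.{u + 1, u} ≅ PoissonDef.PDef p,
      ∀ (B : PoissonDef.ArtAlg k) (x : (PoissonDef.poissonDGLA p).MC B)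
        (E : PoissonDef.PoissonDeformation p B),
        (Φ.hom.app B (ULift.up (Quot.mk _ x)) :
            Quotient (PoissonDef.PoissonDeformation.setoid p B)) = Quotient.mk _ E ↔
          E.IsRealizedBy (PoissonDef.deformedMul B x.1) (PoissonDef.deformedBracket p B x.1) := by
  exact ⟨PoissonDef.poissonDGLA_isDGLA hp,
    fun B => ⟨PoissonDef.deformed_injective hp, PoissonDef.range_deformed B hp⟩,
    fun _ x y => PoissonDef.gaugeRel_iff_productsEquivalent hp x y,
    PoissonDef.defIsoPDef hp, fun _ x E => PoissonDef.defToPDef_mk_eq_iff hp x E⟩
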